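/- **Setting.** Let $\Sigma=\mathbb Z^2$ be the square lattice with nearest-neighbour edges, and let the coupling constants $J=(J_e)_e$ of its edges be i.i.d. centred Gaussian variables of a fixed positive variance. A spin assignment $\sigma:\mathbb Z^2\to\{\pm1\}$ *satisfies* an edge $e=ij$ if $J_e\sigma_i\sigma_j>0$. It is a *ground state* if changing any finite set of spins does not lower the energy $-\sum_{ij}J_{ij}\sigma_i\sigma_j$; a *ground state pair* is $\{\sigma,-\sigma\}$ with $\sigma$ a ground state. The density of a set $A$ of edges in a square is the number of edges of $A$ contained in the square divided by the number of all edges of $\Sigma$ contained in it. Two ground state pairs are *incongruent* if the set of edges satisfied by exactly one of them has positive density in $\Sigma$, i.e. its density in the square of side $L$ centred at the origin converges to a positive number as $L\to\infty$. **Finite lattices.** For positive integers $n,k$ let $C(n,k)$ be the subgraph induced on the vertices $(x,y)$ with $|x|\le k$, $|y|\le n$. A *c-ground state* of $C(n,k)$ is a spin assignment whose boundary spins satisfy the maximum possible number of boundary edges and which has minimum energy among all assignments with the same boundary spins; $DIS(r)$ denotes the set of edges (of the finite lattice in question) not satisfied by $r$. A *plaquette* is a unit square of the lattice; it is *frustrated*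 if an odd number of its four edges have a negative coupling constant. $C(n,k)^*$ is the graph on the plaquettes of $C(n,k)$ in which every non-boundary edge $e$ of $C(n,k)$ gives an edge $e^*$ joining the two plaquettes containing $e$; $A^*=\{e^*:e\in A\}$. A horizontal row of plaquettes of $C(n,k)$ has $2k$ plaquettes; its *middle* plaquette is the one with horizontal extent $[0,1]$. The upper (lower) row of $C(n,k)$ is the row between heights $n-1$ and $n$ (between $-n$ and $-n+1$). * A row is *isolation* if its middle plaquette $M$ is its only frustrated plaquette, and every horizontal edge $e$ of the row that is not an edge of $M$ satisfies $|J_e|>\sum_{e'}|J_{e'}|$, the sum being over all edges $e'$ of $M$ and all vertical edges $e'$ of $\Sigma$ incident to a vertex of a plaquette of the row. * $R(n,k)$ is the event that for every $1\le k'\le k$ both $C(n,k')$ and $C(n-1,k')$ have an even number of boundary edges with negative coupling constant, that the upper and the lower row of $C(n,k)$ each have exactly one frustrated plaquette, the middle one, and that both these rows are isolation. * $R'(n,k)$ is the event that $R(n,k)$ holds and $R(n',k)$ fails for all $k\le n'<n$. * $BA(n,k)$ is the event that there are a c-ground state $r$ of $C(n-1,k)$, a c-ground state $s$ of $C(n,k)$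 and a path $P$ in $DIS(r)^*\,\Delta\,DIS(s)^*$ (in $C(n,k)^*$) from a frustrated plaquette of the upper row of $C(n,k)$ to a frustrated plaquette of the lower row, such that the set of edges $e$ with $e^*\in P$ contains an edge at distance at most $100$ from the origin and has density at least $1/100$ in the square of side $100\,k^{1/100}$ centred at the origin. **Finite conjecture.** There are a positive integer $c$ and $\epsilon>0$ such that for all integers $n\ge k>c+1$, the conditional probability of $BA(n,k)$ given that $R'(n,k)$ holds and $BA(n,k')$ holds for all $c+1<k'<k$ is at least $1-(k-c)^{-1}(\log(k-c))^{-1-\epsilon}$ (whenever the conditioning event has positive probability). **Main conjecture.** With probability strictly bigger than zero there are incongruent ground state pairs. **Theorem.** For every positive variance, the finite conjecture implies the main conjecture. -/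

import Mathlib

open MeasureTheory ProbabilityTheory Filter Topology
open scoped NNReal

noncomputable section

namespace SpinGlass

/-! ### The square lattice, spins and couplings -/

/-- Vertices of the square lattice `Σ`: `(x, y)` with `x` horizontal and `y` vertical. -/
abbrev Vertex := ℤ × ℤ

/-- Edges of the square lattice, each listed once: `(v, false)` is the horizontal edge from `v` to
`v + (1, 0)`, and `(v, true)` is the vertical edge from `v` to `v + (0, 1)`. -/
abbrev Edge := Vertex × Bool

/-- The left (resp. lower) endpoint of an edge. -/
def src (e : Edge) : Vertex := e.1

/-- The right (resp. upper) endpoint of an edge. -/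
def tgt (e : Edge) : Vertex := if e.2 then e.1 + (0, 1) else e.1 + (1, 0)

/-- Spin assignments; `ℤˣ = {1, -1}`. -/
abbrev Spins := Vertex → ℤˣ

/-- Assignments of coupling constants to the edges of the square lattice. -/
abbrev Couplings := Edge → ℝ

/-- The law of i.i.d. centred Gaussian couplings of variance `v`. -/
def couplingLaw (v : ℝ≥0) : Measure Couplings :=
  Measure.infinitePi (fun _ : Edge => gaussianReal 0 v)

/-- `J_{ij} σ_i σ_j` for the edge `e = ij`. -/
def bond (J : Couplings) (σ : Spins) (e : Edge) : ℝ :=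
  J e * ((σ (src e) : ℤ) : ℝ) * ((σ (tgt e) : ℤ) : ℝ)

/-- The edge `e` is satisfied by `σ`. -/
def Satisfied (J : Couplings) (σ : Spins) (e : Edge) : Prop := 0 < bond J σ e

/-- `σ` is a ground state of the square lattice: changing finitely many spins never lowers
the energy `-∑ J_{ij} σ_i σ_j`. (The sum of energy differences has finitely many nonzero terms.) -/
def IsGroundState (J : Couplings) (σ : Spins) : Prop :=
  ∀ τ : Spins, {u | τ u ≠ σ u}.Finite → 0 ≤ ∑ᶠ e : Edge, (-bond J τ e - -bond J σ e)

/-! ### Densities of sets of edges -/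

/-- The edges contained in the square of side length `L` centred at the origin. -/
def squareEdges (L : ℝ) : Set Edge :=
  {e | |((src e).1 : ℝ)| ≤ L / 2 ∧ |((src e).2 : ℝ)| ≤ L / 2 ∧
    |((tgt e).1 : ℝ)| ≤ L / 2 ∧ |((tgt e).2 : ℝ)| ≤ L / 2}

/-- The density of the edge set `A` in the square of side length `L` centred at the origin. -/
def densityIn (A : Set Edge) (L : ℝ) : ℝ :=
  ((A ∩ squareEdges L).ncard : ℝ) / ((squareEdges L).ncard : ℝ)

/-- The edge set `A` has a density in the whole lattice, and this density is positive. -/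
def HasPositiveDensity (A : Set Edge) : Prop :=
  ∃ d : ℝ, 0 < d ∧ Tendsto (densityIn A) atTop (𝓝 d)

/-- The edges satisfied by exactly one of `σ`, `τ` have positive density. This depends only on the
pairs `{σ, -σ}` and `{τ, -τ}`. -/
def Incongruent (J : Couplings) (σ τ : Spins) : Prop :=
  HasPositiveDensity {e | Xor (Satisfied J σ e) (Satisfied J τ e)}

/-- With positive probability there are incongruent ground state pairs. -/
def MainConjecture (v : ℝ≥0) : Prop :=
  0 < couplingLaw v
    {J | ∃ σ τ : Spins, IsGroundState J σ ∧ IsGroundState J τ ∧ Incongruent J σ τ}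

/-! ### The finite lattices `C(n, k)` and their c-ground states -/

/-- The vertices of `C(n, k)`: `|x| ≤ k` and `|y| ≤ n`. -/
def boxV (n k : ℕ) : Finset Vertex :=
  Finset.Icc (-(k : ℤ)) k ×ˢ Finset.Icc (-(n : ℤ)) n

/-- The edges of `C(n, k)`. -/
def boxE (n k : ℕ) : Finset Edge :=
  (boxV n k ×ˢ (Finset.univ : Finset Bool)).filter fun e => tgt e ∈ boxV n k

/-- The edges on the boundary of `C(n, k)`. -/
def bdryE (n k : ℕ) : Finset Edge :=
  (boxE n k).filter fun e => if e.2 then |e.1.1| = (k : ℤ) else |e.1.2| = (n : ℤ)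

/-- The vertices on the boundary of `C(n, k)`. -/
def bdryV (n k : ℕ) : Finset Vertex :=
  (boxV n k).filter fun u => |u.1| = (k : ℤ) ∨ |u.2| = (n : ℤ)

/-- The energy of `σ` in `C(n, k)`. -/
def energy (J : Couplings) (n k : ℕ) (σ : Spins) : ℝ := -∑ e ∈ boxE n k, bond J σ e

/-- The edges of `C(n, k)` on the boundary that are satisfied by `σ`. -/
def satBdry (J : Couplings) (n k : ℕ) (σ : Spins) : Set Edge :=
  {e | e ∈ bdryE n k ∧ Satisfied J σ e}

/-- `σ`, of which only the values on `C(n, k)` matter, is a c-ground state of `C(n, k)`: the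
boundary spins satisfy the maximum number of boundary edges, and `σ` has minimum energy among
the states with the same boundary spins. -/
def IsCGroundState (J : Couplings) (n k : ℕ) (σ : Spins) : Prop :=
  (∀ τ : Spins, (satBdry J n k τ).ncard ≤ (satBdry J n k σ).ncard) ∧
  ∀ τ : Spins, (∀ u ∈ bdryV n k, τ u = σ u) → energy J n k σ ≤ energy J n k τ

/-- `DIS(σ)`: the edges of `C(n, k)` dissatisfied by `σ`. -/
def DIS (J : Couplings) (n k : ℕ) (σ : Spins) : Set Edge :=
  {e | e ∈ boxE n k ∧ ¬ Satisfied J σ e}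

/-! ### Plaquettes and the dual graph -/

/-- Plaquettes (unit squares), given by their lower left corner. -/
abbrev Plaquette := ℤ × ℤ

/-- The four edges of a plaquette. -/
def plaqE (p : Plaquette) : Finset Edge :=
  {(p, false), (p, true), (p + (0, 1), false), (p + (1, 0), true)}

/-- A plaquette is frustrated if an odd number of its edges have negative coupling constants. -/
def Frustrated (J : Couplings) (p : Plaquette) : Prop :=
  Odd ((plaqE p).filter fun e => J e < 0).card

/-- The dual edge `e*`, joining the two plaquettes that contain `e`. -/
def dualEdge (e : Edge) : Sym2 Plaquette :=
  s(e.1, if e.2 then e.1 - (1, 0) else e.1 - (0, 1))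

/-- For a set `A` of edges, the subgraph of `C(n, k)*` formed by the `e*` with `e ∈ A`; an edge on
the boundary of `C(n, k)` has no dual edge in `C(n, k)*`. -/
def dualGraph (n k : ℕ) (A : Set Edge) : SimpleGraph Plaquette :=
  SimpleGraph.fromEdgeSet (dualEdge '' {e | e ∈ A ∧ e ∈ boxE n k ∧ e ∉ bdryE n k})

/-- The edges `e` whose dual edge `e*` lies on the walk `P`. -/
def crossed {G : SimpleGraph Plaquette} {p q : Plaquette} (P : G.Walk p q) : Set Edge :=
  {e | dualEdge e ∈ P.edges}

/-- The plaquettes of `DU(n, m, k)`, the part of `C(n, k)` with `m ≤ y ≤ n`. -/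
def DU (n m k : ℕ) : Finset Plaquette :=
  Finset.Ico (-(k : ℤ)) k ×ˢ Finset.Ico (m : ℤ) n

/-- The plaquettes of `DL(n, m, k)`, the part of `C(n, k)` with `-n ≤ y ≤ -m`. -/
def DL (n m k : ℕ) : Finset Plaquette :=
  Finset.Ico (-(k : ℤ)) k ×ˢ Finset.Ico (-(n : ℤ)) (-(m : ℤ))

/-! ### The events -/

/-- `C(n, k), C(m, k)` is a regular pair. A row of `C(n, k)` has the `2 k` plaquettes
with lower left corners `(x, y)`, `-k ≤ x < k`; its middle plaquette is the one with `x = 0`. -/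
def RegularPair (J : Couplings) (n m k : ℕ) : Prop :=
  (∀ k' : ℕ, 1 ≤ k' → k' ≤ k →
    Even ((bdryE n k').filter fun e => J e < 0).card ∧
    Even ((bdryE m k').filter fun e => J e < 0).card) ∧
  (∀ p ∈ DU n m k, Frustrated J p ↔ p = (0, (m : ℤ))) ∧
  (∀ p ∈ DL n m k, Frustrated J p ↔ p = (0, -(m : ℤ) - 1))

/-- The horizontal edges of the plaquettes in the row of `C(n, k)` with `y` as lower level. -/
def rowHoriz (k : ℕ) (y : ℤ) : Finset Edge :=
  (Finset.Ico (-(k : ℤ)) k ×ˢ ({y, y + 1} : Finset ℤ)) ×ˢ {false}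

/-- The vertical edges of the square lattice incident to a vertex of a plaquette of that row. -/
def rowVert (k : ℕ) (y : ℤ) : Finset Edge :=
  (Finset.Icc (-(k : ℤ)) k ×ˢ Finset.Icc (y - 1) (y + 1)) ×ˢ {true}

/-- The row of plaquettes with `-k ≤ x < k` and lower level `y` is isolation. -/
def IsIsolation (J : Couplings) (k : ℕ) (y : ℤ) : Prop :=
  (∀ x ∈ Finset.Ico (-(k : ℤ)) k, Frustrated J (x, y) ↔ x = 0) ∧
  ∀ e ∈ rowHoriz k y, e ∉ plaqE (0, y) →
    ∑ e' ∈ plaqE (0, y) ∪ rowVert k y, |J e'| < |J e|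

/-- `R(n, k)` (for `n ≥ 1`): `C(n, k), C(n - 1, k)` is a regular pair and both boundary rows of
plaquettes of `C(n, k)` are isolation. -/
def R (n k : ℕ) : Set Couplings :=
  {J | RegularPair J n (n - 1) k ∧ IsIsolation J k ((n : ℤ) - 1) ∧ IsIsolation J k (-(n : ℤ))}

/-- `R'(n, k)`: `R(n, k)` holds, and `R(n', k)` fails for `k ≤ n' < n`. -/
def R' (n k : ℕ) : Set Couplings :=
  {J | J ∈ R n k ∧ ∀ n' : ℕ, k ≤ n' → n' < n → J ∉ R n' k}

/-- The edge `e` is at (Euclidean) distance at most `d` from the origin. (The point of `e` nearest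
to the origin is one of its endpoints.) -/
def NearOrigin (d : ℤ) (e : Edge) : Prop :=
  (src e).1 ^ 2 + (src e).2 ^ 2 ≤ d ^ 2 ∨ (tgt e).1 ^ 2 + (tgt e).2 ^ 2 ≤ d ^ 2

/-- `BA(n, k)` (for `n ≥ 1`). -/
def BA (n k : ℕ) : Set Couplings :=
  {J | ∃ r s : Spins, IsCGroundState J (n - 1) k r ∧ IsCGroundState J n k s ∧
    ∃ p ∈ DU n (n - 1) k, ∃ q ∈ DL n (n - 1) k, Frustrated J p ∧ Frustrated J q ∧
    ∃ P : (dualGraph n k (symmDiff (DIS J (n - 1) k r) (DIS J n k s))).Walk p q,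
      P.IsPath ∧ (∃ e ∈ crossed P, NearOrigin 100 e) ∧
      1 / 100 ≤ densityIn (crossed P) (100 * (k : ℝ) ^ (1 / 100 : ℝ))}

/-- The couplings in `R'(n, k)` that lie in `BA(n, k')` for all `c + 1 < k' < k`. -/
def condEvent (c n k : ℕ) : Set Couplings :=
  {J | J ∈ R' n k ∧ ∀ k' : ℕ, c + 1 < k' → k' < k → J ∈ BA n k'}

/-- The finite conjecture. The conditional probability is considered whenever the conditioning
event has positive probability. -/
def FiniteConjecture (v : ℝ≥0) : Prop :=
  ∃ c : ℕ, 0 < c ∧ ∃ ε : ℝ, 0 < ε ∧ ∀ n k : ℕ, c + 1 < k → k ≤ n →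
    couplingLaw v (condEvent c n k) ≠ 0 →
      1 - ((k : ℝ) - c)⁻¹ * Real.log ((k : ℝ) - c) ^ (-1 - ε) ≤
        ((couplingLaw v)[|condEvent c n k]).real (BA n k)

end SpinGlass

end

noncomputable section

open MeasureTheory ProbabilityTheory Filter Topology
open scoped NNReal

namespace SpinGlass

/-! ### Spins, signs and cuts -/

/-! The proof has a finite part, which turns the conditional bounds of the finite conjecture into
one bound that is uniform in `k`, and an infinite part, which extracts incongruent ground states
from a translation invariant limit.

Geometry. When `R n k` holds, all boundary edges of both boxes can be satisfied, while each extreme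
row has one frustrated plaquette, in the middle. Therefore the c-ground states `r` of the smaller
box and `s` of the larger one have opposite relative signs on the left and on the right side
(`R.exists_twistedPair`), and by parity the duals of the edges on which they differ connect the two
middle plaquettes (`CPair.reachable`). A `StrongLine` is a horizontal line whose couplings, except
at one hole, dominate everything near it; a dual path in the difference can cross it only at the
hole (`CPair.adj_cross`). For generic couplings, the couplings between two strong lines determine
the pair `r`, `s` there up to signs and order, hence the difference of `r` and `s`
(`TwistedPair.block_eq`). So the event `BA n k` depends neither on the couplings beyond two remote
strong lines nor on `n` (`BA.transfer`).

Induction on `k`. `Good` records an event in a finite band that rules out early occurrences of `R`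
and forces `BA` at every later one. The step to `k + 1` (`Good.step`) avoids `R n (k + 1)` for a
further range of heights, so that the first occurrence of `R` comes later and the conditioning event
of the conjecture holds at it; it then applies the conjecture, finds strong lines in the new range,
and uses them to make the outcome local again. Finding strong lines needs about `1 / u` attempts,
where `u` is the probability of a strong line, whereas an occurrence of `R` also needs a frustration
pattern of probability `4⁻ᵏ`, so avoiding it is cheap. The negative logarithm of the probability is
multiplied in each step by one plus a summable term, since `1 / (j (log j) ^ (1 + ε))` is summable
(`iterate_bound`, `exists_uniform_good`). The induction starts from a winding channel that forces
the path to fill a strip (`exists_good`). The result is `exists_measure_BA_ge`.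

Limit. The couplings together with two finite volume states are averaged over translations in the
square of `BA`. These laws are tight, and a limit point is translation invariant, has the original
law of couplings, lives on pairs of ground states, and has positive mean density of difference
(`exists_invariant`). The ergodic theorem gives almost sure densities along squares. If incongruent
pairs had probability zero these densities would vanish, contradicting the positive mean. -/

/-- The product of the two spins at the ends of an edge. -/
def agree (σ : Spins) (e : Edge) : ℤˣ := σ (src e) * σ (tgt e)

/-- The sign of a coupling constant, where `0` counts as positive. -/
def sg (J : Couplings) (e : Edge) : ℤˣ := if J e < 0 then -1 else 1

lemma bond_eq (J : Couplings) (σ : Spins) (e : Edge) :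
    bond J σ e = J e * ((agree σ e : ℤ) : ℝ) := by
  simp [bond, agree, mul_assoc]

lemma abs_bond (J : Couplings) (σ : Spins) (e : Edge) : |bond J σ e| = |J e| := by
  rw [bond_eq, abs_mul]
  rcases Int.units_eq_one_or (agree σ e) with h | h <;> simp [h]

lemma satisfied_iff {J : Couplings} {σ : Spins} {e : Edge} (h : J e ≠ 0) :
    Satisfied J σ e ↔ agree σ e = sg J e := by
  rw [Satisfied, bond_eq, sg]
  rcases Int.units_eq_one_or (agree σ e) with h' | h' <;> rw [h'] <;>
    rcases lt_or_gt_of_ne h with h1 | h1 <;> simp [h1, not_lt.2 h1.le]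

lemma bond_of_not_satisfied {J : Couplings} {σ : Spins} {e : Edge} (h : ¬ Satisfied J σ e) :
    bond J σ e = -|J e| := by
  rw [← abs_bond J σ e, abs_of_nonpos (not_lt.1 h), neg_neg]

/-- The edges incident to a vertex. -/
def incE (u : Vertex) : Finset Edge :=
  {(u, false), (u, true), (u - (1, 0), false), (u - (0, 1), true)}

lemma mem_incE {u : Vertex} {e : Edge} : e ∈ incE u ↔ src e = u ∨ tgt e = u := by
  rcases e with ⟨⟨x, y⟩, _ | _⟩ <;> rcases u with ⟨a, b⟩ <;>
    simp [incE, src, tgt, Prod.ext_iff, eq_sub_iff_add_eq]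

/-- The edges with exactly one end in `W`. -/
def cutE (W : Finset Vertex) : Finset Edge :=
  (W.biUnion incE).filter fun e => ¬ (src e ∈ W ↔ tgt e ∈ W)

lemma mem_cutE {W : Finset Vertex} {e : Edge} : e ∈ cutE W ↔ ¬ (src e ∈ W ↔ tgt e ∈ W) := by
  simp only [cutE, Finset.mem_filter, Finset.mem_biUnion, mem_incE, and_iff_right_iff_imp]
  intro h
  by_cases h1 : src e ∈ W
  · exact ⟨_, h1, Or.inl rfl⟩
  · exact ⟨tgt e, by tauto, Or.inr rfl⟩

/-- Flipping the spins in `W`. -/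
def flipOn (W : Finset Vertex) (σ : Spins) : Spins := fun u => if u ∈ W then -σ u else σ u

lemma agree_flipOn (W : Finset Vertex) (σ : Spins) (e : Edge) :
    agree (flipOn W σ) e = if e ∈ cutE W then -agree σ e else agree σ e := by
  simp only [mem_cutE, agree, flipOn]
  by_cases h1 : src e ∈ W <;> by_cases h2 : tgt e ∈ W <;> simp [h1, h2]

lemma bond_flipOn (J : Couplings) (W : Finset Vertex) (σ : Spins) (e : Edge) :
    bond J (flipOn W σ) e = if e ∈ cutE W then -bond J σ e else bond J σ e := by
  rw [bond_eq, bond_eq, agree_flipOn]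
  split_ifs <;> simp

lemma sum_bond_flipOn (J : Couplings) (W : Finset Vertex) (σ : Spins) {B : Finset Edge}
    (hB : cutE W ⊆ B) :
    ∑ e ∈ B, bond J (flipOn W σ) e = ∑ e ∈ B, bond J σ e - 2 * ∑ e ∈ cutE W, bond J σ e := by
  have h : ∑ e ∈ B, (bond J σ e - bond J (flipOn W σ) e)
      = ∑ e ∈ cutE W, (bond J σ e - bond J (flipOn W σ) e) := by
    symm
    apply Finset.sum_subset hB
    intro e _ he
    simp [bond_flipOn, he]
  have h2 : ∑ e ∈ cutE W, (bond J σ e - bond J (flipOn W σ) e)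
      = 2 * ∑ e ∈ cutE W, bond J σ e := by
    rw [Finset.mul_sum]
    apply Finset.sum_congr rfl
    intro e he
    rw [bond_flipOn, if_pos he]; ring
  rw [Finset.sum_sub_distrib] at h
  linarith

/-- No flip of a finite set of vertices `(x, y)` with `|x| < k`, `|y| < b` lowers the energy. -/
def CutOpt (J : Couplings) (σ : Spins) (k b : ℤ) : Prop :=
  ∀ W : Finset Vertex, (∀ u ∈ W, |u.1| < k ∧ |u.2| < b) → 0 ≤ ∑ e ∈ cutE W, bond J σ e

lemma CutOpt.mono {J : Couplings} {σ : Spins} {k b k' b' : ℤ} (h : CutOpt J σ k b)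
    (hk : k' ≤ k) (hb : b' ≤ b) : CutOpt J σ k' b' := fun W hW =>
  h W fun u hu => ⟨(hW u hu).1.trans_le hk, (hW u hu).2.trans_le hb⟩

lemma mem_boxV {n k : ℕ} {u : Vertex} :
    u ∈ boxV n k ↔ |u.1| ≤ (k : ℤ) ∧ |u.2| ≤ (n : ℤ) := by
  simp [boxV, Finset.mem_product, abs_le]

lemma mem_boxE {n k : ℕ} {e : Edge} :
    e ∈ boxE n k ↔ src e ∈ boxV n k ∧ tgt e ∈ boxV n k := by
  simp [boxE, Finset.mem_product, src]

lemma cutE_subset_boxE {n k : ℕ} {W : Finset Vertex}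
    (hW : ∀ u ∈ W, |u.1| < (k : ℤ) ∧ |u.2| < (n : ℤ)) : cutE W ⊆ boxE n k := by
  intro e he
  rw [mem_cutE] at he
  have key : (|(src e).1| < (k : ℤ) ∧ |(src e).2| < (n : ℤ)) ∨
      (|(tgt e).1| < (k : ℤ) ∧ |(tgt e).2| < (n : ℤ)) := by
    by_cases h : src e ∈ W
    · exact Or.inl (hW _ h)
    · exact Or.inr (hW _ (by tauto))
  rw [mem_boxE, mem_boxV, mem_boxV]
  rcases e with ⟨⟨x, y⟩, _ | _⟩ <;> simp only [src, tgt, abs_le, abs_lt] at * <;>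
    simp at * <;> omega

/-- Flipping interior vertices keeps the boundary spins, so such flips are admissible competitors.
-/
lemma IsCGroundState.cutOpt {J : Couplings} {n k : ℕ} {σ : Spins} (h : IsCGroundState J n k σ) :
    CutOpt J σ k n := by
  intro W hW
  have h1 := h.2 (flipOn W σ) (by
    intro u hu
    simp only [bdryV, Finset.mem_filter] at hu
    have : u ∉ W := fun hu' => by
      have := hW u hu'
      rcases hu.2 with h | h <;> omega
    simp [flipOn, this])
  simp only [energy] at h1
  rw [sum_bond_flipOn J W σ (cutE_subset_boxE hW)] at h1
  linarith

lemma isGroundState_of_cut {J : Couplings} {σ : Spins}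
    (h : ∀ W : Finset Vertex, 0 ≤ ∑ e ∈ cutE W, bond J σ e) : IsGroundState J σ := by
  intro τ hτ
  set W := hτ.toFinset
  have hτW : τ = flipOn W σ := by
    funext u
    by_cases hu : u ∈ W
    · have hu' : τ u ≠ σ u := by simpa [W] using hu
      rw [flipOn, if_pos hu]
      rcases Int.units_eq_one_or (τ u) with h1 | h1 <;>
        rcases Int.units_eq_one_or (σ u) with h2 | h2 <;> simp_all
    · have hu' : τ u = σ u := by simpa [W] using hu
      rw [flipOn, if_neg hu, hu']
  rw [finsum_eq_sum_of_support_subset (s := cutE W)]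
  · have := sum_bond_flipOn J W σ (Finset.Subset.refl _)
    rw [← hτW] at this
    rw [Finset.sum_congr rfl (fun e _ => show -bond J τ e - -bond J σ e = bond J σ e - bond J τ e
      by ring), Finset.sum_sub_distrib, this]
    linarith [h W]
  · intro e he
    by_contra hc
    apply he
    simp only [hτW, bond_flipOn]
    rw [if_neg (by simpa using hc)]; ring

/-! ### Boundary spins -/

/-- The product of `f` over an interval of integers. -/
def prodI (f : ℤ → ℤˣ) (a b : ℤ) : ℤˣ := ∏ i ∈ Finset.Ico a b, f i

lemma prodI_self (f : ℤ → ℤˣ) (a : ℤ) : prodI f a a = 1 := by simp [prodI]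

lemma prodI_succ (f : ℤ → ℤˣ) {a b : ℤ} (h : a ≤ b) :
    prodI f a (b + 1) = prodI f a b * f b := by
  have : Finset.Ico a (b + 1) = insert b (Finset.Ico a b) := by
    ext x; simp only [Finset.mem_insert, Finset.mem_Ico]; omega
  rw [prodI, this, Finset.prod_insert (by simp), mul_comm, prodI]

lemma bdryE_eq {n k : ℕ} :
    bdryE n k = ((Finset.Ico (-(k : ℤ)) k ×ˢ ({-(n : ℤ), (n : ℤ)} : Finset ℤ)) ×ˢ {false}) ∪
      ((({-(k : ℤ), (k : ℤ)} : Finset ℤ) ×ˢ Finset.Ico (-(n : ℤ)) n) ×ˢ {true}) := by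
  ext ⟨⟨x, y⟩, _ | _⟩ <;>
    simp [bdryE, boxE, boxV, tgt, abs_eq (Int.natCast_nonneg _)] <;> omega

lemma prod_bdryE (f : Edge → ℤˣ) {n k : ℕ} (hn : 1 ≤ n) (hk : 1 ≤ k) :
    ∏ e ∈ bdryE n k, f e =
      (prodI (fun x => f ((x, -(n : ℤ)), false)) (-k) k *
        prodI (fun x => f ((x, (n : ℤ)), false)) (-k) k) *
      (prodI (fun y => f ((-(k : ℤ), y), true)) (-n) n *
        prodI (fun y => f (((k : ℤ), y), true)) (-n) n) := by
  rw [bdryE_eq, Finset.prod_union]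
  · congr 1
    · rw [Finset.prod_product, Finset.prod_product]
      simp only [Finset.prod_singleton]
      rw [Finset.prod_congr rfl (fun x _ => Finset.prod_pair (by omega)), Finset.prod_mul_distrib]
      rfl
    · rw [Finset.prod_product, Finset.prod_product]
      simp only [Finset.prod_singleton]
      rw [Finset.prod_pair (by omega)]
      rfl
  · rw [Finset.disjoint_left]
    rintro ⟨⟨x, y⟩, b⟩ h1 h2
    simp at h1 h2
    rw [h1.2] at h2; simp at h2

lemma prod_sg_eq_one_iff (J : Couplings) (S : Finset Edge) :
    ∏ e ∈ S, sg J e = 1 ↔ Even (S.filter fun e => J e < 0).card := by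
  simp only [sg]
  rw [Finset.prod_ite]
  simp only [Finset.prod_const, one_pow, mul_one]
  constructor
  · intro h
    by_contra hc
    rw [Nat.not_even_iff_odd] at hc
    rw [hc.neg_one_pow] at h
    exact absurd h (by decide)
  · intro h
    exact h.neg_one_pow

lemma units_mul_self (u : ℤˣ) : u * u = 1 := Int.units_mul_self u

/-- The boundary is a cycle, and a sign assignment on a cycle comes from spins exactly when its
product is `1`. -/
lemma exists_boundary_spins (J : Couplings) {n k : ℕ} (hn : 1 ≤ n) (hk : 1 ≤ k)
    (h : ∏ e ∈ bdryE n k, sg J e = 1) :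
    ∃ τ : Spins, ∀ e ∈ bdryE n k, agree τ e = sg J e := by
  rw [prod_bdryE _ hn hk] at h
  set B := fun x : ℤ => sg J ((x, -(n : ℤ)), false) with hB
  set T := fun x : ℤ => sg J ((x, (n : ℤ)), false) with hT
  set L := fun y : ℤ => sg J ((-(k : ℤ), y), true) with hL
  set Rt := fun y : ℤ => sg J (((k : ℤ), y), true) with hRt
  -- The signs are integrated from the lower left corner: along the bottom, up both sides, and along
  -- the top from the left. The hypothesis on the product is needed only at the top edge that ends
  -- in the upper right corner.
  refine ⟨fun u => if u.2 = -n then prodI B (-k) u.1 else if u.1 = -k then prodI L (-n) u.2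
    else if u.1 = k then prodI B (-k) k * prodI Rt (-n) u.2
    else prodI L (-n) n * prodI T (-k) u.1, ?_⟩
  rintro ⟨⟨x, y⟩, b⟩ he
  rw [bdryE_eq] at he
  simp only [Finset.mem_union, Finset.mem_product, Finset.mem_Ico, Finset.mem_insert,
    Finset.mem_singleton] at he
  rcases b with _ | _
  · simp only [and_true, and_false, or_false, Bool.false_eq_true] at he
    obtain ⟨⟨h1, h2⟩, rfl | rfl⟩ := he
    · simp only [agree, src, tgt, Bool.false_eq_true, if_false, Prod.fst_add, Prod.snd_add, add_zero,
        if_true]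
      rw [prodI_succ _ h1, ← mul_assoc, units_mul_self, one_mul]
    · have hn' : ¬ ((n : ℤ) = -n) := by omega
      have hx1 : ¬ (x + 1 = -(k : ℤ)) := by omega
      have hxk : ¬ (x = (k : ℤ)) := by omega
      simp only [agree, src, tgt, Bool.false_eq_true, if_false, Prod.fst_add, Prod.snd_add, add_zero,
        hn', hx1, hxk]
      have e1 : (if x = -(k : ℤ) then prodI L (-n) n else prodI L (-n) n * prodI T (-k) x)
          = prodI L (-n) n * prodI T (-k) x := by
        split_ifs with hx
        · rw [hx, prodI_self, mul_one]
        · rfl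
      rw [e1]
      split_ifs with hx
      · have hk' : prodI T (-k) k = prodI T (-k) x * T x := by
          rw [← prodI_succ _ h1, hx]
        rw [hk'] at h
        have : sg J ((x, (n : ℤ)), false) = T x := rfl
        rw [this]
        generalize prodI B (-k) k = a1 at *
        generalize prodI L (-n) n = a2 at *
        generalize prodI Rt (-n) n = a3 at *
        generalize prodI T (-k) x = a4 at *
        generalize T x = a5 at *
        clear * - h
        revert h a1 a2 a3 a4 a5
        decide
      · rw [prodI_succ _ h1]
        have : sg J ((x, (n : ℤ)), false) = T x := rfl
        rw [this]
        generalize prodI L (-n) n = a2 at *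
        generalize prodI T (-k) x = a4 at *
        generalize T x = a5 at *
        clear * -
        revert a2 a4 a5
        decide
  · simp only [and_true, and_false, false_or, reduceCtorEq] at he
    obtain ⟨rfl | rfl, h1, h2⟩ := he
    · have hy1 : ¬ (y + 1 = -(n : ℤ)) := by omega
      simp only [agree, src, tgt, if_true, Prod.fst_add, Prod.snd_add, add_zero, hy1, if_false]
      have e1 : (if y = -(n : ℤ) then prodI B (-k) (-k) else prodI L (-n) y) = prodI L (-n) y := by
        split_ifs with hx
        · rw [hx, prodI_self, prodI_self]
        · rfl
      rw [e1, prodI_succ _ h1, ← mul_assoc, units_mul_self, one_mul]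
    · have hy1 : ¬ (y + 1 = -(n : ℤ)) := by omega
      have hkk : ¬ ((k : ℤ) = -k) := by omega
      simp only [agree, src, tgt, if_true, Prod.fst_add, Prod.snd_add, add_zero, hy1, hkk, if_false]
      have e1 : (if y = -(n : ℤ) then prodI B (-k) k else prodI B (-k) k * prodI Rt (-n) y)
          = prodI B (-k) k * prodI Rt (-n) y := by
        split_ifs with hx
        · rw [hx, prodI_self, mul_one]
        · rfl
      rw [e1, prodI_succ _ h1]
      have : sg J (((k : ℤ), y), true) = Rt y := rfl
      rw [this]
      generalize prodI B (-k) k = a2 at *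
      generalize prodI Rt (-n) y = a4 at *
      generalize Rt y = a5 at *
      clear * -
      revert a2 a4 a5
      decide

/-- By parity some assignment satisfies the whole boundary, so a maximizer must do the same. -/
lemma IsCGroundState.boundary {J : Couplings} (hJ : ∀ e, J e ≠ 0) {n k : ℕ} (hn : 1 ≤ n)
    (hk : 1 ≤ k) (h : Even ((bdryE n k).filter fun e => J e < 0).card) {σ : Spins}
    (hσ : IsCGroundState J n k σ) : ∀ e ∈ bdryE n k, agree σ e = sg J e := by
  obtain ⟨τ, hτ⟩ := exists_boundary_spins J hn hk ((prod_sg_eq_one_iff J _).2 h)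
  have h1 := hσ.1 τ
  have h2 : satBdry J n k τ = ↑(bdryE n k) := by
    ext e
    simp only [satBdry, Set.mem_ofPred_eq, Finset.mem_coe, and_iff_left_iff_imp]
    exact fun he => (satisfied_iff (hJ e)).2 (hτ e he)
  have h3 : satBdry J n k σ ⊆ ↑(bdryE n k) := fun e he => he.1
  rw [h2] at h1
  have h4 := Set.eq_of_subset_of_ncard_le h3 h1 (Finset.finite_toSet _)
  intro e he
  have : e ∈ satBdry J n k σ := by rw [h4]; exact he
  exact (satisfied_iff (hJ e)).1 this.2


/-! ### Strong lines -/

/-- The horizontal edge from `(x, y)` to `(x + 1, y)`. -/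
abbrev hE (x y : ℤ) : Edge := ((x, y), false)

/-- The vertical edge from `(x, y)` to `(x, y + 1)`. -/
abbrev vE (x y : ℤ) : Edge := ((x, y), true)

/-- The horizontal edge at the hole `x₀` of the line at height `y`, and the vertical edges incident
to this line. -/
def lineNbr (k : ℕ) (x₀ y : ℤ) : Finset Edge :=
  insert (hE x₀ y) ((Finset.Icc (-(k : ℤ)) k ×ˢ ({y - 1, y} : Finset ℤ)) ×ˢ {true})

/-- Except at the hole `x₀`, the horizontal edges at height `y` dominate the line. -/
def StrongLine (J : Couplings) (k : ℕ) (x₀ y : ℤ) : Prop :=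
  ∀ x ∈ Finset.Ico (-(k : ℤ)) k, x ≠ x₀ → ∑ e ∈ lineNbr k x₀ y, |J e| < |J (hE x y)|

/-- If the edge were dissatisfied, flipping the part of the line between it and the hole would gain
more than the hole edge and all vertical edges at the line could cost. -/
lemma StrongLine.satisfied {J : Couplings} {K : ℕ} {x₀ y : ℤ} (h : StrongLine J K x₀ y) {k b : ℤ}
    (hk : k ≤ K) (hx₀ : x₀ ∈ Finset.Ico (-k) k) {σ : Spins} (hσ : CutOpt J σ k b) (hy : |y| < b)
    {x : ℤ} (hx : x ∈ Finset.Ico (-k) k) (hne : x ≠ x₀) : Satisfied J σ (hE x y) := by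
  by_contra hc
  rw [Finset.mem_Ico] at hx hx₀
  -- These vertices start just after the left one of the two edges `x`, `x₀` and end at the left end
  -- of the other; hence they stay off the vertical sides of the box.
  set W : Finset Vertex := Finset.Ioc (min x x₀) (max x x₀) ×ˢ {y} with hW
  have hWm : ∀ a c : ℤ, (a, c) ∈ W ↔ (min x x₀ < a ∧ a ≤ max x x₀) ∧ c = y := by
    intro a c
    simp only [hW, Finset.mem_product, Finset.mem_Ioc, Finset.mem_singleton]
  have h0 := hσ W (by
    rintro ⟨a, c⟩ hu
    rw [hWm] at hu
    obtain ⟨hu, rfl⟩ := hu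
    refine ⟨?_, hy⟩
    rw [abs_lt]; constructor <;> simp only <;> omega)
  have hmem : hE x y ∈ cutE W := by
    rw [mem_cutE]
    simp only [src, tgt, Bool.false_eq_true, if_false, Prod.mk_add_mk, hWm]
    rcases lt_or_gt_of_ne hne with h1 | h1 <;> simp [h1.le] <;> omega
  have hsub : (cutE W).erase (hE x y) ⊆ lineNbr K x₀ y := by
    rintro ⟨⟨a, c⟩, _ | _⟩ he
    · rw [Finset.mem_erase, mem_cutE] at he
      simp only [src, tgt, Bool.false_eq_true, if_false, Prod.mk_add_mk, hWm, ne_eq, Prod.mk.injEq,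
        and_true] at he
      simp only [lineNbr, Finset.mem_insert, Prod.mk.injEq, and_true]
      left; omega
    · rw [Finset.mem_erase, mem_cutE] at he
      simp only [src, tgt, if_true, Prod.mk_add_mk, hWm, ne_eq, Prod.mk.injEq,
        reduceCtorEq, and_false, not_false_eq_true, true_and] at he
      simp only [lineNbr, Finset.mem_insert, Finset.mem_product, Prod.mk.injEq, and_true,
        reduceCtorEq, and_false, false_or, Finset.mem_Icc, Finset.mem_singleton]
      omega
  have h1 : ∑ e ∈ (cutE W).erase (hE x y), bond J σ e ≤ ∑ e ∈ lineNbr K x₀ y, |J e| :=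
    calc _ ≤ ∑ e ∈ (cutE W).erase (hE x y), |J e| :=
          Finset.sum_le_sum fun e _ => (le_abs_self _).trans (abs_bond J σ e).le
      _ ≤ _ := Finset.sum_le_sum_of_subset_of_nonneg hsub fun _ _ _ => abs_nonneg _
  have h2 := h x (by rw [Finset.mem_Ico]; omega) hne
  rw [← Finset.add_sum_erase _ _ hmem, bond_of_not_satisfied hc] at h0
  linarith

/-- Either horizontal line of an isolation row is strong: the dominated sum of the row contains the
hole edge and the vertical edges at both lines. -/
lemma IsIsolation.strongLine {J : Couplings} {k : ℕ} {y : ℤ} (h : IsIsolation J k y) {y' : ℤ}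
    (hy' : y' = y ∨ y' = y + 1) : StrongLine J k 0 y' := by
  intro x hx hne
  refine lt_of_le_of_lt ?_ (h.2 (hE x y') ?_ ?_)
  · apply Finset.sum_le_sum_of_subset_of_nonneg _ fun _ _ _ => abs_nonneg _
    rintro ⟨⟨a, c⟩, b⟩ he
    simp only [lineNbr, Finset.mem_insert, Finset.mem_product, Finset.mem_singleton,
      Finset.mem_Icc] at he
    simp only [Finset.mem_union, rowVert, plaqE, Finset.mem_insert, Finset.mem_singleton,
      Finset.mem_product, Finset.mem_Icc]
    rcases he with he | he
    · left
      simp only [Prod.mk.injEq] at he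
      obtain ⟨⟨rfl, rfl⟩, rfl⟩ := he
      rcases hy' with rfl | rfl <;> simp
    · right
      refine ⟨⟨he.1.1, ?_⟩, he.2⟩
      obtain ⟨⟨h1, h2⟩, h3⟩ := he
      rcases hy' with rfl | rfl <;> omega
  · simp only [rowHoriz, Finset.mem_product, Finset.mem_insert, Finset.mem_singleton]
    exact ⟨⟨hx, hy'⟩, trivial⟩
  · simp [plaqE, hne]

/-! ### Plaquette products -/

lemma prod_plaqE (f : Edge → ℤˣ) (x y : ℤ) :
    ∏ e ∈ plaqE (x, y), f e = f (hE x y) * f (vE x y) * f (hE x (y + 1)) * f (vE (x + 1) y) := by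
  rw [plaqE, Finset.prod_insert (by simp), Finset.prod_insert (by simp),
    Finset.prod_insert (by simp), Finset.prod_singleton]
  simp [mul_assoc]

lemma prod_plaqE_agree (σ : Spins) (x y : ℤ) : ∏ e ∈ plaqE (x, y), agree σ e = 1 := by
  rw [prod_plaqE]
  simp only [agree, src, tgt, Bool.false_eq_true, if_false, if_true, Prod.mk_add_mk, add_zero]
  generalize σ (x, y) = a
  generalize σ (x + 1, y) = b
  generalize σ (x, y + 1) = c
  generalize σ (x + 1, y + 1) = d
  revert a b c d
  decide

lemma frustrated_iff (J : Couplings) (p : Plaquette) :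
    Frustrated J p ↔ ∏ e ∈ plaqE p, sg J e = -1 := by
  rw [Frustrated, ← Nat.not_even_iff_odd, ← prod_sg_eq_one_iff]
  rcases Int.units_eq_one_or (∏ e ∈ plaqE p, sg J e) with h | h <;> rw [h] <;> decide

lemma eq_of_steps {α : Type*} {f : ℤ → α} {a b : ℤ}
    (h : ∀ i, a ≤ i → i < b → f i = f (i + 1)) {i : ℤ} (h1 : a ≤ i) (h2 : i ≤ b) : f i = f a := by
  induction i, h1 using Int.leInduction with
  | base => rfl
  | succ j hj ih => rw [← h j hj (by omega), ih (by omega)]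

/-! ### Twisted pairs of states -/

/-- `r` and `s` are stable in `|x| ≤ k`, `|y| ≤ b`, satisfy the vertical boundary edges, and their
relative sign on the left side, `α`, is opposite to the one on the right side. -/
structure TwistedPair (J : Couplings) (k b : ℤ) (r s : Spins) (α : ℤˣ) : Prop where
  cut_r : CutOpt J r k b
  cut_s : CutOpt J s k b
  left_r : ∀ y, -b ≤ y → y < b → agree r (vE (-k) y) = sg J (vE (-k) y)
  left_s : ∀ y, -b ≤ y → y < b → agree s (vE (-k) y) = sg J (vE (-k) y)
  right_r : ∀ y, -b ≤ y → y < b → agree r (vE k y) = sg J (vE k y)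
  right_s : ∀ y, -b ≤ y → y < b → agree s (vE k y) = sg J (vE k y)
  left : ∀ y, -b ≤ y → y ≤ b → r (-k, y) * s (-k, y) = α
  right : ∀ y, -b ≤ y → y ≤ b → r (k, y) * s (k, y) = -α

lemma mul_src_eq_of_agree_eq {σ τ : Spins} {e : Edge} (h : agree σ e = agree τ e) :
    σ (src e) * τ (src e) = σ (tgt e) * τ (tgt e) := by
  simp only [agree] at h
  generalize σ (src e) = a at *
  generalize σ (tgt e) = b at *
  generalize τ (src e) = c at *
  generalize τ (tgt e) = d at *
  revert a b c d
  decide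

lemma mul_step_h {σ τ : Spins} {x y : ℤ} (h : agree σ (hE x y) = agree τ (hE x y)) :
    σ (x, y) * τ (x, y) = σ (x + 1, y) * τ (x + 1, y) := by
  simpa [src, tgt] using mul_src_eq_of_agree_eq h

lemma mul_step_v {σ τ : Spins} {x y : ℤ} (h : agree σ (vE x y) = agree τ (vE x y)) :
    σ (x, y) * τ (x, y) = σ (x, y + 1) * τ (x, y + 1) := by
  simpa [src, tgt] using mul_src_eq_of_agree_eq h

/-- Both states satisfy every edge of the line except perhaps the hole, so their relative sign can
change only there; the two sides fix its values. -/
lemma TwistedPair.line {J : Couplings} {k b : ℤ} {r s : Spins} {α : ℤˣ}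
    (h : TwistedPair J k b r s α) (hJ : ∀ e, J e ≠ 0) {K : ℕ} {x₀ y : ℤ}
    (hl : StrongLine J K x₀ y) (hk : k ≤ K) (hx₀ : x₀ ∈ Finset.Ico (-k) k) (hy : |y| < b) :
    (∀ x, -k ≤ x → x ≤ x₀ → r (x, y) * s (x, y) = α) ∧
    (∀ x, x₀ < x → x ≤ k → r (x, y) * s (x, y) = -α) := by
  have step : ∀ x, -k ≤ x → x < k → x ≠ x₀ →
      r (x, y) * s (x, y) = r (x + 1, y) * s (x + 1, y) := by
    intro x h1 h2 hne
    apply mul_step_h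
    rw [(satisfied_iff (hJ _)).1 (hl.satisfied hk hx₀ h.cut_r hy (Finset.mem_Ico.2 ⟨h1, h2⟩) hne),
      (satisfied_iff (hJ _)).1 (hl.satisfied hk hx₀ h.cut_s hy (Finset.mem_Ico.2 ⟨h1, h2⟩) hne)]
  rw [Finset.mem_Ico] at hx₀
  have hy' := abs_lt.1 hy
  constructor
  · intro x h1 h2
    have := eq_of_steps (f := fun x => r (x, y) * s (x, y)) (a := -k) (b := x₀)
      (fun i hi1 hi2 => step i hi1 (by omega) (by omega)) h1 h2
    rw [this, h.left y (by omega) (by omega)]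
  · intro x h1 h2
    have e1 := eq_of_steps (f := fun x => r (x, y) * s (x, y)) (a := x₀ + 1) (b := k)
      (fun i hi1 hi2 => step i (by omega) (by omega) (by omega)) (i := x) (by omega) h2
    have e2 := eq_of_steps (f := fun x => r (x, y) * s (x, y)) (a := x₀ + 1) (b := k)
      (fun i hi1 hi2 => step i (by omega) (by omega) (by omega)) (i := k) (by omega) le_rfl
    rw [e1, ← e2, h.right y (by omega) (by omega)]

lemma R.strongLine_top {J : Couplings} {n K : ℕ} (h : J ∈ R n K) {y : ℤ}
    (hy : y = n - 1 ∨ y = n) : StrongLine J K 0 y :=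
  h.2.1.strongLine (by omega)

lemma R.frustrated_top {J : Couplings} {n K : ℕ} (h : J ∈ R n K) {x : ℤ}
    (hx : x ∈ Finset.Ico (-(K : ℤ)) K) : Frustrated J (x, (n : ℤ) - 1) ↔ x = 0 := h.2.1.1 x hx

lemma R.frustrated_bot {J : Couplings} {n K : ℕ} (h : J ∈ R n K) {x : ℤ}
    (hx : x ∈ Finset.Ico (-(K : ℤ)) K) : Frustrated J (x, -(n : ℤ)) ↔ x = 0 := h.2.2.1 x hx

/-- The c-ground states of `C(n - 1, k)` and `C(n, k)` form a twisted pair. -/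
lemma R.exists_twistedPair {J : Couplings} (hJ : ∀ e, J e ≠ 0) {n K k : ℕ} (hR : J ∈ R n K)
    (hn : 2 ≤ n) (hk : 1 ≤ k) (hkK : k ≤ K) {r s : Spins} (hr : IsCGroundState J (n - 1) k r)
    (hs : IsCGroundState J n k s) : ∃ α, TwistedPair J k (n - 1) r s α := by
  have hr' := hr.boundary hJ (by omega) hk (hR.1.1 k hk hkK).2
  have hs' := hs.boundary hJ (by omega) hk (hR.1.1 k hk hkK).1
  have hcast : (((n - 1 : ℕ) : ℤ)) = (n : ℤ) - 1 := by omega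
  simp only [bdryE_eq, hcast] at hr'
  simp only [bdryE_eq] at hs'
  have cr : CutOpt J r k (n - 1) := by have := hr.cutOpt; rwa [hcast] at this
  have cs : CutOpt J s k n := hs.cutOpt
  have lr : ∀ y : ℤ, -((n : ℤ) - 1) ≤ y → y < n - 1 → ∀ x : ℤ, (x = -k ∨ x = k) →
      agree r (vE x y) = sg J (vE x y) := by
    intro y h1 h2 x hx
    apply hr'
    simp; omega
  have ls : ∀ y : ℤ, -(n : ℤ) ≤ y → y < n → ∀ x : ℤ, (x = -k ∨ x = k) →
      agree s (vE x y) = sg J (vE x y) := by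
    intro y h1 h2 x hx
    apply hs'
    simp; omega
  have tr : ∀ x : ℤ, -(k : ℤ) ≤ x → x < k → agree r (hE x (n - 1)) = sg J (hE x (n - 1)) := by
    intro x h1 h2
    apply hr'
    simp; omega
  have ts : ∀ x : ℤ, -(k : ℤ) ≤ x → x < k → agree s (hE x n) = sg J (hE x n) := by
    intro x h1 h2
    apply hs'
    simp; omega
  have hx₀ : (0 : ℤ) ∈ Finset.Ico (-(k : ℤ)) k := by rw [Finset.mem_Ico]; omega
  have ms : ∀ x : ℤ, -(k : ℤ) ≤ x → x < k → x ≠ 0 →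
      agree s (hE x (n - 1)) = sg J (hE x (n - 1)) := by
    intro x h1 h2 hne
    exact (satisfied_iff (hJ _)).1 ((R.strongLine_top hR (Or.inl rfl)).satisfied
      (by exact_mod_cast hkK) hx₀ cs (by rw [abs_lt]; omega) (Finset.mem_Ico.2 ⟨h1, h2⟩) hne)
  -- the vertical edges of the upper row
  set d : Edge → ℤˣ := fun e => agree s e * sg J e with hd
  have dprod : ∀ x y : ℤ, d (hE x y) * d (vE x y) * d (hE x (y + 1)) * d (vE (x + 1) y) =
      ∏ e ∈ plaqE (x, y), sg J e := by
    intro x y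
    rw [← prod_plaqE, hd, Finset.prod_mul_distrib, prod_plaqE_agree, one_mul]
  have done : ∀ e, agree s e = sg J e → d e = 1 := by
    intro e he; simp only [hd, he, units_mul_self]
  have hx1 : ∀ x : ℤ, -(k : ℤ) ≤ x → x < k → x ≠ 0 →
      d (vE x (n - 1)) = d (vE (x + 1) (n - 1)) := by
    intro x h1 h2 hne
    have h3 := dprod x (n - 1)
    have h4 : ¬ Frustrated J (x, (n : ℤ) - 1) := by
      rw [R.frustrated_top hR (by rw [Finset.mem_Ico]; omega)]; exact hne
    rw [frustrated_iff] at h4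
    have h5 := (Int.units_eq_one_or (∏ e ∈ plaqE (x, (n : ℤ) - 1), sg J e)).resolve_right h4
    rw [h5, done _ (ms x h1 h2 hne), sub_add_cancel, done _ (ts x h1 h2), one_mul, mul_one] at h3
    exact mul_eq_one_iff_eq_inv.1 h3 |>.trans (by simp)
  have hleft : d (vE 0 (n - 1)) = 1 := by
    have h1 := eq_of_steps (f := fun x => d (vE x (n - 1))) (a := -(k : ℤ)) (b := 0)
      (fun i hi1 hi2 => hx1 i hi1 (by omega) (by omega)) (i := 0) (by omega) le_rfl
    rw [h1]
    exact done _ (ls _ (by omega) (by omega) _ (Or.inl rfl))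
  have hright : d (vE (0 + 1) (n - 1)) = 1 := by
    have h1 := eq_of_steps (f := fun x => d (vE x (n - 1))) (a := 0 + 1) (b := (k : ℤ))
      (fun i hi1 hi2 => hx1 i (by omega) (by omega) (by omega)) (i := k) (by omega) le_rfl
    rw [← h1]
    exact done _ (ls _ (by omega) (by omega) _ (Or.inr rfl))
  -- The other three edges of the frustrated middle plaquette are satisfied by `s`, so the hole edge
  -- is not. As a boundary edge of the smaller box it is satisfied by `r`; this discrepancy is the
  -- twist.
  have hhole : d (hE 0 (n - 1)) = -1 := by
    have h3 := dprod 0 (n - 1)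
    have h4 : Frustrated J (0, (n : ℤ) - 1) := by
      rw [R.frustrated_top hR (by rw [Finset.mem_Ico]; omega)]
    rw [frustrated_iff] at h4
    rw [h4, hleft, hright, sub_add_cancel, done _ (ts 0 (by omega) (by omega))] at h3
    simpa using h3
  -- the relative sign
  have lstep : ∀ x : ℤ, (x = -k ∨ x = k) → ∀ y : ℤ, -((n : ℤ) - 1) ≤ y → y ≤ n - 1 →
      r (x, y) * s (x, y) = r (x, n - 1) * s (x, n - 1) := by
    intro x hx
    have key : ∀ y : ℤ, -((n : ℤ) - 1) ≤ y → y ≤ n - 1 →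
        r (x, y) * s (x, y) = r (x, -((n : ℤ) - 1)) * s (x, -((n : ℤ) - 1)) := by
      intro y h1 h2
      refine eq_of_steps (f := fun y => r (x, y) * s (x, y)) (a := -((n : ℤ) - 1)) (b := n - 1)
        (fun i hi1 hi2 => ?_) h1 h2
      apply mul_step_v
      rw [lr i hi1 hi2 x hx, ls i (by omega) (by omega) x hx]
    intro y h1 h2
    rw [key y h1 h2, key (n - 1) (by omega) le_rfl]
  have tstep : ∀ x : ℤ, -(k : ℤ) ≤ x → x < k → x ≠ 0 →
      r (x, n - 1) * s (x, n - 1) = r (x + 1, n - 1) * s (x + 1, n - 1) := by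
    intro x h1 h2 hne
    apply mul_step_h
    rw [tr x h1 h2, ms x h1 h2 hne]
  have tl : r (0, n - 1) * s (0, n - 1) = r (-k, n - 1) * s (-k, n - 1) :=
    eq_of_steps (f := fun x => r (x, n - 1) * s (x, n - 1)) (a := -(k : ℤ)) (b := 0)
      (fun i hi1 hi2 => tstep i hi1 (by omega) (by omega)) (i := 0) (by omega) le_rfl
  have trr : r (k, n - 1) * s (k, n - 1) = r (0 + 1, n - 1) * s (0 + 1, n - 1) :=
    eq_of_steps (f := fun x => r (x, n - 1) * s (x, n - 1)) (a := 0 + 1) (b := (k : ℤ))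
      (fun i hi1 hi2 => tstep i (by omega) (by omega) (by omega)) (i := k) (by omega) le_rfl
  have hflip : r (0 + 1, n - 1) * s (0 + 1, n - 1) = -(r (0, n - 1) * s (0, n - 1)) := by
    have h1 := tr 0 (by omega) (by omega)
    simp only [hd, ← h1] at hhole
    simp only [agree, src, tgt, Bool.false_eq_true, if_false, Prod.mk_add_mk, add_zero] at hhole
    generalize r (0, (n : ℤ) - 1) = a at *
    generalize s (0, (n : ℤ) - 1) = b at *
    generalize r (0 + 1, (n : ℤ) - 1) = c at *
    generalize s (0 + 1, (n : ℤ) - 1) = d' at *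
    clear * - hhole
    revert a b c d'
    decide
  refine ⟨r (-k, n - 1) * s (-k, n - 1), ?_⟩
  exact {
    cut_r := cr
    cut_s := cs.mono le_rfl (by omega)
    left_r := fun y h1 h2 => lr y h1 h2 _ (Or.inl rfl)
    right_r := fun y h1 h2 => lr y h1 h2 _ (Or.inr rfl)
    left_s := fun y h1 h2 => ls y (by omega) (by omega) _ (Or.inl rfl)
    right_s := fun y h1 h2 => ls y (by omega) (by omega) _ (Or.inr rfl)
    left := fun y h1 h2 => lstep _ (Or.inl rfl) y h1 h2
    right := fun y h1 h2 => by
      rw [lstep _ (Or.inr rfl) y h1 h2, trr, hflip, tl] }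

/-! ### Uniqueness between two strong lines -/

/-- No nontrivial combination of coupling constants with coefficients `1`, `-1` vanishes. -/
def Generic (J : Couplings) : Prop :=
  ∀ F S : Finset Edge, F.Nonempty → (∑ e ∈ F, (if e ∈ S then -J e else J e : ℝ)) ≠ 0

lemma Generic.ne_zero {J : Couplings} (h : Generic J) (e : Edge) : J e ≠ 0 := by
  simpa using h {e} ∅ (Finset.singleton_nonempty e)

lemma Generic.sum_bond_ne_zero {J : Couplings} (h : Generic J) (σ : Spins) {F : Finset Edge}
    (hF : F.Nonempty) : ∑ e ∈ F, bond J σ e ≠ 0 := by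
  have := h F (F.filter fun e => agree σ e = -1) hF
  rwa [Finset.sum_congr rfl fun e he => ?_]
  rw [bond_eq]
  rcases Int.units_eq_one_or (agree σ e) with h' | h' <;> simp [h', he]

lemma cutE_nonempty {W : Finset Vertex} (hW : W.Nonempty) : (cutE W).Nonempty := by
  obtain ⟨u, hu, hmax⟩ := W.exists_max_image (fun u => u.1) hW
  refine ⟨(u, false), ?_⟩
  rw [mem_cutE]
  have : u + (1, 0) ∉ W := fun h => by simpa using hmax _ h
  simp [src, tgt, hu, this]

/-- The two cut sums are nonnegative and opposite, so both vanish, which genericity forbids for a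
nonempty cut. -/
lemma cut_unique {J J' : Couplings} (hJ : Generic J) {σ τ : Spins} {W : Finset Vertex}
    (hσ : 0 ≤ ∑ e ∈ cutE W, bond J σ e) (hτ : 0 ≤ ∑ e ∈ cutE W, bond J' τ e)
    (hJJ : ∀ e ∈ cutE W, J e = J' e) (h : ∀ e ∈ cutE W, agree τ e = -agree σ e) : W = ∅ := by
  by_contra hne
  have h1 := hJ.sum_bond_ne_zero σ (cutE_nonempty (Finset.nonempty_iff_ne_empty.2 hne))
  have h2 : ∑ e ∈ cutE W, bond J' τ e = -∑ e ∈ cutE W, bond J σ e := by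
    rw [← Finset.sum_neg_distrib]
    refine Finset.sum_congr rfl fun e he => ?_
    rw [bond_eq, bond_eq, h e he, hJJ e he]; simp
  rw [h2] at hτ
  exact h1 (by linarith)

lemma CutOpt.const_mul {J : Couplings} {σ : Spins} {k b : ℤ} (h : CutOpt J σ k b) (c : ℤˣ) :
    CutOpt J (fun u => c * σ u) k b := by
  intro W hW
  convert h W hW using 2 with e
  refine (bond_eq _ _ _).trans ?_
  rw [bond_eq, agree, agree, mul_mul_mul_comm, units_mul_self, one_mul]

/-- The couplings `J` and `J'` agree between the heights `y₁` and `y₂`. -/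
def AgreeBetween (J J' : Couplings) (y₁ y₂ : ℤ) : Prop :=
  (∀ x y, y₁ ≤ y → y ≤ y₂ → J (hE x y) = J' (hE x y)) ∧
  (∀ x y, y₁ ≤ y → y < y₂ → J (vE x y) = J' (vE x y))

/-- Take `W` to be the set of disagreement. It lies strictly inside the block, and on every edge of
its cut exactly one end changes sign, so `cut_unique` applies. -/
lemma CutOpt.unique {J J' : Couplings} (hJ : Generic J) {σ τ : Spins} {k b b' y₁ y₂ : ℤ}
    (hσ : CutOpt J σ k b) (hτ : CutOpt J' τ k b') (h1 : -b ≤ y₁) (h2 : y₂ ≤ b) (h1' : -b' ≤ y₁)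
    (h2' : y₂ ≤ b') (hJJ : AgreeBetween J J' y₁ y₂)
    (hbd : ∀ x y, -k ≤ x → x ≤ k → y₁ ≤ y → y ≤ y₂ → (x = -k ∨ x = k ∨ y = y₁ ∨ y = y₂) →
      σ (x, y) = τ (x, y)) :
    ∀ x y, -k ≤ x → x ≤ k → y₁ ≤ y → y ≤ y₂ → σ (x, y) = τ (x, y) := by
  set W : Finset Vertex := (Finset.Ioo (-k) k ×ˢ Finset.Ioo y₁ y₂).filter
    fun u => σ u ≠ τ u with hW
  have hWm : ∀ x y, (x, y) ∈ W ↔ ((-k < x ∧ x < k) ∧ (y₁ < y ∧ y < y₂)) ∧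
      σ (x, y) ≠ τ (x, y) := by
    intro x y; simp [hW, Finset.mem_product]
  have hmem : ∀ x y, -k ≤ x → x ≤ k → y₁ ≤ y → y ≤ y₂ →
      ((x, y) ∈ W ↔ σ (x, y) ≠ τ (x, y)) := by
    intro x y a1 a2 a3 a4
    rw [hWm, and_iff_right_iff_imp]
    intro hne
    by_contra hc
    exact hne (hbd x y a1 a2 a3 a4 (by omega))
  have hin : ∀ u ∈ W, |u.1| < k ∧ y₁ < u.2 ∧ u.2 < y₂ := by
    rintro ⟨x, y⟩ hu
    rw [hWm] at hu
    simp only [abs_lt]; omega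
  have hemp : W = ∅ := by
    have key : ∀ e ∈ cutE W, J e = J' e ∧ agree τ e = -agree σ e := by
      rintro ⟨⟨x, y⟩, _ | _⟩ he
      · rw [mem_cutE] at he
        simp only [src, tgt, Bool.false_eq_true, if_false, Prod.mk_add_mk, add_zero] at he
        have hrange : (-k ≤ x ∧ x + 1 ≤ k) ∧ (y₁ ≤ y ∧ y ≤ y₂) := by
          by_cases h : (x, y) ∈ W
          · rw [hWm] at h; omega
          · have h : (x + 1, y) ∈ W := by tauto
            rw [hWm] at h; omega
        refine ⟨hJJ.1 x y hrange.2.1 hrange.2.2, ?_⟩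
        rw [hmem x y (by omega) (by omega) (by omega) (by omega),
          hmem (x + 1) y (by omega) (by omega) (by omega) (by omega)] at he
        simp only [agree, src, tgt, Bool.false_eq_true, if_false, Prod.mk_add_mk, add_zero]
        generalize σ (x, y) = a1 at *
        generalize σ (x + 1, y) = a2 at *
        generalize τ (x, y) = a3 at *
        generalize τ (x + 1, y) = a4 at *
        clear * - he
        revert a1 a2 a3 a4
        decide
      · rw [mem_cutE] at he
        simp only [src, tgt, if_true, Prod.mk_add_mk, add_zero] at he
        have hrange : (-k ≤ x ∧ x ≤ k) ∧ (y₁ ≤ y ∧ y + 1 ≤ y₂) := by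
          by_cases h : (x, y) ∈ W
          · rw [hWm] at h; omega
          · have h : (x, y + 1) ∈ W := by tauto
            rw [hWm] at h; omega
        refine ⟨hJJ.2 x y hrange.2.1 (by omega), ?_⟩
        rw [hmem x y (by omega) (by omega) (by omega) (by omega),
          hmem x (y + 1) (by omega) (by omega) (by omega) (by omega)] at he
        simp only [agree, src, tgt, if_true, Prod.mk_add_mk, add_zero]
        generalize σ (x, y) = a1 at *
        generalize σ (x, y + 1) = a2 at *
        generalize τ (x, y) = a3 at *
        generalize τ (x, y + 1) = a4 at *
        clear * - he
        revert a1 a2 a3 a4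
        decide
    refine cut_unique hJ (hσ W fun u hu => ?_) (hτ W fun u hu => ?_) (fun e he => (key e he).1)
      (fun e he => (key e he).2)
    · have := hin u hu
      refine ⟨this.1, ?_⟩
      rw [abs_lt]; omega
    · have := hin u hu
      refine ⟨this.1, ?_⟩
      rw [abs_lt]; omega
  intro x y a1 a2 a3 a4
  by_contra hne
  have := (hmem x y a1 a2 a3 a4).2 hne
  rw [hemp] at this
  simp at this

lemma AgreeBetween.sg_h {J J' : Couplings} {y₁ y₂ : ℤ} (h : AgreeBetween J J' y₁ y₂) {x y : ℤ}
    (h1 : y₁ ≤ y) (h2 : y ≤ y₂) : sg J (hE x y) = sg J' (hE x y) := by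
  simp only [sg, h.1 x y h1 h2]

lemma AgreeBetween.sg_v {J J' : Couplings} {y₁ y₂ : ℤ} (h : AgreeBetween J J' y₁ y₂) {x y : ℤ}
    (h1 : y₁ ≤ y) (h2 : y < y₂) : sg J (vE x y) = sg J' (vE x y) := by
  simp only [sg, h.2 x y h1 h2]

/-- Up to a global sign, the relative sign of a twisted pair is determined between two strong lines
by the couplings between these lines. -/
lemma TwistedPair.block_eq {J J' : Couplings} (hJ : Generic J) (hJ' : Generic J') {K : ℕ}
    {k b b' y₁ y₂ : ℤ} {r s r' s' : Spins} {α α' : ℤˣ} (h : TwistedPair J k b r s α)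
    (h' : TwistedPair J' k b' r' s' α') (hk1 : 1 ≤ k) (hkK : k ≤ K) (hJJ : AgreeBetween J J' y₁ y₂)
    (l₁ : StrongLine J K 0 y₁) (l₂ : StrongLine J K 0 y₂) (l₁' : StrongLine J' K 0 y₁)
    (l₂' : StrongLine J' K 0 y₂) (h12 : y₁ < y₂) (hb1 : -b < y₁) (hb2 : y₂ < b) (hb1' : -b' < y₁)
    (hb2' : y₂ < b') :
    ∀ x y, -k ≤ x → x ≤ k → y₁ ≤ y → y ≤ y₂ →
      r' (x, y) * s' (x, y) = α * α' * (r (x, y) * s (x, y)) := by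
  have hx₀ : (0 : ℤ) ∈ Finset.Ico (-k) k := by rw [Finset.mem_Ico]; omega
  -- the relative sign of `r` and `r'` is constant on the left part and on the right part
  have lineStep : ∀ y, (y = y₁ ∨ y = y₂) → ∀ x, -k ≤ x → x < k → x ≠ 0 →
      r (x, y) * r' (x, y) = r (x + 1, y) * r' (x + 1, y) := by
    intro y hy x a1 a2 hne
    have hyb : |y| < b := by rw [abs_lt]; omega
    have hyb' : |y| < b' := by rw [abs_lt]; omega
    have l : StrongLine J K 0 y := by rcases hy with rfl | rfl <;> assumption
    have l' : StrongLine J' K 0 y := by rcases hy with rfl | rfl <;> assumption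
    apply mul_step_h
    rw [(satisfied_iff (hJ.ne_zero _)).1
        (l.satisfied hkK hx₀ h.cut_r hyb (Finset.mem_Ico.2 ⟨a1, a2⟩) hne),
      (satisfied_iff (hJ'.ne_zero _)).1
        (l'.satisfied hkK hx₀ h'.cut_r hyb' (Finset.mem_Ico.2 ⟨a1, a2⟩) hne)]
    exact hJJ.sg_h (by omega) (by omega)
  have sideL : ∀ y, y₁ ≤ y → y ≤ y₂ → r (-k, y) * r' (-k, y) = r (-k, y₁) * r' (-k, y₁) := by
    intro y a1 a2
    refine eq_of_steps (f := fun y => r (-k, y) * r' (-k, y)) (a := y₁) (b := y₂)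
      (fun i hi1 hi2 => ?_) a1 a2
    apply mul_step_v
    rw [h.left_r i (by omega) (by omega), h'.left_r i (by omega) (by omega)]
    exact hJJ.sg_v hi1 hi2
  have sideR : ∀ y, y₁ ≤ y → y ≤ y₂ → r (k, y) * r' (k, y) = r (k, y₁) * r' (k, y₁) := by
    intro y a1 a2
    refine eq_of_steps (f := fun y => r (k, y) * r' (k, y)) (a := y₁) (b := y₂)
      (fun i hi1 hi2 => ?_) a1 a2
    apply mul_step_v
    rw [h.right_r i (by omega) (by omega), h'.right_r i (by omega) (by omega)]
    exact hJJ.sg_v hi1 hi2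
  set A := r (-k, y₁) * r' (-k, y₁) with hA
  set B := r (k, y₁) * r' (k, y₁) with hB
  have bd : ∀ x y, -k ≤ x → x ≤ k → y₁ ≤ y → y ≤ y₂ → (x = -k ∨ x = k ∨ y = y₁ ∨ y = y₂) →
      (r (x, y) * r' (x, y) = A ∧ r (x, y) * s (x, y) = α ∧ r' (x, y) * s' (x, y) = α') ∨
      (r (x, y) * r' (x, y) = B ∧ r (x, y) * s (x, y) = -α ∧ r' (x, y) * s' (x, y) = -α') := by
    intro x y a1 a2 a3 a4 hxy
    by_cases hy : y = y₁ ∨ y = y₂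
    · have hyb : |y| < b := by rw [abs_lt]; omega
      have hyb' : |y| < b' := by rw [abs_lt]; omega
      have l : StrongLine J K 0 y := by rcases hy with rfl | rfl <;> assumption
      have l' : StrongLine J' K 0 y := by rcases hy with rfl | rfl <;> assumption
      have q := h.line hJ.ne_zero l hkK hx₀ hyb
      have q' := h'.line hJ'.ne_zero l' hkK hx₀ hyb'
      rcases le_or_gt x 0 with hx | hx
      · left
        refine ⟨?_, q.1 x a1 hx, q'.1 x a1 hx⟩
        have := eq_of_steps (f := fun x => r (x, y) * r' (x, y)) (a := -k) (b := 0)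
          (fun i hi1 hi2 => lineStep y hy i hi1 (by omega) (by omega)) a1 hx
        rw [this, sideL y a3 a4]
      · right
        refine ⟨?_, q.2 x hx a2, q'.2 x hx a2⟩
        have e1 := eq_of_steps (f := fun x => r (x, y) * r' (x, y)) (a := 1) (b := k)
          (fun i hi1 hi2 => lineStep y hy i (by omega) (by omega) (by omega)) (i := x)
          (by omega) a2
        have e2 := eq_of_steps (f := fun x => r (x, y) * r' (x, y)) (a := 1) (b := k)
          (fun i hi1 hi2 => lineStep y hy i (by omega) (by omega) (by omega)) (i := k)
          (by omega) le_rfl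
        rw [e1, ← e2, sideR y a3 a4]
    · rcases hxy with rfl | rfl | hxy
      · exact Or.inl ⟨sideL y a3 a4, h.left y (by omega) (by omega), h'.left y (by omega) (by omega)⟩
      · exact Or.inr ⟨sideR y a3 a4, h.right y (by omega) (by omega),
          h'.right y (by omega) (by omega)⟩
      · exact absurd hxy hy
  -- On the boundary of the block there are only two classes of spins up to a global sign. Either
  -- `r'` belongs to the class of `r` and `s'` to that of `s`, or the roles are exchanged; the
  -- product `r' s'` is the same up to sign in both cases.
  by_cases hAB : A = B
  · have e1 := (h.cut_r.const_mul A).unique hJ h'.cut_r hb1.le hb2.le hb1'.le hb2'.le hJJ (by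
      intro x y a1 a2 a3 a4 hxy
      have := bd x y a1 a2 a3 a4 hxy
      rw [← hAB] at this
      generalize r (x, y) = c1 at *
      generalize r' (x, y) = c2 at *
      generalize s (x, y) = c3 at *
      generalize s' (x, y) = c4 at *
      generalize A = c5 at *
      clear * - this
      revert c1 c2 c3 c4 c5 α α'
      decide)
    have e2 := (h.cut_s.const_mul (A * (α * α'))).unique hJ h'.cut_s hb1.le hb2.le hb1'.le hb2'.le
      hJJ (by
      intro x y a1 a2 a3 a4 hxy
      have := bd x y a1 a2 a3 a4 hxy
      rw [← hAB] at this
      generalize r (x, y) = c1 at *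
      generalize r' (x, y) = c2 at *
      generalize s (x, y) = c3 at *
      generalize s' (x, y) = c4 at *
      generalize A = c5 at *
      clear * - this
      revert c1 c2 c3 c4 c5 α α'
      decide)
    intro x y a1 a2 a3 a4
    rw [← e1 x y a1 a2 a3 a4, ← e2 x y a1 a2 a3 a4]
    generalize r (x, y) = c1 at *
    generalize s (x, y) = c3 at *
    generalize A = c5 at *
    clear * -
    revert c1 c3 c5 α α'
    decide
  · have hBA : B = -A := by
      generalize A = a at *
      generalize B = b at *
      clear * - hAB
      revert a b
      decide
    have e1 := (h.cut_r.const_mul (A * α')).unique hJ h'.cut_s hb1.le hb2.le hb1'.le hb2'.le hJJ (by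
      intro x y a1 a2 a3 a4 hxy
      have := bd x y a1 a2 a3 a4 hxy
      rw [hBA] at this
      generalize r (x, y) = c1 at *
      generalize r' (x, y) = c2 at *
      generalize s (x, y) = c3 at *
      generalize s' (x, y) = c4 at *
      generalize A = c5 at *
      clear * - this
      revert c1 c2 c3 c4 c5 α α'
      decide)
    have e2 := (h.cut_s.const_mul (A * α)).unique hJ h'.cut_r hb1.le hb2.le hb1'.le hb2'.le
      hJJ (by
      intro x y a1 a2 a3 a4 hxy
      have := bd x y a1 a2 a3 a4 hxy
      rw [hBA] at this
      generalize r (x, y) = c1 at *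
      generalize r' (x, y) = c2 at *
      generalize s (x, y) = c3 at *
      generalize s' (x, y) = c4 at *
      generalize A = c5 at *
      clear * - this
      revert c1 c2 c3 c4 c5 α α'
      decide)
    intro x y a1 a2 a3 a4
    rw [← e1 x y a1 a2 a3 a4, ← e2 x y a1 a2 a3 a4]
    generalize r (x, y) = c1 at *
    generalize s (x, y) = c3 at *
    generalize A = c5 at *
    clear * -
    revert c1 c3 c5 α α'
    decide


/-! ### Existence of c-ground states -/

lemma energy_eq_of_agree (J : Couplings) (n k : ℕ) (σ : Spins) :
    energy J n k σ = -∑ e ∈ boxE n k,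
      (if e ∈ (boxE n k).filter (fun e => agree σ e = -1) then -J e else J e : ℝ) := by
  rw [energy, neg_inj]
  refine Finset.sum_congr rfl fun e he => ?_
  rw [bond_eq]
  rcases Int.units_eq_one_or (agree σ e) with h' | h' <;> simp [h', he]

lemma finite_range_energy (J : Couplings) (n k : ℕ) :
    (Set.range (energy J n k)).Finite := by
  refine (((boxE n k).powerset.finite_toSet).image fun S => -∑ e ∈ boxE n k,
      (if e ∈ S then -J e else J e : ℝ)).subset ?_
  rintro _ ⟨σ, rfl⟩
  refine ⟨(boxE n k).filter (fun e => agree σ e = -1), ?_, (energy_eq_of_agree J n k σ).symm⟩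
  exact Finset.mem_coe.2 (Finset.mem_powerset.2 (Finset.filter_subset _ _))

lemma bdryE_ends {n k : ℕ} {e : Edge} (he : e ∈ bdryE n k) :
    src e ∈ bdryV n k ∧ tgt e ∈ bdryV n k := by
  simp only [bdryE, bdryV, Finset.mem_filter, mem_boxE] at he ⊢
  rcases e with ⟨⟨x, y⟩, _ | _⟩
  · refine ⟨⟨he.1.1, Or.inr he.2⟩, he.1.2, Or.inr ?_⟩
    simpa [tgt] using he.2
  · refine ⟨⟨he.1.1, Or.inl he.2⟩, he.1.2, Or.inl ?_⟩
    simpa [tgt] using he.2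

lemma satBdry_congr (J : Couplings) {n k : ℕ} {σ τ : Spins} (h : ∀ u ∈ bdryV n k, σ u = τ u) :
    satBdry J n k σ = satBdry J n k τ := by
  ext e
  simp only [satBdry, Set.mem_ofPred_eq, and_congr_right_iff]
  intro he
  obtain ⟨h1, h2⟩ := bdryE_ends he
  rw [Satisfied, Satisfied, bond, bond, h _ h1, h _ h2]

/-- The number of satisfied boundary edges and the energy each take finitely many values, although
there are infinitely many spin assignments. -/
lemma exists_isCGroundState (J : Couplings) (n k : ℕ) : ∃ σ, IsCGroundState J n k σ := by
  have hfin : (Set.range fun τ => (satBdry J n k τ).ncard).Finite := by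
    refine (Set.finite_Iic (bdryE n k).card).subset ?_
    rintro _ ⟨τ, rfl⟩
    rw [Set.mem_Iic, ← Set.ncard_coe_finset]
    exact Set.ncard_le_ncard (fun e he => he.1) (Finset.finite_toSet _)
  obtain ⟨_, ⟨τ, rfl⟩, hτ⟩ := Set.exists_max_image _ id hfin ⟨_, ⟨fun _ => 1, rfl⟩⟩
  set S := (energy J n k) '' {σ | ∀ u ∈ bdryV n k, σ u = τ u}
  have hS : S.Finite := (finite_range_energy J n k).subset (Set.image_subset_range _ _)
  obtain ⟨_, ⟨σ, hσ, rfl⟩, hmin⟩ := Set.exists_min_image S id hS ⟨_, ⟨τ, fun _ _ => rfl, rfl⟩⟩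
  refine ⟨σ, fun τ' => ?_, fun σ' h' => ?_⟩
  · rw [satBdry_congr J hσ]
    exact hτ _ ⟨τ', rfl⟩
  · exact hmin _ ⟨σ', fun u hu => (h' u hu).trans (hσ u hu), rfl⟩

/-! ### The dual graph -/

lemma dualEdge_hE (x y : ℤ) : dualEdge (hE x y) = s((x, y), (x, y - 1)) := by simp [dualEdge]

lemma dualEdge_vE (x y : ℤ) : dualEdge (vE x y) = s((x, y), (x - 1, y)) := by simp [dualEdge]

lemma mem_plaqE_iff {e : Edge} {p : Plaquette} : e ∈ plaqE p ↔ p ∈ dualEdge e := by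
  rcases e with ⟨⟨x, y⟩, _ | _⟩ <;> rcases p with ⟨a, b⟩ <;>
    simp [plaqE, dualEdge] <;> omega

lemma dualGraph_adj {n k : ℕ} {A : Set Edge} {p q : Plaquette} :
    (dualGraph n k A).Adj p q ↔
      ∃ e ∈ A, e ∈ boxE n k ∧ e ∉ bdryE n k ∧ dualEdge e = s(p, q) := by
  rw [dualGraph, SimpleGraph.fromEdgeSet_adj]
  constructor
  · rintro ⟨⟨e, ⟨h1, h2, h3⟩, h4⟩, _⟩
    exact ⟨e, h1, h2, h3, h4⟩
  · rintro ⟨e, h1, h2, h3, h4⟩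
    refine ⟨⟨e, ⟨h1, h2, h3⟩, h4⟩, ?_⟩
    rintro rfl
    rcases e with ⟨⟨x, y⟩, _ | _⟩ <;> simp [dualEdge] at h4 <;> rw [← h4.1] at h4 <;> simp at h4

/-- The edges dissatisfied by exactly one of `r` (in `C(n - 1, k)`) and `s` (in `C(n, k)`). -/
abbrev DD (J : Couplings) (n k : ℕ) (r s : Spins) : Set Edge :=
  symmDiff (DIS J (n - 1) k r) (DIS J n k s)

/-- `r` and `s` are c-ground states of `C(n - 1, k)` and `C(n, k)`, where `R(n, K)` holds. -/
structure CPair (J : Couplings) (n K k : ℕ) (r s : Spins) : Prop where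
  gen : Generic J
  hR : J ∈ R n K
  hn : 2 ≤ n
  hk : 1 ≤ k
  hkK : k ≤ K
  hr : IsCGroundState J (n - 1) k r
  hs : IsCGroundState J n k s

lemma mem_boxE_hE {n k : ℕ} {x y : ℤ} :
    hE x y ∈ boxE n k ↔ (-(k : ℤ) ≤ x ∧ x < k) ∧ (-(n : ℤ) ≤ y ∧ y ≤ n) := by
  simp only [mem_boxE, mem_boxV, src, tgt, abs_le]; simp; omega

lemma mem_boxE_vE {n k : ℕ} {x y : ℤ} :
    vE x y ∈ boxE n k ↔ (-(k : ℤ) ≤ x ∧ x ≤ k) ∧ (-(n : ℤ) ≤ y ∧ y < n) := by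
  simp only [mem_boxE, mem_boxV, src, tgt, abs_le]; simp; omega

lemma mem_bdryE_hE {n k : ℕ} {x y : ℤ} :
    hE x y ∈ bdryE n k ↔ (-(k : ℤ) ≤ x ∧ x < k) ∧ (y = -n ∨ y = n) := by
  simp [bdryE_eq]

lemma mem_bdryE_vE {n k : ℕ} {x y : ℤ} :
    vE x y ∈ bdryE n k ↔ (x = -k ∨ x = k) ∧ (-(n : ℤ) ≤ y ∧ y < n) := by
  simp [bdryE_eq]

lemma boxE_mono {n n' k : ℕ} (h : n ≤ n') : boxE n k ⊆ boxE n' k := by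
  rintro ⟨⟨x, y⟩, _ | _⟩ he
  · rw [mem_boxE_hE] at he ⊢; omega
  · rw [mem_boxE_vE] at he ⊢; omega

namespace CPair

variable {J : Couplings} {n K k : ℕ} {r s : Spins}

lemma cast_pred (h : CPair J n K k r s) : (((n - 1 : ℕ) : ℤ)) = (n : ℤ) - 1 := by
  have := h.hn; omega

lemma bdry_r (h : CPair J n K k r s) : ∀ e ∈ bdryE (n - 1) k, agree r e = sg J e :=
  h.hr.boundary h.gen.ne_zero (by have := h.hn; omega) h.hk (h.hR.1.1 k h.hk h.hkK).2

lemma bdry_s (h : CPair J n K k r s) : ∀ e ∈ bdryE n k, agree s e = sg J e :=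
  h.hs.boundary h.gen.ne_zero (by have := h.hn; omega) h.hk (h.hR.1.1 k h.hk h.hkK).1

/-- In the smaller box both states compete on the edge, so the sign of the coupling drops out. In
`mem_outer` only `s` is defined, and the sign remains. -/
lemma mem_inner (h : CPair J n K k r s) {e : Edge} (he : e ∈ boxE (n - 1) k) :
    e ∈ DD J n k r s ↔ agree r e ≠ agree s e := by
  have he' := boxE_mono (Nat.sub_le n 1) he
  simp only [DD, Set.mem_symmDiff, DIS, Set.mem_ofPred_eq, he, he', true_and,
    satisfied_iff (h.gen.ne_zero e)]
  generalize agree r e = a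
  generalize agree s e = b
  generalize sg J e = c
  revert a b c
  decide

lemma mem_outer (h : CPair J n K k r s) {e : Edge} (he : e ∉ boxE (n - 1) k)
    (he' : e ∈ boxE n k) : e ∈ DD J n k r s ↔ agree s e ≠ sg J e := by
  simp [DD, Set.mem_symmDiff, DIS, he, he', satisfied_iff (h.gen.ne_zero e)]

lemma mem_box (_ : CPair J n K k r s) {e : Edge} (he : e ∈ DD J n k r s) : e ∈ boxE n k := by
  rcases he with ⟨h1, _⟩ | ⟨h1, _⟩
  · exact boxE_mono (Nat.sub_le n 1) h1.1
  · exact h1.1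

/-- Boundary edges have no dual edge; this guarantees that no edge of the difference is lost in the
dual graph. -/
lemma notMem_bdry (h : CPair J n K k r s) {e : Edge} (he : e ∈ DD J n k r s) :
    e ∉ bdryE n k := by
  intro hb
  have h2 := h.bdry_s e hb
  by_cases hi : e ∈ boxE (n - 1) k
  · rw [h.mem_inner hi] at he
    refine he ?_
    rw [h2]
    apply h.bdry_r
    have := h.cast_pred
    rcases e with ⟨⟨x, y⟩, _ | _⟩
    · rw [mem_bdryE_hE] at hb ⊢; rw [mem_boxE_hE] at hi; omega
    · rw [mem_bdryE_vE] at hb ⊢; rw [mem_boxE_vE] at hi; omega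
  · rw [h.mem_outer hi (h.mem_box he)] at he
    exact he h2

/-- `-1` on the edges of `DD`, and `1` elsewhere. -/
def dv (J : Couplings) (n k : ℕ) (r s : Spins) (e : Edge) : ℤˣ :=
  open Classical in if e ∈ DD J n k r s then -1 else 1

lemma dv_inner (h : CPair J n K k r s) {e : Edge} (he : e ∈ boxE (n - 1) k) :
    dv J n k r s e = agree r e * agree s e := by
  rw [dv, h.mem_inner he]
  generalize agree r e = a
  generalize agree s e = b
  split_ifs with h1
  · revert a b; decide
  · simp only [ne_eq, not_not] at h1
    rw [h1, units_mul_self]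

lemma dv_outer (h : CPair J n K k r s) {e : Edge} (he : e ∉ boxE (n - 1) k)
    (he' : e ∈ boxE n k) : dv J n k r s e = agree s e * sg J e := by
  rw [dv, h.mem_outer he he']
  generalize agree s e = a
  generalize sg J e = b
  split_ifs with h1
  · revert a b; decide
  · simp only [ne_eq, not_not] at h1
    rw [h1, units_mul_self]

/-- Since `r` satisfies the boundary of the smaller box, the formula valid outside that box extends
to this boundary. It lets the plaquettes of the extreme rows be treated uniformly. -/
lemma dv_bdry (h : CPair J n K k r s) {e : Edge} (he : e ∈ bdryE (n - 1) k) :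
    dv J n k r s e = agree s e * sg J e := by
  rw [h.dv_inner (Finset.mem_filter.1 he).1, h.bdry_r e he, mul_comm]

/-- Inside, `dv` is the product of two gradients and has trivial circulation. In the extreme rows it
compares `s` with the signs of the couplings, so its circulation is the frustration. -/
lemma prod_dv (h : CPair J n K k r s) {x y : ℤ} (hx : x ∈ Finset.Ico (-(k : ℤ)) k)
    (hy : y ∈ Finset.Ico (-(n : ℤ)) n) : ∏ e ∈ plaqE (x, y), dv J n k r s e =
      if x = 0 ∧ (y = n - 1 ∨ y = -n) then -1 else 1 := by
  have hc := h.cast_pred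
  have hn := h.hn
  have hkK := h.hkK
  rw [Finset.mem_Ico] at hx hy
  have fr : ∀ x y, ∏ e ∈ plaqE (x, y), (agree s e * sg J e) =
      open Classical in if Frustrated J (x, y) then -1 else 1 := by
    intro x y
    rw [Finset.prod_mul_distrib, prod_plaqE_agree, one_mul, frustrated_iff]
    split_ifs with h1
    · exact h1
    · exact (Int.units_eq_one_or _).resolve_right h1
  by_cases h1 : y = n - 1
  · subst h1
    rw [prod_plaqE, h.dv_bdry (by rw [mem_bdryE_hE]; omega),
      h.dv_outer (e := vE x _) (by rw [mem_boxE_vE]; omega) (by rw [mem_boxE_vE]; omega),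
      h.dv_outer (e := vE (x + 1) _) (by rw [mem_boxE_vE]; omega) (by rw [mem_boxE_vE]; omega),
      h.dv_outer (e := hE x (_ + 1)) (by rw [mem_boxE_hE]; omega) (by rw [mem_boxE_hE]; omega),
      ← prod_plaqE (fun e => agree s e * sg J e), fr,
      R.frustrated_top h.hR (x := x) (by rw [Finset.mem_Ico]; omega)]
    simp
  · by_cases h2 : y = -n
    · subst h2
      rw [prod_plaqE, h.dv_bdry (e := hE x (_ + 1)) (by rw [mem_bdryE_hE]; omega),
        h.dv_outer (e := vE x _) (by rw [mem_boxE_vE]; omega) (by rw [mem_boxE_vE]; omega),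
        h.dv_outer (e := vE (x + 1) _) (by rw [mem_boxE_vE]; omega) (by rw [mem_boxE_vE]; omega),
        h.dv_outer (e := hE x _) (by rw [mem_boxE_hE]; omega) (by rw [mem_boxE_hE]; omega),
        ← prod_plaqE (fun e => agree s e * sg J e), fr,
        R.frustrated_bot h.hR (x := x) (by rw [Finset.mem_Ico]; omega)]
      simp
    · rw [prod_plaqE, h.dv_inner (e := hE x (_ + 1)) (by rw [mem_boxE_hE]; omega),
        h.dv_inner (e := vE x _) (by rw [mem_boxE_vE]; omega),
        h.dv_inner (e := vE (x + 1) _) (by rw [mem_boxE_vE]; omega),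
        h.dv_inner (e := hE x _) (by rw [mem_boxE_hE]; omega),
        ← prod_plaqE (fun e => agree r e * agree s e), Finset.prod_mul_distrib, prod_plaqE_agree,
        prod_plaqE_agree, if_neg (by tauto), one_mul]

lemma dualEdge_in_box (h : CPair J n K k r s) {e : Edge} (he : e ∈ DD J n k r s) :
    ∃ a b, dualEdge e = s(a, b) ∧ a ≠ b ∧ (∀ z, z = a ∨ z = b →
      z ∈ Finset.Ico (-(k : ℤ)) k ×ˢ Finset.Ico (-(n : ℤ)) n) := by
  have h1 := h.mem_box he
  have h2 := h.notMem_bdry he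
  rcases e with ⟨⟨x, y⟩, _ | _⟩
  · refine ⟨_, _, dualEdge_hE x y, by simp; omega, ?_⟩
    rw [mem_boxE_hE] at h1
    rw [mem_bdryE_hE] at h2
    rintro z (rfl | rfl) <;> simp [Finset.mem_product] <;> omega
  · refine ⟨_, _, dualEdge_vE x y, by simp; omega, ?_⟩
    rw [mem_boxE_vE] at h1
    rw [mem_bdryE_vE] at h2
    rintro z (rfl | rfl) <;> simp [Finset.mem_product] <;> omega

/-- By parity, the two middle plaquettes are connected in the difference of `r` and `s`. -/
lemma reachable (h : CPair J n K k r s) :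
    (dualGraph n k (DD J n k r s)).Reachable (0, (n : ℤ) - 1) (0, -(n : ℤ)) := by
  classical
  by_contra hc
  have hn := h.hn
  have hk := h.hk
  set G := dualGraph n k (DD J n k r s) with hG
  -- The component of the upper middle plaquette. If it missed the lower one, the product of all
  -- circulations over it would be `-1`.
  set C := (Finset.Ico (-(k : ℤ)) k ×ˢ Finset.Ico (-(n : ℤ)) n).filter
    (G.Reachable (0, (n : ℤ) - 1)) with hC
  have hp : ((0 : ℤ), (n : ℤ) - 1) ∈ C := by
    rw [hC, Finset.mem_filter]
    refine ⟨?_, SimpleGraph.Reachable.refl _⟩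
    simp [Finset.mem_product]; omega
  have h1 : ∏ x ∈ C, ∏ e ∈ plaqE x, dv J n k r s e = -1 := by
    rw [Finset.prod_eq_single_of_mem _ hp]
    · rw [h.prod_dv (by rw [Finset.mem_Ico]; omega) (by rw [Finset.mem_Ico]; omega)]
      simp
    · rintro ⟨x, y⟩ hx hne
      rw [hC, Finset.mem_filter, Finset.mem_product] at hx
      rw [h.prod_dv hx.1.1 hx.1.2, if_neg]
      rintro ⟨rfl, rfl | rfl⟩
      · exact hne rfl
      · exact hc hx.2
  -- Exchanging the products, every edge of the difference is counted for both of its plaquettes or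
  -- for neither, since these are adjacent.
  have h2 : ∏ x ∈ C, ∏ e ∈ plaqE x, dv J n k r s e = 1 := by
    rw [Finset.prod_comm' (t' := C.biUnion plaqE) (s' := fun e => C.filter (e ∈ plaqE ·))]
    · refine Finset.prod_eq_one fun e _ => ?_
      by_cases he : e ∈ DD J n k r s
      · obtain ⟨a, b, hab, hne, hbox⟩ := h.dualEdge_in_box he
        have hadj : G.Adj a b :=
          dualGraph_adj.2 ⟨e, he, h.mem_box he, h.notMem_bdry he, hab⟩
        have hf : C.filter (e ∈ plaqE ·) = if a ∈ C then {a, b} else ∅ := by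
          have hiff : a ∈ C ↔ b ∈ C := by
            rw [hC, Finset.mem_filter, Finset.mem_filter]
            simp only [hbox a (Or.inl rfl), hbox b (Or.inr rfl), true_and]
            exact ⟨fun h => h.trans hadj.reachable, fun h => h.trans hadj.symm.reachable⟩
          ext z
          rw [Finset.mem_filter, mem_plaqE_iff, hab, Sym2.mem_iff]
          split_ifs with ha
          · have hb := hiff.1 ha
            simp only [Finset.mem_insert, Finset.mem_singleton]
            constructor
            · exact fun h => h.2
            · rintro (rfl | rfl)
              · exact ⟨ha, Or.inl rfl⟩
              · exact ⟨hb, Or.inr rfl⟩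
          · have hb := fun hb => ha (hiff.2 hb)
            simp only [Finset.notMem_empty, iff_false]
            rintro ⟨hz, rfl | rfl⟩
            · exact ha hz
            · exact hb hz
        rw [hf]
        split_ifs
        · rw [Finset.prod_pair hne, units_mul_self]
        · rfl
      · simp [dv, he]
    · intro x e
      simp only [Finset.mem_filter, Finset.mem_biUnion]
      constructor
      · rintro ⟨a, b⟩; exact ⟨⟨a, b⟩, x, a, b⟩
      · rintro ⟨a, _⟩; exact a
  rw [h1] at h2
  exact absurd h2 (by decide)

/-- The difference of `r` and `s` crosses a strong line only at its hole. -/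
lemma adj_cross (h : CPair J n K k r s) {x₀ y : ℤ} (hl : StrongLine J K x₀ y)
    (hx₀ : x₀ ∈ Finset.Ico (-(k : ℤ)) k) (hy : |y| < (n : ℤ) - 1) {a b : Plaquette}
    (hab : (dualGraph n k (DD J n k r s)).Adj a b) (ha : y ≤ a.2) (hb : b.2 < y) :
    a = (x₀, y) ∧ b = (x₀, y - 1) := by
  have hc := h.cast_pred
  have hy' := abs_lt.1 hy
  obtain ⟨e, he, hbox, hbd, hd⟩ := dualGraph_adj.1 hab
  rcases a with ⟨a1, a2⟩
  rcases b with ⟨b1, b2⟩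
  rcases e with ⟨⟨x, z⟩, _ | _⟩
  · change dualEdge (hE x z) = _ at hd
    rw [dualEdge_hE] at hd
    have hz : a1 = x ∧ b1 = x ∧ a2 = z ∧ b2 = z - 1 := by
      simp only [Sym2.eq_iff, Prod.mk.injEq] at hd
      omega
    obtain ⟨rfl, rfl, rfl, rfl⟩ := hz
    simp only at ha hb
    obtain rfl : a2 = y := by omega
    have hbox' : hE b1 a2 ∈ boxE n k := hbox
    rw [mem_boxE_hE] at hbox'
    -- Away from the hole both states satisfy the edge, hence it is not in their difference.
    have hxx : b1 = x₀ := by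
      by_contra hne
      have hi : hE b1 a2 ∈ boxE (n - 1) k := by rw [mem_boxE_hE]; omega
      rw [h.mem_inner hi] at he
      refine he ?_
      have cr := h.hr.cutOpt
      rw [hc] at cr
      have cs := h.hs.cutOpt
      have hkK : (k : ℤ) ≤ K := by exact_mod_cast h.hkK
      have hxm : b1 ∈ Finset.Ico (-(k : ℤ)) k := by rw [Finset.mem_Ico]; omega
      rw [(satisfied_iff (h.gen.ne_zero _)).1 (hl.satisfied hkK hx₀ cr hy hxm hne),
        (satisfied_iff (h.gen.ne_zero _)).1 (hl.satisfied hkK hx₀ cs (by omega) hxm hne)]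
    subst hxx
    exact ⟨rfl, rfl⟩
  · change dualEdge (vE x z) = _ at hd
    rw [dualEdge_vE] at hd
    simp only [Sym2.eq_iff, Prod.mk.injEq] at hd
    simp only at ha hb
    omega

end CPair


/-! ### Splitting paths at a bridge -/

section Walks

variable {V : Type*} {G : SimpleGraph V}

/-- If a single edge leaves `S`, a path that has left `S` cannot come back: it would have to revisit
`A`. -/
lemma exists_append_of_bridge {S : Set V} {A B : V}
    (hS : ∀ a b, G.Adj a b → a ∈ S → b ∉ S → a = A ∧ b = B) {p q : V} (P : G.Walk p q)
    (hP : P.IsPath) (hp : p ∈ S) (hq : q ∉ S) :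
    ∃ (P₁ : G.Walk p A) (h : G.Adj A B) (P₂ : G.Walk B q), P = P₁.append (.cons h P₂) ∧
      (∀ x ∈ P₁.support, x ∈ S) ∧ (∀ x ∈ P₂.support, x ∉ S) := by
  classical
  induction P with
  | nil => exact absurd hp hq
  | @cons u v w h P ih =>
    rw [SimpleGraph.Walk.cons_isPath_iff] at hP
    by_cases hv : v ∈ S
    · obtain ⟨P₁, h', P₂, rfl, h1, h2⟩ := ih hP.1 hv hq
      refine ⟨.cons h P₁, h', P₂, rfl, ?_, h2⟩
      intro x hx
      rw [SimpleGraph.Walk.support_cons, List.mem_cons] at hx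
      rcases hx with rfl | hx
      · exact hp
      · exact h1 x hx
    -- The path leaves `S` here. A later visit to `S` would enter it through the same bridge and so
    -- repeat the current vertex.
    · obtain ⟨rfl, rfl⟩ := hS _ _ h hp hv
      refine ⟨.nil, h, P, rfl, by simpa using hp, ?_⟩
      intro x hx hxS
      obtain ⟨d, hd, hd1, hd2⟩ := (P.takeUntil x hx).exists_boundary_dart Sᶜ hv (by simpa using hxS)
      have h3 := (hS _ _ d.adj.symm (by simpa using hd2) hd1).1
      apply hP.2
      rw [← h3]
      exact P.support_takeUntil_subset_support hx (SimpleGraph.Walk.dart_snd_mem_support_of_mem_darts _ hd)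

lemma isPath_append_cons {p q A B : V} {P₁ : G.Walk p A} (h : G.Adj A B) {P₂ : G.Walk B q}
    (h1 : P₁.IsPath) (h2 : P₂.IsPath) (hd : ∀ x ∈ P₁.support, x ∉ P₂.support) :
    (P₁.append (.cons h P₂)).IsPath := by
  rw [SimpleGraph.Walk.isPath_def, SimpleGraph.Walk.support_append,
    SimpleGraph.Walk.support_cons, List.tail_cons, List.nodup_append']
  exact ⟨h1.support_nodup, h2.support_nodup, hd⟩

end Walks

/-! ### Densities in squares -/

/-- The edges with ends `(x, y)` such that `|x| ≤ a` and `|y| ≤ a`. -/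
lemma squareEdges_eq (L : ℝ) : squareEdges L =
    ↑(((Finset.Icc (-⌊L / 2⌋) ⌊L / 2⌋ ×ˢ Finset.Icc (-⌊L / 2⌋) ⌊L / 2⌋) ×ˢ
      (Finset.univ : Finset Bool)).filter fun e : Edge =>
        (tgt e).1 ≤ ⌊L / 2⌋ ∧ (tgt e).2 ≤ ⌊L / 2⌋) := by
  have key : ∀ x : ℤ, |(x : ℝ)| ≤ L / 2 ↔ -⌊L / 2⌋ ≤ x ∧ x ≤ ⌊L / 2⌋ := by
    intro x
    rw [abs_le, Int.le_floor, neg_le, ← Int.cast_neg (R := ℝ) x, ← Int.le_floor, neg_le]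
  ext ⟨⟨x, y⟩, _ | _⟩
  · rw [Finset.mem_coe, Finset.mem_filter]
    simp only [squareEdges, Set.mem_ofPred_eq, key, src, tgt, Finset.mem_product, Finset.mem_Icc,
      Finset.mem_univ, and_true]
    simp
    omega
  · rw [Finset.mem_coe, Finset.mem_filter]
    simp only [squareEdges, Set.mem_ofPred_eq, key, src, tgt, Finset.mem_product, Finset.mem_Icc,
      Finset.mem_univ, and_true]
    simp
    omega

lemma squareEdges_finite (L : ℝ) : (squareEdges L).Finite := by
  rw [squareEdges_eq]; exact Finset.finite_toSet _

lemma densityIn_mono {A B : Set Edge} {L : ℝ} (h : A ∩ squareEdges L ⊆ B) :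
    densityIn A L ≤ densityIn B L := by
  refine div_le_div_of_nonneg_right (Nat.cast_le.2 (Set.ncard_le_ncard ?_ ?_)) (Nat.cast_nonneg _)
  · exact fun e he => ⟨h he, he.2⟩
  · exact (squareEdges_finite L).subset Set.inter_subset_right

lemma rpow_inv_hundred_le {k : ℕ} (hk : 1 ≤ k) : (k : ℝ) ^ (1 / 100 : ℝ) ≤ k := by
  have h : (1 : ℝ) ≤ k := by exact_mod_cast hk
  calc (k : ℝ) ^ (1 / 100 : ℝ) ≤ (k : ℝ) ^ (1 : ℝ) :=
        Real.rpow_le_rpow_of_exponent_le h (by norm_num)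
    _ = k := Real.rpow_one _

/-- The square of `BA` lies well within the height `100 k + 200` beyond which the strong lines are
placed, so the middle piece of the path decides both the density and the visit near the origin. -/
lemma snd_le_of_mem_square {k : ℕ} (hk : 1 ≤ k) {e : Edge}
    (he : e ∈ squareEdges (100 * (k : ℝ) ^ (1 / 100 : ℝ))) : |e.1.2| ≤ 50 * k := by
  have h := he.2.1
  have h2 := rpow_inv_hundred_le hk
  have h3 : |((e.1.2 : ℤ) : ℝ)| ≤ 50 * k := by
    refine (le_trans h ?_)
    linarith
  exact_mod_cast h3

lemma NearOrigin.snd_le {e : Edge} (h : NearOrigin 100 e) : |e.1.2| ≤ 101 := by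
  have : |e.1.2| ≤ 100 ∨ |(tgt e).2| ≤ 100 := by
    rcases h with h | h
    · left
      refine abs_le_of_sq_le_sq ?_ (by norm_num)
      simp only [src] at h
      nlinarith [sq_nonneg e.1.1]
    · right
      refine abs_le_of_sq_le_sq ?_ (by norm_num)
      nlinarith [sq_nonneg (tgt e).1]
  rcases e with ⟨⟨x, y⟩, _ | _⟩ <;> simp only [tgt, abs_le] at this ⊢ <;> simp at this ⊢ <;> omega

/-! ### Transfer of paths between two strong lines -/

lemma fst_mem_support_of_mem_crossed {G : SimpleGraph Plaquette} {p q : Plaquette}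
    {P : G.Walk p q} {e : Edge} (he : dualEdge e ∈ P.edges) : e.1 ∈ P.support :=
  P.fst_mem_support_of_mem_edges he

/-- The global sign `g` occurs at both ends of the edge and cancels. -/
lemma units_ne_transfer {g c1 c2 c3 c4 d1 d2 d3 d4 : ℤˣ} (e1 : d1 * d3 = g * (c1 * c3))
    (e2 : d2 * d4 = g * (c2 * c4)) (h : c1 * c2 ≠ c3 * c4) : d1 * d2 ≠ d3 * d4 := by
  intro hd
  apply h
  have h1 : d1 * d2 * (d3 * d4) = 1 := by rw [hd, units_mul_self]
  rw [mul_mul_mul_comm, e1, e2, mul_mul_mul_comm, units_mul_self, one_mul, mul_mul_mul_comm] at h1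
  rw [mul_eq_one_iff_eq_inv.1 h1, Int.units_inv_eq_self]

namespace CPair

variable {J J' : Couplings} {n n' K k : ℕ} {r s r' s' : Spins}

lemma exists_of_R (hJ : Generic J) (hR : J ∈ R n K) (hn : 2 ≤ n) (hk : 1 ≤ k) (hkK : k ≤ K) :
    ∃ r s, CPair J n K k r s := by
  obtain ⟨r, hr⟩ := exists_isCGroundState J (n - 1) k
  obtain ⟨s, hs⟩ := exists_isCGroundState J n k
  exact ⟨r, s, hJ, hR, hn, hk, hkK, hr, hs⟩

/-- Between two strong lines, the difference of the c-ground states is determined by the couplings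
between these lines. -/
lemma adj_transfer (h : CPair J n K k r s) (h' : CPair J' n' K k r' s') {y₁ y₂ : ℤ}
    (hJJ : AgreeBetween J J' y₁ y₂)
    (l₁ : StrongLine J K 0 y₁) (l₂ : StrongLine J K 0 y₂) (l₁' : StrongLine J' K 0 y₁)
    (l₂' : StrongLine J' K 0 y₂) (h12 : y₁ < y₂) (hb1 : -((n : ℤ) - 1) < y₁)
    (hb2 : y₂ < (n : ℤ) - 1) (hb1' : -((n' : ℤ) - 1) < y₁) (hb2' : y₂ < (n' : ℤ) - 1)
    {a b : Plaquette} (ha : y₁ ≤ a.2 ∧ a.2 < y₂) (hb : y₁ ≤ b.2 ∧ b.2 < y₂)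
    (hab : (dualGraph n k (DD J n k r s)).Adj a b) :
    (dualGraph n' k (DD J' n' k r' s')).Adj a b := by
  have hc := h.cast_pred
  have hc' := h'.cast_pred
  obtain ⟨α, tp⟩ := R.exists_twistedPair h.gen.ne_zero h.hR h.hn h.hk h.hkK h.hr h.hs
  obtain ⟨α', tp'⟩ := R.exists_twistedPair h'.gen.ne_zero h'.hR h'.hn h'.hk h'.hkK h'.hr h'.hs
  have blk := tp.block_eq h.gen h'.gen tp' (by exact_mod_cast h.hk) (by exact_mod_cast h.hkK) hJJ
    l₁ l₂ l₁' l₂' h12 hb1 hb2 hb1' hb2'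
  obtain ⟨e, he, hbox, hbd, hd⟩ := dualGraph_adj.1 hab
  rcases a with ⟨a1, a2⟩
  rcases b with ⟨b1, b2⟩
  simp only at ha hb
  rw [dualGraph_adj]
  refine ⟨e, ?_, ?_, ?_, hd⟩
  · rcases e with ⟨⟨x, z⟩, _ | _⟩
    · change dualEdge (hE x z) = _ at hd
      change hE x z ∈ _ at he
      change hE x z ∈ _ at hbox
      change hE x z ∈ _
      rw [dualEdge_hE] at hd
      simp only [Sym2.eq_iff, Prod.mk.injEq] at hd
      rw [mem_boxE_hE] at hbox
      have hin : hE x z ∈ boxE (n - 1) k := by rw [mem_boxE_hE]; omega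
      have hin' : hE x z ∈ boxE (n' - 1) k := by rw [mem_boxE_hE]; omega
      rw [h.mem_inner hin] at he
      rw [h'.mem_inner hin']
      have e1 := blk x z (by omega) (by omega) (by omega) (by omega)
      have e2 := blk (x + 1) z (by omega) (by omega) (by omega) (by omega)
      simp only [agree, src, tgt, Bool.false_eq_true, if_false, Prod.mk_add_mk, add_zero] at he ⊢
      generalize r (x, z) = c1 at *
      generalize r (x + 1, z) = c2 at *
      generalize s (x, z) = c3 at *
      generalize s (x + 1, z) = c4 at *
      generalize r' (x, z) = d1 at *
      generalize r' (x + 1, z) = d2 at *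
      generalize s' (x, z) = d3 at *
      generalize s' (x + 1, z) = d4 at *
      exact units_ne_transfer e1 e2 he
    · change dualEdge (vE x z) = _ at hd
      change vE x z ∈ _ at he
      change vE x z ∈ _ at hbox
      change vE x z ∈ _
      rw [dualEdge_vE] at hd
      simp only [Sym2.eq_iff, Prod.mk.injEq] at hd
      rw [mem_boxE_vE] at hbox
      have hin : vE x z ∈ boxE (n - 1) k := by rw [mem_boxE_vE]; omega
      have hin' : vE x z ∈ boxE (n' - 1) k := by rw [mem_boxE_vE]; omega
      rw [h.mem_inner hin] at he
      rw [h'.mem_inner hin']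
      have e1 := blk x z (by omega) (by omega) (by omega) (by omega)
      have e2 := blk x (z + 1) (by omega) (by omega) (by omega) (by omega)
      simp only [agree, src, tgt, if_true, Prod.mk_add_mk, add_zero] at he ⊢
      generalize r (x, z) = c1 at *
      generalize r (x, z + 1) = c2 at *
      generalize s (x, z) = c3 at *
      generalize s (x, z + 1) = c4 at *
      generalize r' (x, z) = d1 at *
      generalize r' (x, z + 1) = d2 at *
      generalize s' (x, z) = d3 at *
      generalize s' (x, z + 1) = d4 at *
      exact units_ne_transfer e1 e2 he
  · rcases e with ⟨⟨x, z⟩, _ | _⟩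
    · change dualEdge (hE x z) = _ at hd
      change hE x z ∈ _ at hbox
      change hE x z ∈ _
      rw [dualEdge_hE] at hd
      simp only [Sym2.eq_iff, Prod.mk.injEq] at hd
      rw [mem_boxE_hE] at hbox ⊢
      omega
    · change dualEdge (vE x z) = _ at hd
      change vE x z ∈ _ at hbox
      change vE x z ∈ _
      rw [dualEdge_vE] at hd
      simp only [Sym2.eq_iff, Prod.mk.injEq] at hd
      rw [mem_boxE_vE] at hbox ⊢
      omega
  · rcases e with ⟨⟨x, z⟩, _ | _⟩
    · change dualEdge (hE x z) = _ at hd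
      change hE x z ∉ _
      rw [dualEdge_hE] at hd
      simp only [Sym2.eq_iff, Prod.mk.injEq] at hd
      rw [mem_bdryE_hE]
      omega
    · change dualEdge (vE x z) = _ at hd
      change vE x z ∉ _ at hbd
      change vE x z ∉ _
      rw [dualEdge_vE] at hd
      simp only [Sym2.eq_iff, Prod.mk.injEq] at hd
      rw [mem_bdryE_vE] at hbd ⊢
      change vE x z ∈ _ at hbox
      rw [mem_boxE_vE] at hbox
      omega

/-- The part of a path between the middle plaquettes that lies between two strong lines. -/
lemma exists_split (h : CPair J n K k r s) {y₁ y₂ : ℤ} (l₁ : StrongLine J K 0 y₁)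
    (l₂ : StrongLine J K 0 y₂) (h12 : y₁ < y₂) (hb1 : -((n : ℤ) - 1) < y₁)
    (hb2 : y₂ < (n : ℤ) - 1)
    (P : (dualGraph n k (DD J n k r s)).Walk (0, (n : ℤ) - 1) (0, -(n : ℤ))) (hP : P.IsPath) :
    ∃ (P₁ : (dualGraph n k (DD J n k r s)).Walk (0, (n : ℤ) - 1) (0, y₂))
      (hA : (dualGraph n k (DD J n k r s)).Adj (0, y₂) (0, y₂ - 1))
      (Q : (dualGraph n k (DD J n k r s)).Walk (0, y₂ - 1) (0, y₁))
      (hB : (dualGraph n k (DD J n k r s)).Adj (0, y₁) (0, y₁ - 1))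
      (P₃ : (dualGraph n k (DD J n k r s)).Walk (0, y₁ - 1) (0, -(n : ℤ))),
      P = P₁.append (.cons hA (Q.append (.cons hB P₃))) ∧
      (∀ x ∈ P₁.support, y₂ ≤ x.2) ∧ (∀ x ∈ Q.support, y₁ ≤ x.2 ∧ x.2 < y₂) ∧
      (∀ x ∈ P₃.support, x.2 < y₁) := by
  have hk := h.hk
  have hx₀ : (0 : ℤ) ∈ Finset.Ico (-(k : ℤ)) k := by rw [Finset.mem_Ico]; omega
  obtain ⟨P₁, hA, P₂, rfl, s1, s2⟩ := exists_append_of_bridge (S := {z : Plaquette | y₂ ≤ z.2})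
    (fun a b hab ha hb => h.adj_cross l₂ hx₀ (by rw [abs_lt]; omega) hab ha (not_le.1 hb)) P hP
    (by simp only [Set.mem_ofPred_eq]; omega) (by simp only [Set.mem_ofPred_eq]; omega)
  obtain ⟨Q, hB, P₃, rfl, s3, s4⟩ := exists_append_of_bridge (S := {z : Plaquette | y₁ ≤ z.2})
    (fun a b hab ha hb => h.adj_cross l₁ hx₀ (by rw [abs_lt]; omega) hab ha (not_le.1 hb)) P₂
    (hP.of_append_right.of_cons)
    (by simp only [Set.mem_ofPred_eq]; omega) (by simp only [Set.mem_ofPred_eq]; omega)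
  refine ⟨P₁, hA, Q, hB, P₃, rfl, s1, fun x hx => ⟨s3 x hx, ?_⟩, fun x hx => not_le.1 (s4 x hx)⟩
  exact not_le.1 (s2 x (by rw [SimpleGraph.Walk.mem_support_append_iff]; exact Or.inl hx))

end CPair

lemma R.endpoints {J : Couplings} {n K k : ℕ} (hR : J ∈ R n K) (hn : 2 ≤ n) (hkK : k ≤ K)
    {p q : Plaquette} (hp : p ∈ DU n (n - 1) k) (hq : q ∈ DL n (n - 1) k) (Fp : Frustrated J p)
    (Fq : Frustrated J q) : p = (0, (n : ℤ) - 1) ∧ q = (0, -(n : ℤ)) := by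
  have hc : (((n - 1 : ℕ) : ℤ)) = (n : ℤ) - 1 := by omega
  rcases p with ⟨p1, p2⟩
  rcases q with ⟨q1, q2⟩
  simp only [DU, DL, Finset.mem_product, Finset.mem_Ico, hc] at hp hq
  obtain rfl : p2 = n - 1 := by omega
  obtain rfl : q2 = -n := by omega
  rw [R.frustrated_top hR (by rw [Finset.mem_Ico]; omega)] at Fp
  rw [R.frustrated_bot hR (by rw [Finset.mem_Ico]; omega)] at Fq
  rw [Fp, Fq]
  exact ⟨rfl, rfl⟩

lemma BA.of_path {J : Couplings} {n K k : ℕ} {r s : Spins} (h : CPair J n K k r s)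
    (P : (dualGraph n k (DD J n k r s)).Walk (0, (n : ℤ) - 1) (0, -(n : ℤ))) (hP : P.IsPath)
    (hnear : ∃ e ∈ crossed P, NearOrigin 100 e)
    (hdens : 1 / 100 ≤ densityIn (crossed P) (100 * (k : ℝ) ^ (1 / 100 : ℝ))) : J ∈ BA n k := by
  have hc := h.cast_pred
  have hk := h.hk
  have hkK := h.hkK
  have hn := h.hn
  refine ⟨r, s, h.hr, h.hs, _, ?_, _, ?_, ?_, ?_, P, hP, hnear, hdens⟩
  · simp only [DU, Finset.mem_product, Finset.mem_Ico, hc]; omega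
  · simp only [DL, Finset.mem_product, Finset.mem_Ico, hc]; omega
  · rw [R.frustrated_top h.hR (by rw [Finset.mem_Ico]; omega)]
  · rw [R.frustrated_bot h.hR (by rw [Finset.mem_Ico]; omega)]

/-- The event `BA` depends only on the couplings between two strong lines far from the origin. -/
lemma BA.transfer {J J' : Couplings} {n n' K k : ℕ} (hJ : Generic J) (hJ' : Generic J')
    (hR : J ∈ R n K) (hR' : J' ∈ R n' K) (hn : 2 ≤ n) (hn' : 2 ≤ n') (hk : 1 ≤ k) (hkK : k ≤ K)
    {y₁ y₂ : ℤ} (hJJ : AgreeBetween J J' y₁ y₂)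
    (l₁ : StrongLine J K 0 y₁) (l₂ : StrongLine J K 0 y₂) (l₁' : StrongLine J' K 0 y₁)
    (l₂' : StrongLine J' K 0 y₂) (hy1 : y₁ < -(100 * k + 200)) (hy2 : 100 * k + 200 < y₂)
    (hb1 : -((n : ℤ) - 1) < y₁) (hb2 : y₂ < (n : ℤ) - 1) (hb1' : -((n' : ℤ) - 1) < y₁)
    (hb2' : y₂ < (n' : ℤ) - 1) (h : J ∈ BA n k) : J' ∈ BA n' k := by
  classical
  obtain ⟨r, s, hr, hs, p, hp, q, hq, Fp, Fq, P, hP, ⟨e₀, he₀, hnear⟩, hdens⟩ := h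
  obtain ⟨rfl, rfl⟩ := R.endpoints hR hn hkK hp hq Fp Fq
  have c : CPair J n K k r s := ⟨hJ, hR, hn, hk, hkK, hr, hs⟩
  obtain ⟨r', s', c'⟩ := CPair.exists_of_R hJ' hR' hn' hk hkK
  obtain ⟨P', hP'⟩ := c'.reachable.exists_isPath
  have h12 : y₁ < y₂ := by omega
  obtain ⟨P₁, hA, Q, hB, P₃, rfl, s1, s2, s3⟩ := c.exists_split l₁ l₂ h12 hb1 hb2 P hP
  obtain ⟨P₁', hA', Q', hB', P₃', rfl, s1', s2', s3'⟩ :=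
    c'.exists_split l₁' l₂' h12 hb1' hb2' P' hP'
  -- Only the piece between the two lines is transported. The outer pieces are taken from any path
  -- for `J'`; they fit because all paths cross the lines at the same holes.
  have hedges : ∀ e ∈ Q.edges, e ∈ (dualGraph n' k (DD J' n' k r' s')).edgeSet := by
    intro e he
    induction e with
    | _ a b =>
      rw [SimpleGraph.mem_edgeSet]
      exact c.adj_transfer c' hJJ l₁ l₂ l₁' l₂' h12 hb1 hb2 hb1' hb2'
        (s2 a (Q.fst_mem_support_of_mem_edges he)) (s2 b (Q.snd_mem_support_of_mem_edges he))
        (Q.adj_of_mem_edges he)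
  have hQp : Q.IsPath := (hP.of_append_right.of_cons).of_append_left
  set Q₁ := Q.transfer _ hedges with hQ₁
  -- The strict bounds exclude the two bridges and the outer pieces, so every crossed edge
  -- considered comes from the transported piece.
  have hsub : ∀ e, y₁ < e.1.2 → e.1.2 < y₂ - 1 →
      e ∈ crossed (P₁.append (.cons hA (Q.append (.cons hB P₃)))) →
      e ∈ crossed (P₁'.append (.cons hA' (Q₁.append (.cons hB' P₃')))) := by
    intro e h1 h2 he
    simp only [crossed, Set.mem_ofPred_eq, SimpleGraph.Walk.edges_append,
      SimpleGraph.Walk.edges_cons, List.mem_append, List.mem_cons] at he ⊢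
    rcases he with he | he | he | he | he
    · have := s1 _ (fst_mem_support_of_mem_crossed he); omega
    · exfalso
      have : e.1 ∈ dualEdge e := Sym2.mem_mk_left _ _
      rw [he, Sym2.mem_iff] at this
      rcases this with h | h <;> rw [h] at h2 <;> simp only at h2 <;> omega
    · right; right; left
      rw [hQ₁, SimpleGraph.Walk.edges_transfer]
      exact he
    · exfalso
      have : e.1 ∈ dualEdge e := Sym2.mem_mk_left _ _
      rw [he, Sym2.mem_iff] at this
      rcases this with h | h <;> rw [h] at h1 <;> simp only at h1 <;> omega
    · have := s3 _ (fst_mem_support_of_mem_crossed he); omega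
  refine BA.of_path c' (P₁'.append (.cons hA' (Q₁.append (.cons hB' P₃')))) ?_ ?_ ?_
  · have hs2 : ∀ x ∈ Q₁.support, y₁ ≤ x.2 ∧ x.2 < y₂ := by
      intro x hx
      rw [hQ₁, SimpleGraph.Walk.support_transfer] at hx
      exact s2 x hx
    refine isPath_append_cons hA' hP'.of_append_left
      (isPath_append_cons hB' (hQp.transfer hedges)
        (hP'.of_append_right.of_cons.of_append_right.of_cons) ?_) ?_
    · intro x hx hx'
      have := hs2 x hx
      have := s3' x hx'
      omega
    · intro x hx hx'
      have h1 := s1' x hx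
      rw [SimpleGraph.Walk.mem_support_append_iff, SimpleGraph.Walk.support_cons,
        List.mem_cons] at hx'
      rcases hx' with hx' | rfl | hx'
      · have := hs2 x hx'; omega
      · simp only at h1; omega
      · have := s3' x hx'; omega
  · have := abs_le.1 hnear.snd_le
    exact ⟨e₀, hsub e₀ (by omega) (by omega) he₀, hnear⟩
  · refine hdens.trans (densityIn_mono ?_)
    rintro e ⟨he, hsq⟩
    have := abs_le.1 (snd_le_of_mem_square hk hsq)
    exact hsub e (by omega) (by omega) he


/-! ### A winding channel -/

/-- The holes of the winding channel: on the right in even lines, and on the left in odd lines. -/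
def windHole (k : ℕ) (y : ℤ) : ℤ := if Even y then k - 1 else -k

/-- All the lines at height at most `b` are strong, with holes at alternating ends. -/
def Winding (J : Couplings) (k : ℕ) (b : ℤ) : Prop :=
  ∀ y, |y| ≤ b → StrongLine J k (windHole k y) y

lemma windHole_mem {k : ℕ} (hk : 1 ≤ k) (y : ℤ) : windHole k y ∈ Finset.Ico (-(k : ℤ)) k := by
  rw [Finset.mem_Ico, windHole]; split_ifs <;> omega

/-- The corridor between two consecutive lines is entered at one end and left at the other, so all
the vertical edges inside it must be crossed. -/
lemma CPair.mem_crossed_of_winding {J : Couplings} {n k : ℕ} {r s : Spins} (h : CPair J n k k r s)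
    {b : ℤ} (hw : Winding J k b) (hb : b < n - 1)
    (P : (dualGraph n k (DD J n k r s)).Walk (0, (n : ℤ) - 1) (0, -(n : ℤ))) {x y : ℤ}
    (hx : -(k : ℤ) < x ∧ x < k) (hy : -b ≤ y ∧ y < b) : vE x y ∈ crossed P := by
  have hk := h.hk
  -- Everything above the corridor, together with the part of the corridor between its upper hole
  -- and the edge at `x`. The only exit from this set that the strong lines allow is across this
  -- edge.
  set U : Set Plaquette := {z | y < z.2 ∨ (z.2 = y ∧ if Even y then z.1 < x else x ≤ z.1)} with hU
  have hmem : ∀ z : Plaquette, z ∈ U ↔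
      (y < z.2 ∨ (z.2 = y ∧ if Even y then z.1 < x else x ≤ z.1)) := fun z => Iff.rfl
  obtain ⟨d, hd, hd1, hd2⟩ := P.exists_boundary_dart U
    (by rw [hmem]; left; simp only; omega)
    (by rw [hmem]; simp only; intro hc; rcases hc with hc | hc <;> omega)
  have hadj := d.adj
  have hed : s(d.fst, d.snd) ∈ P.edges := by
    rw [SimpleGraph.Walk.edges]; exact List.mem_map_of_mem hd
  generalize d.fst = p at *
  generalize d.snd = q at *
  rcases p with ⟨p1, p2⟩
  rcases q with ⟨q1, q2⟩
  rw [hmem] at hd1 hd2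
  simp only at hd1 hd2
  have hq2 : q2 ≤ y := not_lt.1 fun hc => hd2 (Or.inl hc)
  have upper := hw (y + 1) (by rw [abs_le]; omega)
  have lower := hw y (by rw [abs_le]; omega)
  have hp2 : p2 = y := by
    refine le_antisymm ?_ (hd1.elim le_of_lt fun h => h.1.ge)
    by_contra hc
    have := h.adj_cross upper (windHole_mem hk _) (by rw [abs_lt]; omega) hadj
      (by simp only; omega) (by simp only; omega)
    apply hd2
    right
    simp only [Prod.mk.injEq] at this
    refine ⟨by omega, ?_⟩
    simp only [windHole, Int.even_add_one] at this
    split_ifs with he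
    · simp only [he, not_true_eq_false, if_false] at this; omega
    · simp only [he, not_false_eq_true, if_true] at this; omega
  subst hp2
  simp only [lt_irrefl, true_and, false_or] at hd1
  have hq2' : q2 = p2 := by
    refine le_antisymm hq2 ?_
    by_contra hc
    have := h.adj_cross lower (windHole_mem hk _) (by rw [abs_lt]; omega) hadj
      (by simp only; omega) (by simp only; omega)
    simp only [Prod.mk.injEq] at this
    simp only [windHole] at this
    split_ifs at hd1 with he
    · simp only [he, if_true] at this; omega
    · simp only [he, if_false] at this; omega
  subst hq2'
  simp only [lt_irrefl, true_and, false_or] at hd2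
  obtain ⟨e, he, -, -, hd⟩ := dualGraph_adj.1 hadj
  rw [← hd] at hed
  rcases e with ⟨⟨a, c⟩, _ | _⟩
  · change dualEdge (hE a c) = _ at hd
    rw [dualEdge_hE] at hd
    simp only [Sym2.eq_iff, Prod.mk.injEq] at hd
    omega
  · have hd' : dualEdge (vE a c) = s((p1, q2), (q1, q2)) := hd
    rw [dualEdge_vE] at hd'
    simp only [Sym2.eq_iff, Prod.mk.injEq] at hd'
    have hac : a = x ∧ c = q2 := by
      split_ifs at hd1 hd2 <;> omega
    obtain ⟨rfl, rfl⟩ := hac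
    exact hed

lemma squareEdges_eq_union {L : ℝ} {a : ℕ} (ha : ⌊L / 2⌋ = a) : squareEdges L =
    ↑(((Finset.Ico (-(a : ℤ)) a ×ˢ Finset.Icc (-(a : ℤ)) a) ×ˢ ({false} : Finset Bool)) ∪
      ((Finset.Icc (-(a : ℤ)) a ×ˢ Finset.Ico (-(a : ℤ)) a) ×ˢ ({true} : Finset Bool))) := by
  rw [squareEdges_eq, ha]
  ext ⟨⟨x, y⟩, _ | _⟩ <;> rw [Finset.mem_coe, Finset.mem_filter] <;>
    rw [Finset.mem_coe, Finset.mem_union] <;>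
    simp only [Finset.mem_product, Finset.mem_Icc, Finset.mem_univ, and_true, tgt] <;>
    simp <;> omega

lemma disjoint_product_false_true (A B : Finset Vertex) :
    Disjoint (A ×ˢ ({false} : Finset Bool)) (B ×ˢ ({true} : Finset Bool)) := by
  rw [Finset.disjoint_left]
  rintro ⟨u, _ | _⟩ <;> simp

lemma ncard_squareEdges {L : ℝ} {a : ℕ} (ha : ⌊L / 2⌋ = a) :
    (squareEdges L).ncard = 4 * a * (2 * a + 1) := by
  rw [squareEdges_eq_union ha, Set.ncard_coe_finset,
    Finset.card_union_of_disjoint (disjoint_product_false_true _ _)]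
  simp only [Finset.card_product, Int.card_Ico, Int.card_Icc, Finset.card_singleton]
  have h1 : ((a : ℤ) - -a).toNat = 2 * a := by omega
  have h2 : ((a : ℤ) + 1 - -a).toNat = 2 * a + 1 := by omega
  rw [h1, h2]
  ring

/-- In a winding channel, the path fills a strip, so `BA` holds. -/
lemma BA.of_winding {J : Couplings} {n k : ℕ} (hJ : Generic J) (hR : J ∈ R n k) (hk : 2 ≤ k)
    {b : ℕ} (hw : Winding J k b) (hb : 100 * k ≤ b) (hbn : b + 1 < n) : J ∈ BA n k := by
  obtain ⟨r, s, c⟩ := CPair.exists_of_R hJ hR (by omega) (by omega) le_rfl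
  obtain ⟨P, hP⟩ := c.reachable.exists_isPath
  have key : ∀ x y : ℤ, -(k : ℤ) < x ∧ x < k → -(b : ℤ) ≤ y ∧ y < b → vE x y ∈ crossed P :=
    fun x y hx hy => c.mem_crossed_of_winding hw (by omega) P hx hy
  refine BA.of_path c P hP ⟨vE 0 0, key 0 0 (by omega) (by omega), Or.inl ?_⟩ ?_
  · simp [src]
  set L := 100 * (k : ℝ) ^ (1 / 100 : ℝ) with hL
  have hk1 : (1 : ℝ) ≤ (k : ℝ) ^ (1 / 100 : ℝ) :=
    Real.one_le_rpow (by exact_mod_cast (by omega : 1 ≤ k)) (by norm_num)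
  -- Bernoulli's inequality bounds the half side `a` by `2 a ≤ 99 + k`, which keeps the square from
  -- being much wider than the box when `k` is small.
  have hk2 : (k : ℝ) ^ (1 / 100 : ℝ) ≤ 1 + 1 / 100 * ((k : ℝ) - 1) := by
    have := rpow_one_add_le_one_add_mul_self (s := (k : ℝ) - 1) (p := 1 / 100)
      (by have : (0 : ℝ) ≤ k := Nat.cast_nonneg k
          linarith) (by norm_num) (by norm_num)
    simpa using this
  obtain ⟨a, ha⟩ : ∃ a : ℕ, ⌊L / 2⌋ = a := ⟨⌊L / 2⌋.toNat, (Int.toNat_of_nonneg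
    (Int.floor_nonneg.2 (by positivity))).symm⟩
  have ha1 : (50 : ℤ) ≤ a := by
    rw [← ha, Int.le_floor]; push_cast; linarith
  have ha2 : (a : ℝ) ≤ L / 2 := by
    have := Int.floor_le (L / 2)
    rw [ha] at this
    exact_mod_cast this
  have ha3 : 2 * a ≤ 99 + k := by
    have : (2 * a : ℝ) ≤ 99 + k := by linarith
    exact_mod_cast this
  -- The crossed vertical edges reach only to `|x| ≤ k - 1`; they number at least `(2 w + 1) (2 a)`,
  -- out of `4 a (2 a + 1)` edges of the square.
  set w := min (k - 1) a with hw'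
  have hsub : (↑((Finset.Icc (-(w : ℤ)) w ×ˢ Finset.Ico (-(a : ℤ)) a) ×ˢ
      ({true} : Finset Bool)) : Set Edge) ⊆ crossed P ∩ squareEdges L := by
    rintro ⟨⟨x, y⟩, t⟩ he
    rw [Finset.mem_coe] at he
    simp only [Finset.mem_product, Finset.mem_Icc, Finset.mem_Ico, Finset.mem_singleton] at he
    obtain ⟨⟨h1, h2⟩, rfl⟩ := he
    refine ⟨key x y (by omega) (by omega), ?_⟩
    rw [squareEdges_eq, ha, Finset.mem_coe, Finset.mem_filter]
    simp only [Finset.mem_product, Finset.mem_Icc, Finset.mem_univ, and_true, tgt]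
    simp
    omega
  have hcard : (2 * w + 1) * (2 * a) ≤ (crossed P ∩ squareEdges L).ncard := by
    refine le_trans (le_of_eq ?_) (Set.ncard_le_ncard hsub
      ((squareEdges_finite L).subset Set.inter_subset_right))
    rw [Set.ncard_coe_finset]
    simp only [Finset.card_product, Int.card_Ico, Int.card_Icc, Finset.card_singleton]
    have h1 : ((a : ℤ) - -a).toNat = 2 * a := by omega
    have h2 : ((w : ℤ) + 1 - -w).toNat = 2 * w + 1 := by omega
    rw [h1, h2, mul_one]
  have hpos : 0 < (squareEdges L).ncard := by
    have := (Set.ncard_le_ncard (Set.inter_subset_right (s := crossed P)) (squareEdges_finite L))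
    have h2 : 0 < (2 * w + 1) * (2 * a) := Nat.mul_pos (by omega) (by omega)
    omega
  rw [densityIn, le_div_iff₀ (by exact_mod_cast hpos)]
  have h4 : (squareEdges L).ncard ≤ 100 * ((2 * w + 1) * (2 * a)) := by
    refine (ncard_squareEdges ha).le.trans ?_
    have : 2 * (2 * a + 1) ≤ 100 * (2 * w + 1) := by
      have hcase := min_choice (k - 1) a
      rw [← hw'] at hcase
      rcases hcase with h | h <;> omega
    nlinarith
  have h5 : ((squareEdges L).ncard : ℝ) ≤ 100 * ((2 * w + 1) * (2 * a)) := by exact_mod_cast h4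
  have h6 : (((2 * w + 1) * (2 * a) : ℕ) : ℝ) ≤ ((crossed P ∩ squareEdges L).ncard : ℝ) := by
    exact_mod_cast hcard
  push_cast at h6
  linarith


/-! ### The law of the couplings -/

instance (v : ℝ≥0) : IsProbabilityMeasure (couplingLaw v) := by
  unfold couplingLaw; infer_instance

/-- The couplings equal to `J₁` on `S`, and to `J₂` elsewhere. -/
def glue (S : Set Edge) (J₁ J₂ : Couplings) : Couplings :=
  fun e => open Classical in if e ∈ S then J₁ e else J₂ e

lemma glue_of_mem {S : Set Edge} {J₁ J₂ : Couplings} {e : Edge} (h : e ∈ S) :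
    glue S J₁ J₂ e = J₁ e := by simp [glue, h]

lemma glue_of_notMem {S : Set Edge} {J₁ J₂ : Couplings} {e : Edge} (h : e ∉ S) :
    glue S J₁ J₂ e = J₂ e := by simp [glue, h]

lemma measurable_glue (S : Set Edge) :
    Measurable fun p : Couplings × Couplings => glue S p.1 p.2 := by
  refine measurable_pi_lambda _ fun e => ?_
  by_cases h : e ∈ S
  · simp only [glue_of_mem h]; fun_prop
  · simp only [glue_of_notMem h]; fun_prop

/-- Resampling the couplings outside `S` does not change their law. Independence, almost sure
genericity and the localization of events by Fubini all rest on this. -/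
lemma map_glue (v : ℝ≥0) (S : Set Edge) :
    ((couplingLaw v).prod (couplingLaw v)).map (fun p => glue S p.1 p.2) = couplingLaw v := by
  classical
  refine Measure.eq_infinitePi _ fun s t ht => ?_
  rw [Measure.map_apply (measurable_glue S) (.pi s.countable_toSet fun i _ => ht i)]
  have : (fun p : Couplings × Couplings => glue S p.1 p.2) ⁻¹' (Set.pi s t) =
      (Set.pi (s.filter (· ∈ S)) t) ×ˢ (Set.pi (s.filter (· ∉ S)) t) := by
    ext ⟨J₁, J₂⟩
    simp only [Set.mem_preimage, Set.mem_pi, Finset.mem_coe, Set.mem_prod, Finset.mem_filter]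
    constructor
    · intro h
      exact ⟨fun e he => by simpa [glue_of_mem he.2] using h e he.1,
        fun e he => by simpa [glue_of_notMem he.2] using h e he.1⟩
    · rintro ⟨h1, h2⟩ e he
      by_cases heS : e ∈ S
      · rw [glue_of_mem heS]; exact h1 e ⟨he, heS⟩
      · rw [glue_of_notMem heS]; exact h2 e ⟨he, heS⟩
  rw [this, Measure.prod_prod, couplingLaw, Measure.infinitePi_pi _ fun i _ => ht i,
    Measure.infinitePi_pi _ fun i _ => ht i, Finset.prod_filter_mul_prod_filter_not]

/-- Membership in `A` depends only on the couplings of the edges in `S`. -/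
def LocalTo (S : Set Edge) (A : Set Couplings) : Prop :=
  ∀ J J' : Couplings, (∀ e ∈ S, J e = J' e) → J ∈ A → J' ∈ A

lemma LocalTo.iff {S : Set Edge} {A : Set Couplings} (h : LocalTo S A) {J J' : Couplings}
    (hJ : ∀ e ∈ S, J e = J' e) : J ∈ A ↔ J' ∈ A :=
  ⟨h J J' hJ, h J' J fun e he => (hJ e he).symm⟩

lemma LocalTo.mono {S T : Set Edge} {A : Set Couplings} (h : LocalTo S A) (hST : S ⊆ T) :
    LocalTo T A := fun J J' hJ => h J J' fun e he => hJ e (hST he)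

lemma LocalTo.inter {S : Set Edge} {A B : Set Couplings} (hA : LocalTo S A) (hB : LocalTo S B) :
    LocalTo S (A ∩ B) := fun J J' hJ h => ⟨hA J J' hJ h.1, hB J J' hJ h.2⟩

lemma LocalTo.compl {S : Set Edge} {A : Set Couplings} (hA : LocalTo S A) : LocalTo S Aᶜ :=
  fun J J' hJ h h' => h (hA J' J (fun e he => (hJ e he).symm) h')

lemma LocalTo.iInter {S : Set Edge} {ι : Sort*} {A : ι → Set Couplings}
    (hA : ∀ i, LocalTo S (A i)) : LocalTo S (⋂ i, A i) := fun J J' hJ h => by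
  rw [Set.mem_iInter] at h ⊢
  exact fun i => hA i J J' hJ (h i)

/-- Events depending on disjoint sets of edges are independent. -/
lemma measure_inter_of_localTo (v : ℝ≥0) {S T : Set Edge} {A B : Set Couplings} (hA : LocalTo S A)
    (hB : LocalTo T B) (hST : Disjoint S T) (mA : MeasurableSet A) (mB : MeasurableSet B) :
    (couplingLaw v).real (A ∩ B) = (couplingLaw v).real A * (couplingLaw v).real B := by
  have h : couplingLaw v (A ∩ B) = couplingLaw v A * couplingLaw v B := by
    conv_lhs => rw [← map_glue v S]
    rw [Measure.map_apply (measurable_glue S) (mA.inter mB), ← Measure.prod_prod]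
    congr 1
    ext ⟨J₁, J₂⟩
    have h1 : glue S J₁ J₂ ∈ A ↔ J₁ ∈ A := hA.iff fun e he => glue_of_mem he
    have h2 : glue S J₁ J₂ ∈ B ↔ J₂ ∈ B := hB.iff fun e he =>
      glue_of_notMem (Set.disjoint_right.1 hST he)
    simp only [Set.mem_preimage, Set.mem_inter_iff, h1, h2, Set.mem_prod]
  rw [Measure.real, h, ENNReal.toReal_mul]; rfl

/-- Reversing the signs of the coupling constants in `T`. -/
def flipJ (T : Finset Edge) (J : Couplings) : Couplings := fun e => if e ∈ T then -J e else J e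

lemma measurePreserving_flipJ (v : ℝ≥0) (T : Finset Edge) :
    MeasurePreserving (flipJ T) (couplingLaw v) (couplingLaw v) := by
  have hm : ∀ e : Edge, Measurable fun x : ℝ => if e ∈ T then -x else x := by
    intro e; split_ifs <;> fun_prop
  refine ⟨measurable_pi_lambda _ fun e => (hm e).comp (measurable_pi_apply e), ?_⟩
  have := Measure.infinitePi_map_pi (μ := fun _ : Edge => gaussianReal 0 v) hm
  change (Measure.infinitePi _).map (fun J e => if e ∈ T then -J e else J e) = _
  rw [this, couplingLaw]
  congr 1
  funext e
  split_ifs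
  · have := gaussianReal_map_neg (μ := 0) (v := v)
    simpa using this
  · exact Measure.map_id

/-- Translation of couplings. -/
def shiftJ (t : Vertex) (J : Couplings) : Couplings := fun e => J (e.1 + t, e.2)

lemma measurePreserving_shiftJ (v : ℝ≥0) (t : Vertex) :
    MeasurePreserving (shiftJ t) (couplingLaw v) (couplingLaw v) := by
  refine ⟨measurable_pi_lambda _ fun e => measurable_pi_apply _, ?_⟩
  let f : Edge ≃ Edge := (Equiv.subRight t).prodCongr (Equiv.refl Bool)
  have := Measure.infinitePi_map_piCongrLeft (μ := fun _ : Edge => gaussianReal 0 v) f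
  rw [couplingLaw]
  refine Eq.trans ?_ this
  congr 1
  funext J e
  obtain ⟨e', rfl⟩ := f.surjective e
  rw [MeasurableEquiv.coe_piCongrLeft, Equiv.piCongrLeft_apply_apply]
  simp [shiftJ, f]

lemma measure_box (v : ℝ≥0) (F : Finset Edge) (U : Edge → Set ℝ) (hU : ∀ e, MeasurableSet (U e)) :
    (couplingLaw v).real {J | ∀ e ∈ F, J e ∈ U e} = ∏ e ∈ F, (gaussianReal 0 v).real (U e) := by
  have := Measure.infinitePi_pi (μ := fun _ : Edge => gaussianReal 0 v) (s := F) (t := U)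
    fun e _ => hU e
  rw [Measure.real, couplingLaw]
  change (Measure.infinitePi _ (Set.pi F U)).toReal = _
  rw [this, ENNReal.toReal_prod]; rfl

lemma gaussian_pos {v : ℝ≥0} (hv : v ≠ 0) {a b : ℝ} (hab : a < b) :
    0 < (gaussianReal 0 v).real (Set.Ioo a b) := by
  rw [Measure.real, ENNReal.toReal_pos_iff]
  refine ⟨pos_iff_ne_zero.2 fun h => ?_, measure_lt_top _ _⟩
  have := gaussianReal_absolutelyContinuous' 0 hv h
  simp at this
  linarith

/-- The coupling constants are almost surely generic. -/
lemma ae_generic {v : ℝ≥0} (hv : v ≠ 0) : ∀ᵐ J ∂couplingLaw v, Generic J := by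
  have key : ∀ F S : Finset Edge, F.Nonempty → ∀ᵐ J ∂couplingLaw v,
      ∑ e ∈ F, (if e ∈ S then -J e else J e : ℝ) ≠ 0 := by
    intro F S ⟨e₀, he₀⟩
    have hmeas : Measurable fun J : Couplings => ∑ e ∈ F, (if e ∈ S then -J e else J e : ℝ) := by
      refine Finset.measurable_sum _ fun e _ => ?_
      split_ifs <;> fun_prop
    have hms : MeasurableSet {J : Couplings | ∑ e ∈ F, (if e ∈ S then -J e else J e : ℝ) ≠ 0} :=
      (hmeas (measurableSet_singleton (0 : ℝ))).compl
    rw [← map_glue v {e₀}, ae_map_iff (measurable_glue _).aemeasurable hms]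
    have hm2 : MeasurableSet {p : Couplings × Couplings |
        ∑ e ∈ F, (if e ∈ S then -(glue {e₀} p.1 p.2 e) else glue {e₀} p.1 p.2 e : ℝ) ≠ 0} :=
      ((hmeas.comp (measurable_glue {e₀})) (measurableSet_singleton (0 : ℝ))).compl
    rw [← Measure.prod_swap, ae_map_iff measurable_swap.aemeasurable hm2, Measure.ae_prod_iff_ae_ae]
    · refine Eventually.of_forall fun J₂ => ?_
      -- With all other couplings frozen, the combination vanishes for one value of `J₁ e₀` only.
      have hnull : couplingLaw v {J₁ | J₁ e₀ = (if e₀ ∈ S then 1 else -1) *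
          ∑ e ∈ F.erase e₀, (if e ∈ S then -J₂ e else J₂ e : ℝ)} = 0 := by
        have h1 : couplingLaw v ((fun J => J e₀) ⁻¹' {(if e₀ ∈ S then 1 else -1) *
          ∑ e ∈ F.erase e₀, (if e ∈ S then -J₂ e else J₂ e : ℝ)}) = 0 := by
          have := nullSingletonClass_gaussianReal (μ := 0) hv
          exact ((measurePreserving_eval_infinitePi (fun _ : Edge => gaussianReal 0 v)
            e₀).measure_preimage (measurableSet_singleton _).nullMeasurableSet).trans
            (measure_singleton _)
        exact h1
      filter_upwards [measure_eq_zero_iff_ae_notMem.1 hnull] with J₁ hJ₁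
      simp only [Prod.fst_swap, Prod.snd_swap]
      rw [← Finset.add_sum_erase _ _ he₀]
      intro hc
      apply hJ₁
      have h2 : ∑ e ∈ F.erase e₀, (if e ∈ S then -(glue {e₀} J₁ J₂ e) else glue {e₀} J₁ J₂ e : ℝ) =
          ∑ e ∈ F.erase e₀, (if e ∈ S then -J₂ e else J₂ e : ℝ) := by
        refine Finset.sum_congr rfl fun e he => ?_
        rw [glue_of_notMem (by simpa using (Finset.mem_erase.1 he).1)]
      rw [h2, glue_of_mem (Set.mem_singleton e₀)] at hc
      show J₁ e₀ = _
      split_ifs at hc ⊢ <;> linarith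
    · exact measurable_swap hm2
  have h2 : ∀ᵐ J ∂couplingLaw v, ∀ F S : Finset Edge, F.Nonempty →
      ∑ e ∈ F, (if e ∈ S then -J e else J e : ℝ) ≠ 0 := by
    rw [ae_all_iff]; intro F
    rw [ae_all_iff]; intro S
    by_cases hF : F.Nonempty
    · filter_upwards [key F S hF] with J hJ _ using hJ
    · exact Eventually.of_forall fun J h => absurd h hF
  exact h2


/-! ### Measurability of the events -/

/-- A random subset of a finite set takes finitely many values, so any property of it, however
complicated, is measurable. -/
lemma measurableSet_finset_filter {F : Finset Edge} {q : Edge → Couplings → Prop}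
    (hq : ∀ e ∈ F, MeasurableSet {J | q e J}) (P : Set Edge → Prop) :
    MeasurableSet {J | P {e | e ∈ F ∧ q e J}} := by
  classical
  have : {J | P {e | e ∈ F ∧ q e J}} = ⋃ S ∈ F.powerset.filter (fun S : Finset Edge => P (S : Set Edge)),
      ⋂ e ∈ F, {J | q e J ↔ e ∈ S} := by
    ext J
    simp only [Set.mem_iUnion, Set.mem_iInter, Set.mem_ofPred_eq, Finset.mem_filter,
      Finset.mem_powerset, exists_prop]
    constructor
    · intro h
      refine ⟨F.filter fun e => q e J, ⟨Finset.filter_subset _ _, ?_⟩, fun e he => ?_⟩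
      · convert h using 1
        ext e; simp
      · simp [he]
    · rintro ⟨S, ⟨hS, hP⟩, h⟩
      convert hP using 1
      ext e
      simp only [Set.mem_ofPred_eq, Finset.mem_coe]
      exact ⟨fun he => (h e he.1).1 he.2, fun he => ⟨hS he, (h e (hS he)).2 he⟩⟩
  rw [this]
  refine Finset.measurableSet_biUnion _ fun S _ => Finset.measurableSet_biInter _ fun e he => ?_
  by_cases h : e ∈ S
  · simpa only [h, iff_true] using hq e he
  · simp only [h, iff_false]; exact (hq e he).compl

lemma measurable_ncard_filter {F : Finset Edge} {q : Edge → Couplings → Prop}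
    (hq : ∀ e ∈ F, MeasurableSet {J | q e J}) :
    Measurable fun J => {e | e ∈ F ∧ q e J}.ncard :=
  measurable_to_countable' fun i => measurableSet_finset_filter hq fun A => A.ncard = i

lemma measurableSet_neg (e : Edge) : MeasurableSet {J : Couplings | J e < 0} :=
  measurableSet_lt (measurable_pi_apply e) measurable_const

lemma measurableSet_even_neg (F : Finset Edge) :
    MeasurableSet {J : Couplings | Even (F.filter fun e => J e < 0).card} := by
  convert measurableSet_finset_filter (F := F) (q := fun e J => J e < 0)
    (fun e _ => measurableSet_neg e) fun A => Even A.ncard using 4 with J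
  rw [← Set.ncard_coe_finset]
  congr 1
  ext e; simp

lemma measurableSet_frustrated (p : Plaquette) : MeasurableSet {J | Frustrated J p} := by
  simp only [Frustrated, ← Nat.not_even_iff_odd]
  exact (measurableSet_even_neg _).compl

lemma measurableSet_sum_lt (B : Finset Edge) (e : Edge) :
    MeasurableSet {J : Couplings | ∑ e' ∈ B, |J e'| < |J e|} := by
  refine measurableSet_lt (Finset.measurable_sum _ fun e' _ => ?_) ?_
  · exact (measurable_pi_apply e').abs
  · exact (measurable_pi_apply e).abs

lemma measurableSet_forall_finset {ι : Type*} (s : Finset ι) {P : ι → Couplings → Prop}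
    (h : ∀ i ∈ s, MeasurableSet {J | P i J}) : MeasurableSet {J | ∀ i ∈ s, P i J} := by
  have : {J | ∀ i ∈ s, P i J} = ⋂ i ∈ s, {J | P i J} := by ext J; simp
  rw [this]
  exact Finset.measurableSet_biInter _ h

lemma measurableSet_iff_const {P : Couplings → Prop} (h : MeasurableSet {J | P J}) (q : Prop) :
    MeasurableSet {J | P J ↔ q} := by
  by_cases hq : q
  · simpa only [hq, iff_true] using h
  · simp only [hq, iff_false]; exact h.compl

lemma measurableSet_strongLine (k : ℕ) (x₀ y : ℤ) : MeasurableSet {J | StrongLine J k x₀ y} := by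
  refine measurableSet_forall_finset _ fun x _ => ?_
  by_cases h : x = x₀
  · simp [h]
  · simpa [h] using measurableSet_sum_lt _ _

/-- The pattern of frustration of an isolation row. -/
def RowPattern (J : Couplings) (k : ℕ) (y : ℤ) : Prop :=
  ∀ x ∈ Finset.Ico (-(k : ℤ)) k, Frustrated J (x, y) ↔ x = 0

/-- The inequalities defining an isolation row. -/
def RowStrong (J : Couplings) (k : ℕ) (y : ℤ) : Prop :=
  ∀ e ∈ rowHoriz k y, e ∉ plaqE (0, y) → ∑ e' ∈ plaqE (0, y) ∪ rowVert k y, |J e'| < |J e|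

lemma measurableSet_rowPattern (k : ℕ) (y : ℤ) : MeasurableSet {J | RowPattern J k y} :=
  measurableSet_forall_finset _ fun _ _ => measurableSet_iff_const (measurableSet_frustrated _) _

lemma measurableSet_rowStrong (k : ℕ) (y : ℤ) : MeasurableSet {J | RowStrong J k y} := by
  refine measurableSet_forall_finset _ fun e _ => ?_
  by_cases h : e ∈ plaqE (0, y)
  · simp [h]
  · simpa [h] using measurableSet_sum_lt _ _

lemma measurableSet_R (n k : ℕ) : MeasurableSet (R n k) := by
  have h1 : MeasurableSet {J : Couplings | ∀ k' : ℕ, 1 ≤ k' → k' ≤ k →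
      Even ((bdryE n k').filter fun e => J e < 0).card ∧
      Even ((bdryE (n - 1) k').filter fun e => J e < 0).card} := by
    have := measurableSet_forall_finset (Finset.Icc 1 k) (P := fun k' J =>
      Even ((bdryE n k').filter fun e => J e < 0).card ∧
      Even ((bdryE (n - 1) k').filter fun e => J e < 0).card)
      fun k' _ => (measurableSet_even_neg _).inter (measurableSet_even_neg _)
    simpa only [Finset.mem_Icc, and_imp] using this
  have h2 : MeasurableSet {J | ∀ p ∈ DU n (n - 1) k, Frustrated J p ↔ p = (0, ((n - 1 : ℕ) : ℤ))} :=
    measurableSet_forall_finset _ fun _ _ => measurableSet_iff_const (measurableSet_frustrated _) _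
  have h3 : MeasurableSet {J | ∀ p ∈ DL n (n - 1) k,
      Frustrated J p ↔ p = (0, -((n - 1 : ℕ) : ℤ) - 1)} :=
    measurableSet_forall_finset _ fun _ _ => measurableSet_iff_const (measurableSet_frustrated _) _
  have h4 : ∀ y, MeasurableSet {J | IsIsolation J k y} := fun y =>
    (measurableSet_rowPattern k y).inter (measurableSet_rowStrong k y)
  exact (h1.inter (h2.inter h3)).inter ((h4 _).inter (h4 _))

lemma measurableSet_R' (n k : ℕ) : MeasurableSet (R' n k) := by
  have : R' n k = R n k ∩ ⋂ n' : ℕ, ⋂ _ : k ≤ n', ⋂ _ : n' < n, (R n' k)ᶜ := by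
    ext J; simp [R']
  rw [this]
  exact (measurableSet_R n k).inter <| .iInter fun n' => .iInter fun _ => .iInter fun _ => (measurableSet_R n' k).compl

lemma measurable_bond (σ : Spins) (e : Edge) : Measurable fun J : Couplings => bond J σ e := by
  unfold bond; fun_prop

lemma measurableSet_satisfied (σ : Spins) (e : Edge) : MeasurableSet {J | Satisfied J σ e} :=
  measurableSet_lt measurable_const (measurable_bond σ e)

lemma bond_congr (J : Couplings) {n k : ℕ} {σ τ : Spins} (h : ∀ u ∈ boxV n k, σ u = τ u) {e : Edge}
    (he : e ∈ boxE n k) : bond J σ e = bond J τ e := by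
  rw [mem_boxE] at he
  rw [bond, bond, h _ he.1, h _ he.2]

lemma energy_congr (J : Couplings) {n k : ℕ} {σ τ : Spins} (h : ∀ u ∈ boxV n k, σ u = τ u) :
    energy J n k σ = energy J n k τ := by
  rw [energy, energy, Finset.sum_congr rfl fun e he => bond_congr J h he]

lemma DIS_congr (J : Couplings) {n k : ℕ} {σ τ : Spins} (h : ∀ u ∈ boxV n k, σ u = τ u) :
    DIS J n k σ = DIS J n k τ := by
  ext e
  simp only [DIS, Set.mem_ofPred_eq, and_congr_right_iff, Satisfied]
  intro he
  rw [bond_congr J h he]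

lemma bdryV_subset (n k : ℕ) : bdryV n k ⊆ boxV n k := Finset.filter_subset _ _

lemma IsCGroundState.congr {J : Couplings} {n k : ℕ} {σ τ : Spins} (hσ : IsCGroundState J n k σ)
    (h : ∀ u ∈ boxV n k, σ u = τ u) : IsCGroundState J n k τ := by
  have hb : ∀ u ∈ bdryV n k, σ u = τ u := fun u hu => h u (bdryV_subset n k hu)
  refine ⟨fun τ' => ?_, fun τ' hτ' => ?_⟩
  · rw [← satBdry_congr J hb]; exact hσ.1 τ'
  · rw [← energy_congr J h]; exact hσ.2 τ' fun u hu => (hτ' u hu).trans (hb u hu).symm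

/-- The spin assignment that is `-1` on `W` and `1` elsewhere. -/
def spinsOf (W : Finset Vertex) : Spins := flipOn W fun _ => 1

/-- Assignments with finitely many minus spins are countable and suffice for every condition in a
box; this replaces uncountable quantifiers over spins by countable ones. -/
lemma exists_spinsOf (σ : Spins) (B : Finset Vertex) :
    ∃ W, ∀ u ∈ B, spinsOf W u = σ u := by
  refine ⟨B.filter fun u => σ u = -1, fun u hu => ?_⟩
  rcases Int.units_eq_one_or (σ u) with h | h <;> simp [spinsOf, flipOn, hu, h]

lemma measurableSet_isCGroundState (n k : ℕ) (σ : Spins) :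
    MeasurableSet {J | IsCGroundState J n k σ} := by
  have : {J | IsCGroundState J n k σ} =
      (⋂ W : Finset Vertex, {J | (satBdry J n k (spinsOf W)).ncard ≤ (satBdry J n k σ).ncard}) ∩
      ⋂ W : Finset Vertex, ⋂ _ : ∀ u ∈ bdryV n k, spinsOf W u = σ u,
        {J | energy J n k σ ≤ energy J n k (spinsOf W)} := by
    ext J
    simp only [Set.mem_inter_iff, Set.mem_iInter, Set.mem_ofPred_eq]
    constructor
    · exact fun h => ⟨fun W => h.1 _, fun W hW => h.2 _ hW⟩
    · rintro ⟨h1, h2⟩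
      refine ⟨fun τ => ?_, fun τ hτ => ?_⟩
      · obtain ⟨W, hW⟩ := exists_spinsOf τ (boxV n k)
        rw [← satBdry_congr J fun u hu => hW u (bdryV_subset n k hu)]
        exact h1 W
      · obtain ⟨W, hW⟩ := exists_spinsOf τ (boxV n k)
        rw [← energy_congr J hW]
        exact h2 W fun u hu => (hW u (bdryV_subset n k hu)).trans (hτ u hu)
  rw [this]
  have hn : ∀ τ, Measurable fun J => (satBdry J n k τ).ncard := fun τ =>
    measurable_ncard_filter fun e _ => measurableSet_satisfied τ e
  have he : ∀ τ, Measurable fun J => energy J n k τ := fun τ =>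
    (Finset.measurable_sum _ fun e _ => measurable_bond τ e).neg
  exact (MeasurableSet.iInter fun W => measurableSet_le (hn _) (hn _)).inter
    (.iInter fun W => .iInter fun _ => measurableSet_le (he _) (he _))

/-- After the states are reduced to countably many, the existence of a suitable path depends only on
the random finite set of differing edges. -/
lemma measurableSet_BA (n k : ℕ) : MeasurableSet (BA n k) := by
  set Φ : Plaquette → Plaquette → Set Edge → Prop := fun p q A =>
    ∃ P : (dualGraph n k A).Walk p q, P.IsPath ∧ (∃ e ∈ crossed P, NearOrigin 100 e) ∧
      1 / 100 ≤ densityIn (crossed P) (100 * (k : ℝ) ^ (1 / 100 : ℝ)) with hΦ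
  have hbox : ∀ u ∈ boxV (n - 1) k, u ∈ boxV n k := by
    intro u hu
    rw [mem_boxV] at hu ⊢
    omega
  have : BA n k = ⋃ W : Finset Vertex, ⋃ W' : Finset Vertex, ⋃ p : Plaquette, ⋃ q : Plaquette,
      ⋃ _ : p ∈ DU n (n - 1) k, ⋃ _ : q ∈ DL n (n - 1) k,
      {J | IsCGroundState J (n - 1) k (spinsOf W)} ∩ {J | IsCGroundState J n k (spinsOf W')} ∩
      {J | Frustrated J p} ∩ {J | Frustrated J q} ∩
      {J | Φ p q (symmDiff (DIS J (n - 1) k (spinsOf W)) (DIS J n k (spinsOf W')))} := by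
    ext J
    simp only [Set.mem_iUnion, Set.mem_inter_iff, Set.mem_ofPred_eq]
    constructor
    · rintro ⟨r, s, hr, hs, p, hp, q, hq, Fp, Fq, P, hP⟩
      obtain ⟨W, hW⟩ := exists_spinsOf r (boxV (n - 1) k)
      obtain ⟨W', hW'⟩ := exists_spinsOf s (boxV n k)
      refine ⟨W, W', p, q, hp, hq, ⟨⟨⟨hr.congr fun u hu => (hW u hu).symm,
        hs.congr fun u hu => (hW' u hu).symm⟩, Fp⟩, Fq⟩, ?_⟩
      rw [DIS_congr J hW, DIS_congr J hW']
      exact ⟨P, hP⟩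
    · rintro ⟨W, W', p, q, hp, hq, ⟨⟨⟨hr, hs⟩, Fp⟩, Fq⟩, P, hP⟩
      exact ⟨_, _, hr, hs, p, hp, q, hq, Fp, Fq, P, hP⟩
  rw [this]
  refine .iUnion fun W => .iUnion fun W' => .iUnion fun p => .iUnion fun q => .iUnion fun _ =>
    .iUnion fun _ => ((((measurableSet_isCGroundState _ _ _).inter
      (measurableSet_isCGroundState _ _ _)).inter (measurableSet_frustrated _)).inter
      (measurableSet_frustrated _)).inter ?_
  have hd : ∀ n σ (e : Edge), MeasurableSet {J | e ∈ DIS J n k σ} := by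
    intro n σ e
    by_cases he : e ∈ boxE n k
    · simp only [DIS, Set.mem_ofPred_eq, he, true_and]
      exact (measurableSet_satisfied σ e).compl
    · simp [DIS, he]
  have hq : ∀ e ∈ boxE (n - 1) k ∪ boxE n k, MeasurableSet
      {J | e ∈ symmDiff (DIS J (n - 1) k (spinsOf W)) (DIS J n k (spinsOf W'))} := by
    intro e _
    simp only [Set.mem_symmDiff]
    exact ((hd _ _ e).inter (hd _ _ e).compl).union ((hd _ _ e).inter (hd _ _ e).compl)
  convert measurableSet_finset_filter hq (Φ p q) using 4 with J
  ext e
  simp only [Set.mem_ofPred_eq, iff_and_self, Finset.mem_union, Set.mem_symmDiff]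
  rintro (h | h)
  · exact Or.inl h.1.1
  · exact Or.inr h.1.1

lemma measurableSet_condEvent (c n k : ℕ) : MeasurableSet (condEvent c n k) := by
  have : condEvent c n k = R' n k ∩ ⋂ k' : ℕ, ⋂ _ : c + 1 < k', ⋂ _ : k' < k, BA n k' := by
    ext J; simp [condEvent]
  rw [this]
  exact (measurableSet_R' n k).inter <| .iInter fun k' => .iInter fun _ => .iInter fun _ => measurableSet_BA n k'

lemma measurableSet_generic : MeasurableSet {J | Generic J} := by
  have : {J | Generic J} = ⋂ F : Finset Edge, ⋂ S : Finset Edge, ⋂ _ : F.Nonempty,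
      {J : Couplings | ∑ e ∈ F, (if e ∈ S then -J e else J e : ℝ) ≠ 0} := by ext J; simp [Generic]
  rw [this]
  refine .iInter fun F => .iInter fun S => .iInter fun _ => ?_
  have hmeas : Measurable fun J : Couplings => ∑ e ∈ F, (if e ∈ S then -J e else J e : ℝ) := by
    refine Finset.measurable_sum _ fun e _ => ?_
    split_ifs <;> fun_prop
  exact (hmeas (measurableSet_singleton (0 : ℝ))).compl


/-! ### Bands of the lattice -/

/-- The edges meeting the open strip `a < y < b`. -/
def band (a b : ℤ) : Set Edge :=
  {e | if e.2 then a ≤ e.1.2 ∧ e.1.2 < b else a < e.1.2 ∧ e.1.2 < b}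

lemma hE_mem_band {a b x y : ℤ} : hE x y ∈ band a b ↔ a < y ∧ y < b := by simp [band]

lemma vE_mem_band {a b x y : ℤ} : vE x y ∈ band a b ↔ a ≤ y ∧ y < b := by simp [band]

lemma edge_cases {P : Edge → Prop} (h : ∀ x y, P (hE x y)) (v : ∀ x y, P (vE x y)) (e : Edge) :
    P e := by
  rcases e with ⟨⟨x, y⟩, _ | _⟩
  · exact h x y
  · exact v x y

lemma band_subset {a b c d : ℤ} (h1 : c ≤ a) (h2 : b ≤ d) : band a b ⊆ band c d := by
  refine edge_cases (fun x y => ?_) (fun x y => ?_)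
  · simp only [hE_mem_band]; omega
  · simp only [vE_mem_band]; omega

lemma band_disjoint {a b c d : ℤ} (h : b ≤ c) : Disjoint (band a b) (band c d) := by
  rw [Set.disjoint_left]
  refine edge_cases (fun x y => ?_) (fun x y => ?_)
  · simp only [hE_mem_band]; omega
  · simp only [vE_mem_band]; omega

lemma mem_plaqE {x y : ℤ} {e : Edge} :
    e ∈ plaqE (x, y) ↔ e = hE x y ∨ e = vE x y ∨ e = hE x (y + 1) ∨ e = vE (x + 1) y := by
  simp [plaqE]

lemma mem_lineNbr {k : ℕ} {x₀ y : ℤ} {e : Edge} : e ∈ lineNbr k x₀ y ↔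
    e = hE x₀ y ∨ ∃ x y', (-(k : ℤ) ≤ x ∧ x ≤ k) ∧ (y' = y - 1 ∨ y' = y) ∧ e = vE x y' := by
  rcases e with ⟨⟨a, b⟩, _ | _⟩ <;> simp [lineNbr]

lemma frustrated_congr {J J' : Couplings} {p : Plaquette} (h : ∀ e ∈ plaqE p, J e = J' e) :
    Frustrated J p ↔ Frustrated J' p := by
  rw [Frustrated, Frustrated, Finset.filter_congr fun e he => by rw [h e he]]

lemma plaqE_subset_band (x y : ℤ) : (plaqE (x, y) : Set Edge) ⊆ band (y - 1) (y + 2) := by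
  intro e he
  rw [Finset.mem_coe, mem_plaqE] at he
  rcases he with rfl | rfl | rfl | rfl <;> simp only [hE_mem_band, vE_mem_band] <;> omega

lemma localTo_rowPattern (k : ℕ) (y : ℤ) :
    LocalTo (band (y - 1) (y + 2)) {J | RowPattern J k y} := fun _ _ h hJ x hx =>
  (frustrated_congr fun e he => h e (plaqE_subset_band x y he)).symm.trans (hJ x hx)

lemma lineNbr_subset_band (k : ℕ) (x₀ y : ℤ) : (lineNbr k x₀ y : Set Edge) ⊆ band (y - 1) (y + 1) := by
  intro e he
  rw [Finset.mem_coe, mem_lineNbr] at he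
  rcases he with rfl | ⟨x, y', -, hy, rfl⟩ <;> simp only [hE_mem_band, vE_mem_band] <;> omega

lemma localTo_strongLine (k : ℕ) (x₀ y : ℤ) :
    LocalTo (band (y - 1) (y + 1)) {J | StrongLine J k x₀ y} := fun J J' h hJ x hx hne => by
  have hs : ∑ e ∈ lineNbr k x₀ y, |J e| = ∑ e ∈ lineNbr k x₀ y, |J' e| :=
    Finset.sum_congr rfl fun e he => by rw [h e (lineNbr_subset_band k x₀ y he)]
  rw [← h (hE x y) (by rw [hE_mem_band]; omega), ← hs]
  exact hJ x hx hne

lemma rowNbr_subset_band (k : ℕ) (y : ℤ) :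
    ((plaqE (0, y) ∪ rowVert k y : Finset Edge) : Set Edge) ⊆ band (y - 1) (y + 2) := by
  intro e he
  rw [Finset.mem_coe, Finset.mem_union] at he
  rcases he with he | he
  · exact plaqE_subset_band 0 y he
  · revert e
    refine edge_cases (fun x y => ?_) (fun x y => ?_)
    · simp [rowVert]
    · simp [rowVert, vE_mem_band]; omega

lemma rowHoriz_subset_band (k : ℕ) (y : ℤ) :
    (rowHoriz k y : Set Edge) ⊆ band (y - 1) (y + 2) := by
  refine edge_cases (fun x y => ?_) (fun x y => ?_)
  · simp [rowHoriz, hE_mem_band]; omega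
  · simp [rowHoriz]

lemma localTo_rowStrong (k : ℕ) (y : ℤ) :
    LocalTo (band (y - 1) (y + 2)) {J | RowStrong J k y} := fun J J' h hJ e he hne => by
  have hs : ∑ e ∈ plaqE (0, y) ∪ rowVert k y, |J e| = ∑ e ∈ plaqE (0, y) ∪ rowVert k y, |J' e| :=
    Finset.sum_congr rfl fun e he => by rw [h e (rowNbr_subset_band k y he)]
  rw [← h e (rowHoriz_subset_band k y he), ← hs]
  exact hJ e he hne

lemma bdryE_subset_band (n k : ℕ) : (bdryE n k : Set Edge) ⊆ band (-(n + 1)) (n + 1) := by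
  refine edge_cases (fun x y => ?_) (fun x y => ?_)
  · rw [Finset.mem_coe, mem_bdryE_hE, hE_mem_band]; omega
  · rw [Finset.mem_coe, mem_bdryE_vE, vE_mem_band]; omega

lemma localTo_R {n : ℕ} (hn : 1 ≤ n) (k : ℕ) : LocalTo (band (-(n + 1)) (n + 1)) (R n k) := by
  intro J J' h ⟨⟨h1, h2, h3⟩, h4, h5⟩
  have hb : ∀ n' k', n' ≤ n → ((bdryE n' k').filter fun e => J e < 0) =
      (bdryE n' k').filter fun e => J' e < 0 := fun n' k' hn' =>
    Finset.filter_congr fun e he => by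
      rw [h e (band_subset (by omega) (by omega) (bdryE_subset_band n' k' he))]
  have hp : ∀ x y : ℤ, -(n : ℤ) ≤ y → y < n → (Frustrated J (x, y) ↔ Frustrated J' (x, y)) :=
    fun x y _ _ => frustrated_congr fun e he =>
      h e (band_subset (by omega) (by omega) (plaqE_subset_band x y he))
  refine ⟨⟨fun k' hk1 hk2 => ?_, ?_, ?_⟩, ⟨?_, ?_⟩, ?_, ?_⟩
  · rw [← hb n k' le_rfl, ← hb (n - 1) k' (Nat.sub_le n 1)]
    exact h1 k' hk1 hk2
  · rintro ⟨x, y⟩ hxy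
    have := hxy
    rw [DU, Finset.mem_product, Finset.mem_Ico, Finset.mem_Ico] at this
    rw [← hp x y (by simp only at this; omega) (by simp only at this; omega)]
    exact h2 _ hxy
  · rintro ⟨x, y⟩ hxy
    have := hxy
    rw [DL, Finset.mem_product, Finset.mem_Ico, Finset.mem_Ico] at this
    rw [← hp x y (by simp only at this; omega) (by simp only at this; omega)]
    exact h3 _ hxy
  · intro x hx
    rw [← hp _ _ (by omega) (by omega)]
    exact h4.1 x hx
  · exact localTo_rowStrong k _ J J' (fun e he => h e (band_subset (by omega) (by omega) he)) h4.2
  · intro x hx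
    rw [← hp _ _ (by omega) (by omega)]
    exact h5.1 x hx
  · exact localTo_rowStrong k _ J J' (fun e he => h e (band_subset (by omega) (by omega) he)) h5.2

/-! ### Reversing signs -/

lemma sg_flipJ {J : Couplings} {e : Edge} (h : J e ≠ 0) (T : Finset Edge) :
    sg (flipJ T J) e = sg J e * if e ∈ T then -1 else 1 := by
  simp only [sg, flipJ]
  rcases lt_or_gt_of_ne h with h1 | h1 <;> by_cases hT : e ∈ T <;>
    simp [hT, h1, not_lt.2 h1.le]

/-- Only one edge of the plaquette can be reversed, so its parity changes exactly when that edge is.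
-/
lemma frustrated_flipJ {J : Couplings} (hJ : ∀ e, J e ≠ 0) {T : Finset Edge} {p : Plaquette}
    {e₀ : Edge} (he₀ : e₀ ∈ plaqE p) (h : ∀ e ∈ plaqE p, e ∈ T → e = e₀) :
    Frustrated (flipJ T J) p ↔ (Frustrated J p ↔ e₀ ∉ T) := by
  rw [frustrated_iff, frustrated_iff, Finset.prod_congr rfl fun e _ => sg_flipJ (hJ e) T,
    Finset.prod_mul_distrib, Finset.prod_eq_single (s := plaqE p) (f := fun e =>
      if e ∈ T then (-1 : ℤˣ) else 1) e₀ (fun e he hne => if_neg fun hT => hne (h e he hT))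
      fun hc => absurd he₀ hc]
  rcases Int.units_eq_one_or (∏ e ∈ plaqE p, sg J e) with h1 | h1 <;> by_cases h2 : e₀ ∈ T <;>
    simp [h1, h2]

lemma abs_flipJ (T : Finset Edge) (J : Couplings) (e : Edge) : |flipJ T J e| = |J e| := by
  rw [flipJ]; split_ifs <;> simp

lemma strongLine_flipJ {T : Finset Edge} {J : Couplings} {k : ℕ} {x₀ y : ℤ} :
    StrongLine (flipJ T J) k x₀ y ↔ StrongLine J k x₀ y := by
  simp only [StrongLine, abs_flipJ]

lemma rowStrong_flipJ {T : Finset Edge} {J : Couplings} {k : ℕ} {y : ℤ} :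
    RowStrong (flipJ T J) k y ↔ RowStrong J k y := by
  simp only [RowStrong, abs_flipJ]

lemma LocalTo.flipJ_mem {S : Set Edge} {A : Set Couplings} (h : LocalTo S A) {T : Finset Edge}
    (hT : ∀ e ∈ T, e ∉ S) {J : Couplings} : flipJ T J ∈ A ↔ J ∈ A :=
  h.iff fun e he => by rw [flipJ, if_neg fun hc => hT e hc he]

lemma ae_ne_zero {v : ℝ≥0} (hv : v ≠ 0) : ∀ᵐ J ∂couplingLaw v, ∀ e, J e ≠ 0 := by
  filter_upwards [ae_generic hv] with J hJ using hJ.ne_zero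

/-- The preimages of `B` under the sign reversals of subsets of `H` are equally likely, almost
surely disjoint, and all contained in `Q`. -/
lemma flip_disjoint {v : ℝ≥0} (hv : v ≠ 0) (H : Finset Edge) {B Q : Set Couplings}
    (mB : MeasurableSet B)
    (h1 : ∀ T ∈ H.powerset, ∀ T' ∈ H.powerset, ∀ J : Couplings, (∀ e, J e ≠ 0) →
      flipJ T J ∈ B → flipJ T' J ∈ B → T = T')
    (h2 : ∀ T ∈ H.powerset, ∀ J, flipJ T J ∈ B → J ∈ Q) :
    2 ^ H.card * (couplingLaw v).real B ≤ (couplingLaw v).real Q := by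
  have hm : ∀ T, (couplingLaw v).real (flipJ T ⁻¹' B) = (couplingLaw v).real B := fun T =>
    congrArg ENNReal.toReal ((measurePreserving_flipJ v T).measure_preimage mB.nullMeasurableSet)
  have hsum : ∑ T ∈ H.powerset, (couplingLaw v).real (flipJ T ⁻¹' B) =
      (couplingLaw v).real (⋃ T ∈ H.powerset, flipJ T ⁻¹' B) := by
    refine (measureReal_biUnion_finset₀ ?_ ?_).symm
    · intro T hT T' hT' hne
      refine measure_mono_null (t := {J | ¬ ∀ e, J e ≠ 0}) ?_ (ae_ne_zero hv)
      intro J hJ hc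
      exact hne (h1 T hT T' hT' J hc hJ.1 hJ.2)
    · exact fun T _ => ((measurePreserving_flipJ v T).measurable mB).nullMeasurableSet
  rw [Finset.sum_congr rfl fun T _ => hm T, Finset.sum_const, Finset.card_powerset,
    nsmul_eq_mul, Nat.cast_pow, Nat.cast_two] at hsum
  rw [hsum]
  refine measureReal_mono ?_
  intro J hJ
  simp only [Set.mem_iUnion, Set.mem_preimage, exists_prop] at hJ
  obtain ⟨T, hT, hJ⟩ := hJ
  exact h2 T hT J hJ

/-- If reversing some subset of `H` always leads from `Q` into `B`, the preimages of `B` cover `Q`,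
and they are equally likely. -/
lemma flip_cover {v : ℝ≥0} (hv : v ≠ 0) (H : Finset Edge) {B Q : Set Couplings}
    (mB : MeasurableSet B)
    (h : ∀ J ∈ Q, (∀ e, J e ≠ 0) → ∃ T ∈ H.powerset, flipJ T J ∈ B) :
    (couplingLaw v).real Q ≤ 2 ^ H.card * (couplingLaw v).real B := by
  have hm : ∀ T, (couplingLaw v).real (flipJ T ⁻¹' B) = (couplingLaw v).real B := fun T =>
    congrArg ENNReal.toReal ((measurePreserving_flipJ v T).measure_preimage mB.nullMeasurableSet)
  calc (couplingLaw v).real Q ≤ (couplingLaw v).real (⋃ T ∈ H.powerset, flipJ T ⁻¹' B) := by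
        refine ENNReal.toReal_mono (measure_ne_top _ _) (measure_mono_ae ?_)
        filter_upwards [ae_ne_zero hv] with J hJ hQ
        obtain ⟨T, hT, hB⟩ := h J hQ hJ
        exact Set.mem_biUnion (s := (↑H.powerset : Set (Finset Edge))) hT hB
    _ ≤ ∑ T ∈ H.powerset, (couplingLaw v).real (flipJ T ⁻¹' B) := measureReal_biUnion_finset_le _ _
    _ = _ := by
        rw [Finset.sum_congr rfl fun T _ => hm T, Finset.sum_const, Finset.card_powerset,
          nsmul_eq_mul, Nat.cast_pow, Nat.cast_two]

/-- The horizontal edges of the line at height `y`. -/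
def lineE (k : ℕ) (y : ℤ) : Finset Edge := (Finset.Ico (-(k : ℤ)) k).image fun x => hE x y

lemma mem_lineE {k : ℕ} {y : ℤ} {e : Edge} :
    e ∈ lineE k y ↔ ∃ x, (-(k : ℤ) ≤ x ∧ x < k) ∧ e = hE x y := by
  simp [lineE, eq_comm]

lemma hE_mem_lineE {k : ℕ} {x y : ℤ} : hE x y ∈ lineE k y ↔ -(k : ℤ) ≤ x ∧ x < k := by
  simp [lineE]

lemma card_lineE (k : ℕ) (y : ℤ) : (lineE k y).card = 2 * k := by
  rw [lineE, Finset.card_image_of_injective, Int.card_Ico]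
  · omega
  · intro a b h; simpa using h

lemma frustrated_flipJ_top {J : Couplings} (hJ : ∀ e, J e ≠ 0) {T : Finset Edge} {k : ℕ} {x y : ℤ}
    (hT : T ⊆ lineE k (y + 1)) :
    Frustrated (flipJ T J) (x, y) ↔ (Frustrated J (x, y) ↔ hE x (y + 1) ∉ T) := by
  refine frustrated_flipJ hJ (mem_plaqE.2 (by simp)) fun e he heT => ?_
  obtain ⟨x', -, rfl⟩ := mem_lineE.1 (hT heT)
  rw [mem_plaqE] at he
  simpa using he

/-- A given pattern of frustration has probability `4⁻ᵏ`, even conditionally on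
an event that is insensitive to the signs of the upper edges of the row. -/
lemma measure_rowPattern_le {v : ℝ≥0} (hv : v ≠ 0) {Q : Set Couplings} (mQ : MeasurableSet Q)
    {k : ℕ} {y : ℤ} (hQ : ∀ T ⊆ lineE k (y + 1), ∀ J, flipJ T J ∈ Q → J ∈ Q) :
    (couplingLaw v).real (Q ∩ {J | RowPattern J k y}) ≤ (1 / 4) ^ k * (couplingLaw v).real Q := by
  have := flip_disjoint hv (lineE k (y + 1)) (B := Q ∩ {J | RowPattern J k y}) (Q := Q)
    (mQ.inter (measurableSet_rowPattern k y)) ?_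
    fun T hT J h => hQ T (Finset.mem_powerset.1 hT) J h.1
  · rw [card_lineE, pow_mul] at this
    have h4 : (0 : ℝ) < 4 ^ k := by positivity
    rw [one_div, inv_pow, inv_mul_eq_div, le_div_iff₀ h4]
    norm_num at this
    linarith
  -- Each plaquette of the row has its own upper edge, and the required frustration decides whether
  -- that edge is reversed.
  · intro T hT T' hT' J hJ h h'
    rw [Finset.mem_powerset] at hT hT'
    ext e
    by_cases he : e ∈ lineE k (y + 1)
    · obtain ⟨x, hx, rfl⟩ := mem_lineE.1 he
      have h1 := h.2 x (Finset.mem_Ico.2 hx)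
      have h2 := h'.2 x (Finset.mem_Ico.2 hx)
      rw [frustrated_flipJ_top hJ hT] at h1
      rw [frustrated_flipJ_top hJ hT'] at h2
      tauto
    · exact ⟨fun h => absurd (hT h) he, fun h => absurd (hT' h) he⟩

/-! ### Probabilities of strong lines and rows -/

lemma sum_shift (t : Vertex) {A B : Finset Edge} (h : ∀ e : Edge, e ∈ A ↔ (e.1 + t, e.2) ∈ B)
    (J : Couplings) : ∑ e ∈ A, |shiftJ t J e| = ∑ e ∈ B, |J e| :=
  Finset.sum_equiv ((Equiv.addRight t).prodCongr (Equiv.refl Bool)) h fun _ _ => rfl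

lemma strongLine_shiftJ {J : Couplings} {k : ℕ} {x₀ y : ℤ} :
    StrongLine (shiftJ (0, y) J) k x₀ 0 ↔ StrongLine J k x₀ y := by
  refine forall_congr' fun x => imp_congr_right fun _ => imp_congr_right fun _ => ?_
  rw [sum_shift (0, y) (B := lineNbr k x₀ y)]
  · simp [shiftJ]
  · refine edge_cases (fun a b => ?_) (fun a b => ?_) <;> simp [lineNbr]
    omega

lemma rowStrong_shiftJ {J : Couplings} {k : ℕ} {y : ℤ} :
    RowStrong (shiftJ (0, y) J) k 0 ↔ RowStrong J k y := by
  have hs : ∑ e' ∈ plaqE (0, 0) ∪ rowVert k 0, |shiftJ (0, y) J e'| =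
      ∑ e' ∈ plaqE (0, y) ∪ rowVert k y, |J e'| := by
    refine sum_shift _ (edge_cases (fun a b => ?_) (fun a b => ?_)) _
    · simp [plaqE, rowVert]; omega
    · simp [plaqE, rowVert]; omega
  constructor
  · refine fun h => edge_cases (fun a b => ?_) (fun a b => ?_)
    · have := h (hE a (b - y))
      rw [hs] at this
      simp [rowHoriz, plaqE, shiftJ] at this ⊢
      intros
      apply this <;> omega
    · simp [rowHoriz]
  · refine fun h => edge_cases (fun a b => ?_) (fun a b => ?_)
    · have := h (hE a (b + y))
      rw [hs]
      simp [rowHoriz, plaqE, shiftJ] at this ⊢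
      intros
      apply this <;> omega
    · simp [rowHoriz]

/-- The probability that a line is strong. -/
def lineProb (v : ℝ≥0) (k : ℕ) : ℝ := (couplingLaw v).real {J | StrongLine J k 0 0}

lemma measure_strongLine (v : ℝ≥0) (k : ℕ) (y : ℤ) :
    (couplingLaw v).real {J | StrongLine J k 0 y} = lineProb v k := by
  rw [lineProb, Measure.real, Measure.real, ← (measurePreserving_shiftJ v (0, y)).measure_preimage
    (measurableSet_strongLine k 0 0).nullMeasurableSet]
  congr 2
  ext J
  exact strongLine_shiftJ.symm

/-- The probability that a row satisfies the inequalities of isolation. -/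
def rowProb (v : ℝ≥0) (k : ℕ) : ℝ := (couplingLaw v).real {J | RowStrong J k 0}

lemma measure_rowStrong (v : ℝ≥0) (k : ℕ) (y : ℤ) :
    (couplingLaw v).real {J | RowStrong J k y} = rowProb v k := by
  rw [rowProb, Measure.real, Measure.real, ← (measurePreserving_shiftJ v (0, y)).measure_preimage
    (measurableSet_rowStrong k 0).nullMeasurableSet]
  congr 2
  ext J
  exact rowStrong_shiftJ.symm

/-- With positive probability, all couplings in `A ∪ B` are positive, and those
in `A` dominate those in `B`. -/
lemma measure_dominate_pos {v : ℝ≥0} (hv : v ≠ 0) {A B : Finset Edge} (hAB : Disjoint A B) :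
    0 < (couplingLaw v).real {J | (∀ e ∈ A ∪ B, 0 < J e) ∧
      ∀ e ∈ A, ∀ C ⊆ B, ∑ e' ∈ C, |J e'| < |J e|} := by
  classical
  -- Couplings in `(0, 1)` on `B` sum to at most the cardinality of `B`, below which no coupling on
  -- `A` may lie.
  set U : Edge → Set ℝ := fun e => if e ∈ A then Set.Ioo (B.card : ℝ) (B.card + 1) else Set.Ioo 0 1
  have hU : ∀ e, MeasurableSet (U e) := fun e => by
    simp only [U]; split_ifs <;> exact measurableSet_Ioo
  have hpos : 0 < (couplingLaw v).real {J | ∀ e ∈ A ∪ B, J e ∈ U e} := by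
    rw [measure_box v _ U hU]
    refine Finset.prod_pos fun e _ => ?_
    simp only [U]
    split_ifs
    · exact gaussian_pos hv (by linarith)
    · exact gaussian_pos hv one_pos
  refine hpos.trans_le (measureReal_mono ?_)
  intro J hJ
  have h1 : ∀ e ∈ A, (B.card : ℝ) < J e := fun e he => by
    have := hJ e (Finset.mem_union_left _ he)
    simp only [U, he, if_true] at this
    exact this.1
  have h2 : ∀ e ∈ B, 0 < J e ∧ J e < 1 := fun e he => by
    have := hJ e (Finset.mem_union_right _ he)
    simp only [U, Finset.disjoint_right.1 hAB he, if_false] at this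
    exact this
  refine ⟨fun e he => ?_, fun e he C hC => ?_⟩
  · rcases Finset.mem_union.1 he with h | h
    · exact (Nat.cast_nonneg _).trans_lt (h1 e h)
    · exact (h2 e h).1
  · calc ∑ e' ∈ C, |J e'| ≤ ∑ e' ∈ B, |J e'| :=
          Finset.sum_le_sum_of_subset_of_nonneg hC fun _ _ _ => abs_nonneg _
      _ ≤ ∑ e' ∈ B, 1 := Finset.sum_le_sum fun e he => by
          rw [abs_of_pos (h2 e he).1]; exact (h2 e he).2.le
      _ = B.card := by simp
      _ < J e := h1 e he
      _ ≤ |J e| := le_abs_self _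

lemma lineProb_pos {v : ℝ≥0} (hv : v ≠ 0) (k : ℕ) : 0 < lineProb v k := by
  refine (measure_dominate_pos hv (A := (lineE k 0).erase (hE 0 0)) (B := lineNbr k 0 0)
    ?_).trans_le (measureReal_mono fun J hJ x hx hne => hJ.2 _ ?_ _ subset_rfl)
  · rw [Finset.disjoint_left]
    intro e he h
    rw [Finset.mem_erase, mem_lineE] at he
    obtain ⟨hne, x, -, rfl⟩ := he
    rw [mem_lineNbr] at h
    simp at h hne
    omega
  · rw [Finset.mem_erase, hE_mem_lineE]
    rw [Finset.mem_Ico] at hx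
    exact ⟨by simpa using hne, hx⟩

lemma lineProb_le_one (v : ℝ≥0) (k : ℕ) : lineProb v k ≤ 1 := measureReal_le_one

lemma rowProb_pos {v : ℝ≥0} (hv : v ≠ 0) (k : ℕ) : 0 < rowProb v k := by
  refine (measure_dominate_pos hv (A := (rowHoriz k 0).filter fun e => e ∉ plaqE (0, 0))
    (B := plaqE (0, 0) ∪ rowVert k 0) ?_).trans_le (measureReal_mono fun J hJ e he hne =>
      hJ.2 _ (Finset.mem_filter.2 ⟨he, hne⟩) _ subset_rfl)
  rw [Finset.disjoint_left]
  intro e he h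
  rw [Finset.mem_filter] at he
  rcases Finset.mem_union.1 h with h | h
  · exact he.2 h
  · have h1 : e.2 = false := by
      have := he.1
      simp only [rowHoriz, Finset.mem_product, Finset.mem_singleton] at this
      exact this.2
    simp only [rowVert, Finset.mem_product, Finset.mem_singleton] at h
    simp [h1] at h

/-- The probability that none of the lines `a, a + 2, …, a + 2 M - 2` is strong. -/
lemma measure_no_strongLine (v : ℝ≥0) (k : ℕ) (a : ℤ) (M : ℕ) :
    (couplingLaw v).real (⋂ i : Fin M, {J | StrongLine J k 0 (a + 2 * i)}ᶜ) =
      (1 - lineProb v k) ^ M := by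
  induction M with
  | zero => simp
  | succ M ih =>
    have hsplit : (⋂ i : Fin (M + 1), {J | StrongLine J k 0 (a + 2 * i)}ᶜ) =
        (⋂ i : Fin M, {J | StrongLine J k 0 (a + 2 * i)}ᶜ) ∩ {J | StrongLine J k 0 (a + 2 * M)}ᶜ := by
      ext J
      simp only [Set.mem_iInter, Set.mem_inter_iff, Fin.forall_fin_succ', Fin.val_castSucc,
        Fin.val_last]
    -- Spacing `2` makes the bands of neighbouring lines disjoint, hence the events independent.
    rw [hsplit, measure_inter_of_localTo v (S := band (a - 1) (a + 2 * M - 1))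
      (T := band (a + 2 * M - 1) (a + 2 * M + 1)) _ (localTo_strongLine _ _ _).compl
      (band_disjoint le_rfl) (.iInter fun i => (measurableSet_strongLine _ _ _).compl)
      (measurableSet_strongLine _ _ _).compl, ih, pow_succ,
      measureReal_compl (measurableSet_strongLine _ _ _), measure_strongLine]
    · simp
    · refine LocalTo.iInter fun i => (localTo_strongLine _ _ _).compl.mono ?_
      have := i.2
      exact band_subset (by omega) (by omega)


/-! ### The events `R(n, k)` occur almost surely -/

lemma prodI_cons (f : ℤ → ℤˣ) {a b : ℤ} (h : a < b) : prodI f a b = f a * prodI f (a + 1) b := by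
  have : Finset.Ico a b = insert a (Finset.Ico (a + 1) b) := by
    ext x; simp only [Finset.mem_insert, Finset.mem_Ico]; omega
  rw [prodI, this, Finset.prod_insert (by simp), prodI]

/-- Every interior vertical edge of the row belongs to two plaquettes and cancels. -/
lemma prodI_row (f : Edge → ℤˣ) (y : ℤ) {a b : ℤ} (h : a ≤ b) :
    prodI (fun x => ∏ e ∈ plaqE (x, y), f e) a b =
      prodI (fun x => f (hE x y)) a b * prodI (fun x => f (hE x (y + 1))) a b *
        (f (vE a y) * f (vE b y)) := by
  induction b, h using Int.leInduction with
  | base => simp [prodI_self]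
  | succ b hb ih =>
    rw [prodI_succ _ hb, prodI_succ _ hb, prodI_succ _ hb, ih, prod_plaqE]
    generalize prodI _ a b = A
    generalize prodI _ a b = B
    have h := units_mul_self (f (vE b y))
    calc _ = A * f (hE b y) * (B * f (hE b (y + 1))) * (f (vE a y) * f (vE (b + 1) y)) *
          (f (vE b y) * f (vE b y)) := by ac_rfl
      _ = _ := by rw [h, mul_one]

/-- The boundaries of the two boxes differ by the boundaries of the two extreme rows. With one
frustrated plaquette in each row the factors are `-1` and `-1`, so the parity for the smaller box
gives the one for the larger box. -/
lemma prod_bdryE_step (f : Edge → ℤˣ) {n k : ℕ} (hn : 2 ≤ n) (hk : 1 ≤ k) :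
    ∏ e ∈ bdryE n k, f e = (∏ e ∈ bdryE (n - 1) k, f e) *
      (prodI (fun x => ∏ e ∈ plaqE (x, (n : ℤ) - 1), f e) (-k) k *
        prodI (fun x => ∏ e ∈ plaqE (x, -(n : ℤ)), f e) (-k) k) := by
  have hc : (((n - 1 : ℕ) : ℤ)) = (n : ℤ) - 1 := by omega
  rw [prod_bdryE f (by omega) hk, prod_bdryE f (by omega) hk, hc, prodI_row f _ (by omega),
    prodI_row f _ (by omega)]
  have hv : ∀ g : ℤ → ℤˣ, prodI g (-n) n = g (-n) * prodI g (-(n - 1)) (n - 1) * g (n - 1) := by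
    intro g
    rw [prodI_cons g (by omega), mul_assoc, ← prodI_succ g (by omega)]
    congr 2 <;> ring
  rw [hv, hv, sub_add_cancel, show -(n : ℤ) + 1 = -(n - 1) by ring]
  generalize prodI _ (-(k : ℤ)) k = B
  generalize prodI _ (-(k : ℤ)) k = T
  generalize prodI _ (-(k : ℤ)) k = b
  generalize prodI _ (-(k : ℤ)) k = t
  generalize prodI _ (-((n : ℤ) - 1)) (n - 1) = l
  generalize prodI _ (-((n : ℤ) - 1)) (n - 1) = r
  generalize f (vE _ _) = u1
  generalize f (vE _ _) = u2
  generalize f (vE _ _) = u3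
  generalize f (vE _ _) = u4
  have h1 := units_mul_self b
  have h2 := units_mul_self t
  trans B * T * (u1 * l * u2 * (u3 * r * u4)) * (b * b) * (t * t)
  · rw [h1, h2, mul_one, mul_one]
  · ac_rfl

/-- The edges used to adjust the signs of the couplings for `R(n, k)`. -/
def adjustE (n k : ℕ) : Finset Edge :=
  lineE k n ∪ lineE k (-n) ∪ (Finset.Icc 1 k).image fun k' : ℕ => vE k' ((n : ℤ) - 2)

lemma card_adjustE_le (n k : ℕ) : (adjustE n k).card ≤ 5 * k := by
  refine (Finset.card_union_le _ _).trans ?_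
  have h1 := Finset.card_union_le (lineE k n) (lineE k (-n))
  have h2 : ((Finset.Icc 1 k).image fun k' : ℕ => vE k' ((n : ℤ) - 2)).card ≤ k :=
    Finset.card_image_le.trans (by simp)
  rw [card_lineE, card_lineE] at h1
  omega

/-- The inequalities of isolation ignore signs, and the remaining requirements are parities that can
be corrected independently. -/
lemma exists_flipJ_mem_R {J : Couplings} (hJ : ∀ e, J e ≠ 0) {n k : ℕ} (hn : 2 ≤ n)
    (h1 : RowStrong J k ((n : ℤ) - 1)) (h2 : RowStrong J k (-(n : ℤ))) :
    ∃ T ∈ (adjustE n k).powerset, flipJ T J ∈ R n k := by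
  classical
  have hc : (((n - 1 : ℕ) : ℤ)) = (n : ℤ) - 1 := by omega
  -- The outer horizontal edges correct the frustration of the two rows, one plaquette each. The
  -- vertical edge at abscissa `k'`, just below height `n - 1`, lies on the boundary of the box of
  -- half width `k'` but of no other half width, and corrects its parity.
  set T : Finset Edge :=
    ((lineE k n).filter fun e => ¬ (Frustrated J (e.1.1, (n : ℤ) - 1) ↔ e.1.1 = 0)) ∪
    ((lineE k (-n)).filter fun e => ¬ (Frustrated J (e.1.1, -(n : ℤ)) ↔ e.1.1 = 0)) ∪
    (((Finset.Icc 1 k).filter fun k' => ∏ e ∈ bdryE (n - 1) k', sg J e = -1).image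
      fun k' : ℕ => vE k' ((n : ℤ) - 2)) with hT
  have hTtop : ∀ x, hE x n ∈ T ↔
      (-(k : ℤ) ≤ x ∧ x < k) ∧ ¬ (Frustrated J (x, (n : ℤ) - 1) ↔ x = 0) := by
    intro x
    simp only [hT, Finset.mem_union, Finset.mem_filter, Finset.mem_image, mem_lineE]
    simp
    omega
  have hTbot : ∀ x, hE x (-n) ∈ T ↔
      (-(k : ℤ) ≤ x ∧ x < k) ∧ ¬ (Frustrated J (x, -(n : ℤ)) ↔ x = 0) := by
    intro x
    simp only [hT, Finset.mem_union, Finset.mem_filter, Finset.mem_image, mem_lineE]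
    simp
    omega
  have hTh : ∀ x y, hE x y ∈ T → y = n ∨ y = -n := by
    intro x y
    simp only [hT, Finset.mem_union, Finset.mem_filter, Finset.mem_image, mem_lineE]
    simp
    omega
  have hTv : ∀ x y, vE x y ∈ T ↔ y = n - 2 ∧ ∃ k' : ℕ, x = k' ∧ (1 ≤ k' ∧ k' ≤ k) ∧
      ∏ e ∈ bdryE (n - 1) k', sg J e = -1 := by
    intro x y
    simp only [hT, Finset.mem_union, Finset.mem_filter, Finset.mem_image, mem_lineE, Finset.mem_Icc]
    simp
    constructor
    · rintro ⟨a, ⟨h1, h2⟩, rfl, rfl⟩; exact ⟨rfl, a, rfl, h1, h2⟩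
    · rintro ⟨rfl, a, rfl, h1, h2⟩; exact ⟨a, ⟨h1, h2⟩, rfl, rfl⟩
  have hsub : T ⊆ adjustE n k := by
    rw [hT, adjustE]
    refine Finset.union_subset_union (Finset.union_subset_union (Finset.filter_subset _ _)
      (Finset.filter_subset _ _)) (Finset.image_subset_image (Finset.filter_subset _ _))
  have htop : RowPattern (flipJ T J) k ((n : ℤ) - 1) := by
    intro x hx
    rw [frustrated_flipJ hJ (e₀ := hE x n) (mem_plaqE.2 (by simp)), hTtop]
    · rw [Finset.mem_Ico] at hx; tauto
    · intro e he heT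
      rcases mem_plaqE.1 he with rfl | rfl | rfl | rfl
      · have := hTh _ _ heT; omega
      · have := (hTv _ _).1 heT; omega
      · simp
      · have := (hTv _ _).1 heT; omega
  have hbot : RowPattern (flipJ T J) k (-(n : ℤ)) := by
    intro x hx
    rw [frustrated_flipJ hJ (e₀ := hE x (-n)) (mem_plaqE.2 (by simp)), hTbot]
    · rw [Finset.mem_Ico] at hx; tauto
    · intro e he heT
      rcases mem_plaqE.1 he with rfl | rfl | rfl | rfl
      · simp
      · have := (hTv _ _).1 heT; omega
      · have := hTh _ _ heT; omega
      · have := (hTv _ _).1 heT; omega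
  have hin : ∀ k' : ℕ, 1 ≤ k' → k' ≤ k → ∏ e ∈ bdryE (n - 1) k', sg (flipJ T J) e = 1 := by
    intro k' hk1 hk2
    have hmem : vE k' ((n : ℤ) - 2) ∈ bdryE (n - 1) k' := by
      rw [mem_bdryE_vE]; omega
    rw [Finset.prod_congr rfl fun e _ => sg_flipJ (hJ e) T, Finset.prod_mul_distrib,
      Finset.prod_eq_single (s := bdryE (n - 1) k') (f := fun e =>
        if e ∈ T then (-1 : ℤˣ) else 1) (vE k' ((n : ℤ) - 2)) ?_ (fun hc => absurd hmem hc)]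
    · have : vE k' ((n : ℤ) - 2) ∈ T ↔ ∏ e ∈ bdryE (n - 1) k', sg J e = -1 := by
        rw [hTv]
        constructor
        · rintro ⟨-, k'', h, -, h'⟩
          obtain rfl : k' = k'' := by exact_mod_cast h
          exact h'
        · exact fun h => ⟨rfl, k', rfl, ⟨hk1, hk2⟩, h⟩
      rw [if_congr this rfl rfl]
      rcases Int.units_eq_one_or (∏ e ∈ bdryE (n - 1) k', sg J e) with h | h <;> rw [h] <;> decide
    · refine edge_cases (fun x y h hne => if_neg fun hc => ?_)
        (fun x y h hne => if_neg fun hc => ?_)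
      · have := hTh _ _ hc
        rw [mem_bdryE_hE] at h
        omega
      · obtain ⟨rfl, k'', rfl, h1, -⟩ := (hTv _ _).1 hc
        rw [mem_bdryE_vE] at h
        obtain rfl : k'' = k' := by omega
        exact hne rfl
  have hrow : ∀ y, RowPattern (flipJ T J) k y → ∀ k' : ℕ, 1 ≤ k' → k' ≤ k →
      prodI (fun x => ∏ e ∈ plaqE (x, y), sg (flipJ T J) e) (-k') k' = -1 := by
    intro y hy k' hk1 hk2
    rw [prodI, Finset.prod_eq_single 0]
    · exact (frustrated_iff _ _).1 ((hy 0 (by rw [Finset.mem_Ico]; omega)).2 rfl)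
    · intro x hx hne
      rw [Finset.mem_Ico] at hx
      have : ¬ Frustrated (flipJ T J) (x, y) := by
        rw [hy x (by rw [Finset.mem_Ico]; omega)]; exact hne
      rw [frustrated_iff] at this
      exact (Int.units_eq_one_or _).resolve_right this
    · intro h; exact absurd (Finset.mem_Ico.2 (by omega)) h
  refine ⟨T, Finset.mem_powerset.2 hsub, ⟨fun k' hk1 hk2 => ?_, ?_, ?_⟩, ⟨htop, ?_⟩, hbot, ?_⟩
  · rw [← prod_sg_eq_one_iff, ← prod_sg_eq_one_iff]
    refine ⟨?_, hin k' hk1 hk2⟩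
    rw [prod_bdryE_step _ hn hk1, hin k' hk1 hk2, hrow _ htop k' hk1 hk2, hrow _ hbot k' hk1 hk2]
    decide
  · rintro ⟨x, y⟩ hp
    simp only [DU, Finset.mem_product, Finset.mem_Ico, hc] at hp
    obtain rfl : y = n - 1 := by omega
    rw [htop x (Finset.mem_Ico.2 hp.1), hc]
    simp
  · rintro ⟨x, y⟩ hp
    simp only [DL, Finset.mem_product, Finset.mem_Ico, hc] at hp
    obtain rfl : y = -n := by omega
    rw [hbot x (Finset.mem_Ico.2 hp.1), hc]
    simp
  · exact rowStrong_flipJ.2 h1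
  · exact rowStrong_flipJ.2 h2

/-- Both rows satisfy the isolation inequalities independently of `Q`, and reversing at most `5 k`
signs then produces `R n k` without disturbing `Q`. -/
lemma measure_inter_R_ge {v : ℝ≥0} (hv : v ≠ 0) {Q : Set Couplings} (mQ : MeasurableSet Q)
    {n k : ℕ} (hn : 3 ≤ n) (hQ : LocalTo (band (-((n : ℤ) - 3)) ((n : ℤ) - 3)) Q) :
    rowProb v k ^ 2 / 2 ^ (5 * k) * (couplingLaw v).real Q ≤ (couplingLaw v).real (Q ∩ R n k) := by
  have hQA : (couplingLaw v).real ((Q ∩ {J | RowStrong J k ((n : ℤ) - 1)}) ∩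
      {J | RowStrong J k (-(n : ℤ))}) = (couplingLaw v).real Q * rowProb v k * rowProb v k := by
    have hd : Disjoint (band (-((n : ℤ) - 3)) (n + 1)) (band (-(n : ℤ) - 1) (-(n : ℤ) + 2)) :=
      (band_disjoint (by omega)).symm
    have hd' : Disjoint (band (-((n : ℤ) - 3)) ((n : ℤ) - 3))
      (band ((n : ℤ) - 1 - 1) ((n : ℤ) - 1 + 2)) := band_disjoint (by omega)
    rw [measure_inter_of_localTo v (S := band (-((n : ℤ) - 3)) (n + 1))
      (T := band (-(n : ℤ) - 1) (-(n : ℤ) + 2)) _ (localTo_rowStrong _ _)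
      hd (mQ.inter (measurableSet_rowStrong _ _))
      (measurableSet_rowStrong _ _), measure_rowStrong,
      measure_inter_of_localTo v hQ (localTo_rowStrong k ((n : ℤ) - 1))
        hd' mQ
      (measurableSet_rowStrong _ _), measure_rowStrong]
    have h1 : -((n : ℤ) - 3) ≤ (n : ℤ) - 1 - 1 := by omega
    exact (hQ.mono (band_subset le_rfl (by omega))).inter
      ((localTo_rowStrong k ((n : ℤ) - 1)).mono (band_subset h1 (by omega)))
  have h := flip_cover hv (adjustE n k) (B := Q ∩ R n k)
    (Q := (Q ∩ {J | RowStrong J k ((n : ℤ) - 1)}) ∩ {J | RowStrong J k (-(n : ℤ))})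
    (mQ.inter (measurableSet_R n k)) ?_
  · rw [hQA] at h
    have h2 : (2 : ℝ) ^ (adjustE n k).card ≤ 2 ^ (5 * k) :=
      pow_le_pow_right₀ (by norm_num) (card_adjustE_le n k)
    have h3 := mul_le_mul_of_nonneg_right h2 (measureReal_nonneg (μ := couplingLaw v)
      (s := Q ∩ R n k))
    rw [div_mul_eq_mul_div, div_le_iff₀ (by positivity)]
    linarith
  · rintro J ⟨⟨hJQ, h1⟩, h2⟩ hJ
    obtain ⟨T, hT, hTR⟩ := exists_flipJ_mem_R hJ (by omega) h1 h2
    refine ⟨T, hT, (hQ.flipJ_mem fun e he hb => ?_).2 hJQ, hTR⟩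
    have := Finset.mem_powerset.1 hT he
    simp only [adjustE, Finset.mem_union, mem_lineE, Finset.mem_image] at this
    rcases this with (⟨x, -, rfl⟩ | ⟨x, -, rfl⟩) | ⟨k', -, rfl⟩
    · rw [hE_mem_band] at hb; omega
    · rw [hE_mem_band] at hb; omega
    · rw [vE_mem_band] at hb; omega

/-- At each of a sequence of separated heights, `R` occurs with conditional probability at least a
fixed `ρ`, whatever happened before. -/
lemma ae_exists_R {v : ℝ≥0} (hv : v ≠ 0) (k n₀ : ℕ) :
    ∀ᵐ J ∂couplingLaw v, ∃ n, n₀ ≤ n ∧ J ∈ R n k := by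
  set ρ := rowProb v k ^ 2 / 2 ^ (5 * k) with hρ
  have hρ0 : 0 < ρ := by have := rowProb_pos hv k; positivity
  have hρ1 : ρ ≤ 1 := by
    rw [hρ, div_le_one (by positivity)]
    calc rowProb v k ^ 2 ≤ 1 := pow_le_one₀ (rowProb_pos hv k).le measureReal_le_one
      _ ≤ 2 ^ (5 * k) := one_le_pow₀ (by norm_num)
  -- Spacing `4` puts the earlier events, which live below height `N j + 1`, into the band below `N
  -- i - 3` required by `measure_inter_R_ge`.
  set N : ℕ → ℕ := fun i => n₀ + 3 + 4 * i with hN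
  set Q : ℕ → Set Couplings := fun i => ⋂ j : Fin i, (R (N j) k)ᶜ with hQ
  have mQ : ∀ i, MeasurableSet (Q i) := fun i => .iInter fun j => (measurableSet_R _ _).compl
  have hstep : ∀ i, (couplingLaw v).real (Q (i + 1)) ≤ (1 - ρ) * (couplingLaw v).real (Q i) := by
    intro i
    have hsplit : Q (i + 1) = Q i \ (Q i ∩ R (N i) k) := by
      ext J
      simp only [hQ, Set.mem_iInter, Set.mem_sdiff, Set.mem_inter_iff, Fin.forall_fin_succ',
        Fin.val_castSucc, Fin.val_last, Set.mem_compl_iff]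
      tauto
    rw [hsplit, measureReal_sdiff Set.inter_subset_left ((mQ i).inter (measurableSet_R _ _))]
    have := measure_inter_R_ge hv (mQ i) (n := N i) (k := k) (by simp only [hN]; omega) ?_
    · rw [← hρ] at this; linarith
    · refine LocalTo.iInter fun j => ((localTo_R (by simp only [hN]; omega) k).compl).mono ?_
      have := j.2
      refine band_subset ?_ ?_ <;> simp only [hN] <;> push_cast <;> omega
  have hpow : ∀ i, (couplingLaw v).real (Q i) ≤ (1 - ρ) ^ i := by
    intro i
    induction i with
    | zero => simp
    | succ i ih =>
      refine (hstep i).trans ?_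
      rw [pow_succ']
      exact mul_le_mul_of_nonneg_left ih (by linarith)
  have hlim : Tendsto (fun i : ℕ => (1 - ρ) ^ i) atTop (𝓝 0) :=
    tendsto_pow_atTop_nhds_zero_of_lt_one (by linarith) (by linarith)
  have hz : (couplingLaw v).real {J | ¬ ∃ n, n₀ ≤ n ∧ J ∈ R n k} ≤ 0 := by
    refine ge_of_tendsto' hlim fun i => le_trans (measureReal_mono ?_) (hpow i)
    intro J hJ
    simp only [hQ, Set.mem_iInter, Set.mem_compl_iff]
    exact fun j hc => hJ ⟨_, by simp only [hN]; omega, hc⟩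
  rw [ae_iff]
  exact (measureReal_eq_zero_iff).1 (le_antisymm hz measureReal_nonneg)


/-! ### Local events that force `BA` -/

/-- There is an event of probability at least `d`, determined by the couplings between the heights
`-m` and `m`, that excludes `R(n, k)` for `n < m`, and on which `R(n, k)` with `n ≥ m` entails
the events `BA(n, k')` with `c + 1 < k' ≤ k`. -/
def Good (v : ℝ≥0) (c k m : ℕ) (d : ℝ) : Prop :=
  100 * k + 300 ≤ m ∧ ∃ E : Set Couplings, MeasurableSet E ∧ LocalTo (band (-m) m) E ∧
    d ≤ (couplingLaw v).real E ∧ (∀ J ∈ E, ∀ n, k ≤ n → n < m → J ∉ R n k) ∧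
    ∀ J ∈ E, Generic J → ∀ n, m ≤ n → J ∈ R n k → ∀ k', c + 1 < k' → k' ≤ k → J ∈ BA n k'

/-- The base of the induction: a finite set of positive couplings with a winding channel. Only `k' =
c + 2` is in question, so `BA.of_winding` supplies everything. -/
lemma exists_good {v : ℝ≥0} (hv : v ≠ 0) (c : ℕ) : ∃ m d, 0 < d ∧ Good v c (c + 2) m d := by
  classical
  set k := c + 2 with hk
  set b := 100 * k + 300 with hb
  set m := b + 2 with hm
  set X : Finset Edge := ((Finset.Icc (-(k : ℤ)) k ×ˢ Finset.Icc (-(m : ℤ)) m) ×ˢ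
    (Finset.univ : Finset Bool)).filter fun e => e ∈ band (-m) m with hX
  have hXh : ∀ x y, hE x y ∈ X ↔ (-(k : ℤ) ≤ x ∧ x ≤ k) ∧ -(m : ℤ) < y ∧ y < m := by
    intro x y
    simp [hX, hE_mem_band]; omega
  have hXv : ∀ x y, vE x y ∈ X ↔ (-(k : ℤ) ≤ x ∧ x ≤ k) ∧ -(m : ℤ) ≤ y ∧ y < m := by
    intro x y
    simp [hX, vE_mem_band]; omega
  set q : Edge → Prop := fun e => e.2 = false ∧ |e.1.2| ≤ (b : ℤ) ∧
    (-(k : ℤ) ≤ e.1.1 ∧ e.1.1 < k) ∧ e.1.1 ≠ windHole k e.1.2 with hq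
  set A := X.filter q with hA
  set B := X.filter fun e => ¬ q e with hB
  have hAB : A ∪ B = X := Finset.filter_union_filter_not_eq _ _
  set E : Set Couplings := {J | (∀ e ∈ A ∪ B, 0 < J e) ∧
    ∀ e ∈ A, ∀ C ⊆ B, ∑ e' ∈ C, |J e'| < |J e|} with hE'
  have hwind : ∀ J ∈ E, Winding J k b := by
    intro J hJ y hy x hx hne
    rw [Finset.mem_Ico] at hx
    have hy' := abs_le.1 hy
    refine hJ.2 (hE x y) ?_ _ ?_
    · rw [hA, Finset.mem_filter, hXh]
      exact ⟨by omega, rfl, hy, hx, hne⟩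
    · intro e he
      have hw := Finset.mem_Ico.1 (windHole_mem (k := k) (by omega) y)
      rw [hB, Finset.mem_filter]
      rcases mem_lineNbr.1 he with rfl | ⟨x', y', hx', hy', rfl⟩
      · rw [hXh]
        exact ⟨by omega, fun h => h.2.2.2 rfl⟩
      · rw [hXv]
        exact ⟨by omega, fun h => by simp [hq] at h⟩
  have hdisj : Disjoint A B := Finset.disjoint_filter_filter_not _ _ _
  refine ⟨m, (couplingLaw v).real E, measure_dominate_pos hv hdisj, by omega, E, ?_, ?_, le_rfl,
    ?_, ?_⟩
  · refine (measurableSet_forall_finset _ fun e _ => ?_).inter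
      (measurableSet_forall_finset _ fun e _ => ?_)
    · exact measurableSet_lt measurable_const (measurable_pi_apply e)
    · have := measurableSet_forall_finset B.powerset
        (P := fun C J => ∑ e' ∈ C, |J e'| < |J e|) fun C _ => measurableSet_sum_lt C e
      simpa only [Finset.mem_powerset] using this
  · intro J J' h hJ
    have hX' : ∀ e ∈ X, J e = J' e := fun e he => h e (Finset.mem_filter.1 he).2
    refine ⟨fun e he => ?_, fun e he C hC => ?_⟩
    · rw [← hX' e (hAB ▸ he)]; exact hJ.1 e he
    · have hs : ∑ e' ∈ C, |J e'| = ∑ e' ∈ C, |J' e'| := Finset.sum_congr rfl fun e' he' => by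
        rw [hX' e' (Finset.filter_subset _ _ (hC he'))]
      rw [← hX' e (Finset.filter_subset _ _ he), ← hs]
      exact hJ.2 e he C hC
  -- All couplings near the channel are positive, so there is no frustrated plaquette, as `R n k`
  -- would require.
  · intro J hJ n hn1 hn2 hR
    have hf := (R.frustrated_top hR (x := 0) (by rw [Finset.mem_Ico]; omega)).2 rfl
    rw [Frustrated, Finset.filter_false_of_mem] at hf
    · simp at hf
    · intro e he
      refine not_lt.2 (hJ.1 e ?_).le
      rw [hAB]
      rcases mem_plaqE.1 he with rfl | rfl | rfl | rfl
      · rw [hXh]; omega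
      · rw [hXv]; omega
      · rw [hXh]; omega
      · rw [hXv]; omega
  · intro J hJ hgen n hn hR k' h1 h2
    obtain rfl : k' = k := by omega
    exact BA.of_winding hgen hR (by omega) (hwind J hJ) (by omega) (by omega)

/-- The part of `R(n, k)` that concerns the upper row. -/
def upperRow (k : ℕ) (n : ℤ) : Set Couplings :=
  {J | StrongLine J k 0 n} ∩ {J | RowPattern J k (n - 1)}

lemma measurableSet_upperRow (k : ℕ) (n : ℤ) : MeasurableSet (upperRow k n) :=
  (measurableSet_strongLine _ _ _).inter (measurableSet_rowPattern _ _)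

lemma localTo_upperRow (k : ℕ) (n : ℤ) : LocalTo (band (n - 2) (n + 1)) (upperRow k n) :=
  ((localTo_strongLine k 0 n).mono (band_subset (by omega) le_rfl)).inter
    ((localTo_rowPattern k (n - 1)).mono (band_subset (by omega) (by omega)))

lemma R_subset_upperRow (n k : ℕ) : R n k ⊆ upperRow k n := fun _ hJ =>
  ⟨R.strongLine_top hJ (Or.inr rfl), hJ.2.1.1⟩

/-- A gap of one row makes the strong line independent of `Q`; the frustration pattern contributes
the further factor `4⁻ᵏ`. The factor `lineProb` is what makes avoidance cheap compared with the
search for strong lines. -/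
lemma measure_inter_upperRow_le {v : ℝ≥0} (hv : v ≠ 0) {Q : Set Couplings} (mQ : MeasurableSet Q)
    (k : ℕ) {a n : ℤ} (hQ : LocalTo (band a (n - 1)) Q) :
    (couplingLaw v).real (Q ∩ upperRow k n) ≤
      (1 / 4) ^ k * lineProb v k * (couplingLaw v).real Q := by
  rw [upperRow, ← Set.inter_assoc]
  refine (measure_rowPattern_le hv (mQ.inter (measurableSet_strongLine _ _ _)) ?_).trans ?_
  · intro T hT J hJ
    refine ⟨(hQ.flipJ_mem fun e he hb => ?_).1 hJ.1, strongLine_flipJ.1 hJ.2⟩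
    obtain ⟨x, -, rfl⟩ := mem_lineE.1 (hT he)
    rw [hE_mem_band] at hb
    omega
  · rw [measure_inter_of_localTo v hQ (localTo_strongLine k 0 n) (band_disjoint le_rfl) mQ
      (measurableSet_strongLine _ _ _), measure_strongLine]
    apply le_of_eq
    ring

/-- Without the gap only the factor of the pattern is available. This is used once, for the first
row. -/
lemma measure_inter_upperRow_le' {v : ℝ≥0} (hv : v ≠ 0) {Q : Set Couplings} (mQ : MeasurableSet Q)
    (k : ℕ) {a n : ℤ} (hQ : LocalTo (band a n) Q) :
    (couplingLaw v).real (Q ∩ upperRow k n) ≤ (1 / 4) ^ k * (couplingLaw v).real Q := by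
  refine (measureReal_mono (Set.inter_subset_inter_right Q Set.inter_subset_right)).trans
    (measure_rowPattern_le hv mQ ?_)
  intro T hT J hJ
  refine (hQ.flipJ_mem fun e he hb => ?_).1 hJ
  obtain ⟨x, -, rfl⟩ := mem_lineE.1 (hT he)
  rw [hE_mem_band] at hb
  omega

/-- Avoiding the upper rows of a range of heights costs little. -/
lemma measure_avoid_ge {v : ℝ≥0} (hv : v ≠ 0) {E : Set Couplings} (mE : MeasurableSet E) {m : ℕ}
    (hm : 1 ≤ m) (hE : LocalTo (band (-m) m) E) {k : ℕ} (hk : 1 ≤ k) (j : ℕ) :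
    (1 - 2 * ((1 / 4) ^ k * lineProb v k)) ^ j * ((1 - (1 / 4) ^ k) * (couplingLaw v).real E) ≤
      (couplingLaw v).real (E ∩ ⋂ i : Fin (j + 1), (upperRow k (m + i))ᶜ) := by
  set Q : ℕ → Set Couplings := fun j => E ∩ ⋂ i : Fin j, (upperRow k (m + i))ᶜ with hQ
  have mQ : ∀ j, MeasurableSet (Q j) := fun j =>
    mE.inter (.iInter fun i => (measurableSet_upperRow _ _).compl)
  have lQ : ∀ j : ℕ, LocalTo (band (-m) (m + j)) (Q j) := by
    intro j
    refine (hE.mono (band_subset le_rfl (by omega))).inter (LocalTo.iInter fun i => ?_)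
    have := i.2
    exact (localTo_upperRow k (m + i)).compl.mono (band_subset (by omega) (by omega))
  have hsplit : ∀ j : ℕ, (couplingLaw v).real (Q (j + 1)) =
      (couplingLaw v).real (Q j) - (couplingLaw v).real (Q j ∩ upperRow k (m + j)) := by
    intro j
    rw [← measureReal_sdiff Set.inter_subset_left ((mQ j).inter (measurableSet_upperRow _ _))]
    congr 1
    ext J
    simp only [hQ, Set.mem_iInter, Set.mem_sdiff, Set.mem_inter_iff, Fin.forall_fin_succ',
      Fin.val_castSucc, Fin.val_last, Set.mem_compl_iff]
    tauto
  have h4 : ((1 : ℝ) / 4) ^ k ≤ 1 / 4 := by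
    have := pow_le_pow_of_le_one (by norm_num : (0 : ℝ) ≤ 1 / 4) (by norm_num) hk
    simpa using this
  set p := (1 / 4 : ℝ) ^ k * lineProb v k with hp
  have hp0 : 0 ≤ p := mul_nonneg (by positivity) (lineProb_pos hv k).le
  have hp1 : p ≤ 1 / 4 :=
    (mul_le_of_le_one_right (by positivity) (lineProb_le_one v k)).trans h4
  have h0 : (1 - (1 / 4 : ℝ) ^ k) * (couplingLaw v).real E ≤ (couplingLaw v).real (Q 1) := by
    have h1 := hsplit 0
    have hQ0 : Q 0 = E := by simp [hQ]
    have h2 := measure_inter_upperRow_le' hv mE k hE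
    rw [hQ0, Nat.cast_zero, add_zero] at h1
    simp only [zero_add] at h1
    rw [h1]
    linarith
  -- The upper row is compared with `Q j`, not with `Q (j + 1)`. The first bound pays a factor `2`
  -- for this shift and is propagated by the second one.
  have hstep : ∀ j : ℕ, (couplingLaw v).real (Q j) ≤ 2 * (couplingLaw v).real (Q (j + 1)) ∧
      (1 - 2 * p) * (couplingLaw v).real (Q (j + 1)) ≤ (couplingLaw v).real (Q (j + 2)) := by
    have key : ∀ j : ℕ, (couplingLaw v).real (Q j) ≤ 2 * (couplingLaw v).real (Q (j + 1)) →
      (1 - 2 * p) * (couplingLaw v).real (Q (j + 1)) ≤ (couplingLaw v).real (Q (j + 2)) := by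
      intro j hj
      have h1 := hsplit (j + 1)
      have h2 : (couplingLaw v).real (Q (j + 1) ∩ upperRow k (m + (j + 1 : ℕ))) ≤
          p * (couplingLaw v).real (Q j) := by
        -- Forgetting the most recent avoided row leaves the gap needed for independence.
        refine (measureReal_mono (Set.inter_subset_inter_left _ ?_)).trans
          (measure_inter_upperRow_le hv (mQ j) k (a := -m) (n := m + (j + 1 : ℕ))
            ((lQ j).mono (band_subset le_rfl (by push_cast; omega))))
        intro J hJ
        simp only [hQ, Set.mem_iInter, Set.mem_inter_iff, Fin.forall_fin_succ',
          Fin.val_castSucc] at hJ ⊢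
        exact ⟨hJ.1, hJ.2.1⟩
      rw [show j + 2 = j + 1 + 1 from rfl, h1]
      have := mul_le_mul_of_nonneg_left hj hp0
      linarith
    intro j
    induction j with
    | zero =>
      have h : (couplingLaw v).real (Q 0) ≤ 2 * (couplingLaw v).real (Q (0 + 1)) := by
        have hQ0 : Q 0 = E := by simp [hQ]
        rw [hQ0]
        have := mul_le_mul_of_nonneg_right h4 (measureReal_nonneg (μ := couplingLaw v) (s := E))
        simp only [zero_add]
        have h5 := measureReal_nonneg (μ := couplingLaw v) (s := E)
        linarith
      exact ⟨h, key 0 h⟩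
    | succ j ih =>
      have h : (couplingLaw v).real (Q (j + 1)) ≤ 2 * (couplingLaw v).real (Q (j + 1 + 1)) := by
        have h5 := measureReal_nonneg (μ := couplingLaw v) (s := Q (j + 1))
        have := mul_le_mul_of_nonneg_right hp1 h5
        have h6 := ih.2
        rw [show j + 2 = j + 1 + 1 from rfl] at h6
        linarith
      exact ⟨h, key (j + 1) h⟩
  change _ ≤ (couplingLaw v).real (Q (j + 1))
  induction j with
  | zero => simpa using h0
  | succ j ih =>
    refine le_trans ?_ (hstep j).2
    rw [pow_succ', mul_assoc]
    exact mul_le_mul_of_nonneg_left ih (by linarith)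


/-! ### The inductive step in the width -/

lemma IsIsolation.anti {J : Couplings} {k K : ℕ} {y : ℤ} (h : IsIsolation J K y) (hk : k ≤ K) :
    IsIsolation J k y := by
  have hk' : (k : ℤ) ≤ K := by exact_mod_cast hk
  refine ⟨fun x hx => h.1 x (Finset.Ico_subset_Ico (by omega) hk' hx), fun e he hne => ?_⟩
  refine lt_of_le_of_lt ?_ (h.2 e ?_ hne)
  · refine Finset.sum_le_sum_of_subset_of_nonneg (Finset.union_subset_union_right ?_)
      fun _ _ _ => abs_nonneg _
    exact Finset.product_subset_product_left (Finset.product_subset_product_left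
      (Finset.Icc_subset_Icc (by omega) hk'))
  · exact Finset.product_subset_product_left (Finset.product_subset_product_left
      (Finset.Ico_subset_Ico (by omega) hk')) he

/-- An occurrence of `R` at width `k + 1` is one at width `k`, so the event inherited from the
previous step applies to it. -/
lemma R_anti (n : ℕ) {k K : ℕ} (hk : k ≤ K) : R n K ⊆ R n k := by
  have hk' : (k : ℤ) ≤ K := by exact_mod_cast hk
  rintro J ⟨⟨h1, h2, h3⟩, h4, h5⟩
  refine ⟨⟨fun k' hk1 hk2 => h1 k' hk1 (hk2.trans hk), fun p hp => h2 p ?_, fun p hp => h3 p ?_⟩,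
    h4.anti hk, h5.anti hk⟩
  · exact Finset.product_subset_product_left (Finset.Ico_subset_Ico (by omega) hk') hp
  · exact Finset.product_subset_product_left (Finset.Ico_subset_Ico (by omega) hk') hp

/-- The conclusion of the finite conjecture in terms of unconditional probabilities. -/
lemma FiniteConjecture.measure_inter_BA {v : ℝ≥0} {c : ℕ} {ε : ℝ} (h : ∀ n k : ℕ, c + 1 < k → k ≤ n →
    couplingLaw v (condEvent c n k) ≠ 0 →
      1 - ((k : ℝ) - c)⁻¹ * Real.log ((k : ℝ) - c) ^ (-1 - ε) ≤
        ((couplingLaw v)[|condEvent c n k]).real (BA n k)) {n k : ℕ} (hck : c + 1 < k)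
    (hkn : k ≤ n) :
    (1 - ((k : ℝ) - c)⁻¹ * Real.log ((k : ℝ) - c) ^ (-1 - ε)) *
      (couplingLaw v).real (condEvent c n k) ≤ (couplingLaw v).real (condEvent c n k ∩ BA n k) := by
  by_cases h0 : couplingLaw v (condEvent c n k) = 0
  · simp [Measure.real, h0]
  · have h1 := h n k hck hkn h0
    rw [Measure.real, cond_apply (measurableSet_condEvent c n k), ENNReal.toReal_mul,
      ENNReal.toReal_inv] at h1
    have hpos : 0 < (couplingLaw v).real (condEvent c n k) :=
      ENNReal.toReal_pos h0 (measure_ne_top _ _)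
    change _ ≤ (Measure.real _ _)⁻¹ * Measure.real _ _ at h1
    rw [le_inv_mul_iff₀ hpos] at h1
    rwa [mul_comm]

/-- Agreement on the band up to height `m` makes the two strong lines of `J'` strong for `J` too,
and `BA.transfer` carries the event over even though the heights `n'` and `n` differ. -/
lemma mem_BA_of_glue {m : ℤ} {J : Couplings} {K : ℕ} (hJ : Generic J) {n n' : ℕ} (hR : J ∈ R n K)
    (hn : m ≤ n) {J' : Couplings} (hJ' : Generic J') (hR' : J' ∈ R n' K) (hn' : m ≤ n')
    (hJJ : ∀ e ∈ band (-m) m, J' e = J e) {y₁ y₂ : ℤ} (l₁ : StrongLine J' K 0 y₁)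
    (l₂ : StrongLine J' K 0 y₂) {k : ℕ} (hk : 1 ≤ k) (hkK : k ≤ K) (hy1 : y₁ < -(100 * k + 200))
    (hy2 : 100 * k + 200 < y₂) (hm1 : -(m - 1) < y₁) (hm2 : y₂ < m - 1) (h : J' ∈ BA n' k) :
    J ∈ BA n k := by
  have hline : ∀ y, -(m - 1) < y → y < m - 1 → StrongLine J' K 0 y → StrongLine J K 0 y :=
    fun y h1 h2 hl => localTo_strongLine K 0 y J' J
      (fun e he => hJJ e (band_subset (by omega) (by omega) he)) hl
  refine BA.transfer hJ' hJ hR' hR (by omega) (by omega) hk hkK ⟨fun x y h1 h2 => hJJ _ ?_,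
    fun x y h1 h2 => hJJ _ ?_⟩ l₁ l₂ (hline _ hm1 (by omega) l₁) (hline _ (by omega) hm2 l₂)
    hy1 hy2 (by omega) (by omega) (by omega) (by omega) h
  · rw [hE_mem_band]; omega
  · rw [vE_mem_band]; omega

/-- The new probability reads as follows: `1 - δ` is the loss from the conjecture, the middle
factors are the loss from avoiding `R` on `2 M + 1` heights, and the subtracted term bounds the
absence of a strong line above or below. The condition `50 ≤ M` supplies the additional `100` in the
height required for width `k + 1`. -/
lemma Good.step {v : ℝ≥0} (hv : v ≠ 0) {c k m M : ℕ} {d δ : ℝ} (hG : Good v c k m d)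
    (hck : c + 1 < k) (hδ : δ ≤ 1)
    (hFC : ∀ n, k + 1 ≤ n → (1 - δ) * (couplingLaw v).real (condEvent c n (k + 1)) ≤
      (couplingLaw v).real (condEvent c n (k + 1) ∩ BA n (k + 1))) (hM : 50 ≤ M) :
    Good v c (k + 1) (m + 2 * M + 1)
      ((1 - δ) * ((1 - 2 * ((1 / 4) ^ (k + 1) * lineProb v (k + 1))) ^ (2 * M) *
        ((1 - (1 / 4) ^ (k + 1)) * d)) - 2 * (1 - lineProb v (k + 1)) ^ M) := by
  obtain ⟨hmk, E, mE, lE, hd, hnoR, hBA⟩ := hG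
  set μ := couplingLaw v with hμ
  set K := k + 1 with hK
  set m' := m + 2 * M + 1 with hm'
  set Y := E ∩ ⋂ i : Fin (2 * M + 1), (upperRow K (m + i))ᶜ with hY
  have hYge := measure_avoid_ge hv mE (by omega) lE (k := K) (by omega) (2 * M)
  have hp1 : (1 / 4 : ℝ) ^ K ≤ 1 / 4 := by
    have := pow_le_pow_of_le_one (by norm_num : (0 : ℝ) ≤ 1 / 4) (by norm_num)
      (by omega : 1 ≤ K)
    simpa using this
  have hYd : (1 - 2 * ((1 / 4) ^ K * lineProb v K)) ^ (2 * M) * ((1 - (1 / 4) ^ K) * d) ≤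
      μ.real Y := by
    refine le_trans (mul_le_mul_of_nonneg_left (mul_le_mul_of_nonneg_left hd (by linarith)) ?_) hYge
    apply pow_nonneg
    have := mul_le_of_le_one_right (by positivity : (0 : ℝ) ≤ (1 / 4) ^ K) (lineProb_le_one v K)
    linarith
  set C : ℕ → Set Couplings := fun i => condEvent c (m' + i) K with hC
  have mC : ∀ i, MeasurableSet (C i) := fun i => measurableSet_condEvent _ _ _
  -- Take the first `n` at which `R n K` occurs. By `E` and the avoided rows it is at least `m'`,
  -- and `E` forces `BA` at this `n` for all smaller widths, so this is a conditioning event of the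
  -- conjecture.
  have hsub : ∀ᵐ J ∂μ, J ∈ Y → J ∈ ⋃ i, C i := by
    filter_upwards [ae_generic hv, ae_exists_R hv K K] with J hgen hex hJ
    classical
    have hspec := Nat.find_spec hex
    have hmin : ∀ n', K ≤ n' → n' < Nat.find hex → J ∉ R n' K := fun n' h1 h2 h3 =>
      Nat.find_min hex h2 ⟨h1, h3⟩
    set n := Nat.find hex with hn
    have hRk : J ∈ R n k := R_anti n (Nat.le_succ k) hspec.2
    have hmn : m ≤ n := by
      by_contra hc
      exact hnoR J hJ.1 n (by omega) (by omega) hRk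
    have hmn' : m' ≤ n := by
      by_contra hc
      have := Set.mem_iInter.1 hJ.2 ⟨n - m, by omega⟩
      apply this
      change J ∈ upperRow K ((m : ℤ) + ((n - m : ℕ) : ℤ))
      rw [show (m : ℤ) + ((n - m : ℕ) : ℤ) = n by omega]
      exact R_subset_upperRow n K hspec.2
    refine Set.mem_iUnion.2 ⟨n - m', ?_⟩
    simp only [hC, Nat.add_sub_cancel' hmn']
    exact ⟨⟨hspec.2, hmin⟩, fun k' h1 h2 => hBA J hJ.1 hgen n hmn hRk k' h1 (by omega)⟩
  have hdisj : Pairwise (Function.onFun Disjoint C) := by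
    have key : ∀ i j : ℕ, i < j → Disjoint (C i) (C j) := fun i j hij =>
      Set.disjoint_left.2 fun J hi hj => hj.1.2 (m' + i) (by omega) (by omega) hi.1.1
    intro i j hij
    rcases lt_or_gt_of_ne hij with h | h
    · exact key i j h
    · exact (key j i h).symm
  set U := ⋃ i, (C i ∩ BA (m' + i) K) with hU
  have mU : MeasurableSet U := .iUnion fun i => (mC i).inter (measurableSet_BA _ _)
  -- The conditioning events for different `n` are disjoint because `R'` picks the first occurrence;
  -- the bounds can therefore be summed.
  have hUge : (1 - δ) * μ.real Y ≤ μ.real U := by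
    have h1 : ENNReal.ofReal (1 - δ) * μ (⋃ i, C i) ≤ μ U := by
      rw [hU, measure_iUnion hdisj mC, measure_iUnion (fun i j hij =>
        (hdisj hij).mono Set.inter_subset_left Set.inter_subset_left)
        (fun i => (mC i).inter (measurableSet_BA _ _)), ← ENNReal.tsum_mul_left]
      refine ENNReal.tsum_le_tsum fun i => ?_
      have := hFC (m' + i) (by omega)
      rw [Measure.real, Measure.real, ← ENNReal.ofReal_le_ofReal_iff ENNReal.toReal_nonneg,
        ENNReal.ofReal_mul (by linarith), ENNReal.ofReal_toReal (measure_ne_top _ _),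
        ENNReal.ofReal_toReal (measure_ne_top _ _)] at this
      exact this
    have h2 : μ.real Y ≤ μ.real (⋃ i, C i) :=
      ENNReal.toReal_mono (measure_ne_top _ _) (measure_mono_ae hsub)
    have h3 := ENNReal.toReal_mono (measure_ne_top _ _) h1
    rw [ENNReal.toReal_mul, ENNReal.toReal_ofReal (by linarith)] at h3
    exact (mul_le_mul_of_nonneg_left h2 (by linarith)).trans h3
  -- Absence of strong lines among `M` candidates in the new upper range, and likewise `N₂` below.
  -- All candidates lie strictly within height `m' - 1`.
  set N₁ := ⋂ i : Fin M, {J | StrongLine J K 0 (((m : ℤ) + 1) + 2 * i)}ᶜ with hN₁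
  set N₂ := ⋂ i : Fin M, {J | StrongLine J K 0 (-((m : ℤ) + 2 * M - 1) + 2 * i)}ᶜ with hN₂
  have mN₁ : MeasurableSet N₁ := .iInter fun i => (measurableSet_strongLine _ _ _).compl
  have mN₂ : MeasurableSet N₂ := .iInter fun i => (measurableSet_strongLine _ _ _).compl
  set D := ((U ∩ N₁ᶜ) ∩ N₂ᶜ) ∩ {J | Generic J} with hD
  have mD : MeasurableSet D := ((mU.inter mN₁.compl).inter mN₂.compl).inter measurableSet_generic
  have hDge : μ.real U - 2 * (1 - lineProb v K) ^ M ≤ μ.real D := by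
    have h1 : μ.real U ≤ μ.real (D ∪ (N₁ ∪ N₂)) := by
      refine ENNReal.toReal_mono (measure_ne_top _ _) (measure_mono_ae ?_)
      filter_upwards [ae_generic hv] with J hgen hJ
      by_cases h1 : J ∈ N₁
      · exact Or.inr (Or.inl h1)
      by_cases h2 : J ∈ N₂
      · exact Or.inr (Or.inr h2)
      exact Or.inl ⟨⟨⟨hJ, h1⟩, h2⟩, hgen⟩
    have h2 := measureReal_union_le (μ := μ) D (N₁ ∪ N₂)
    have h3 := measureReal_union_le (μ := μ) N₁ N₂
    have h4 : μ.real N₁ = _ := measure_no_strongLine v K _ M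
    have h5 : μ.real N₂ = _ := measure_no_strongLine v K _ M
    linarith
  set S := band (-(m' : ℤ)) m' with hS
  -- `D` depends on distant couplings. `E'` keeps the couplings in the band that have some extension
  -- in `D`: it is local, and by Fubini at least as likely as `D`. One such extension as witness is
  -- enough for `mem_BA_of_glue`.
  set E' : Set Couplings := {J | 0 < μ ((fun J₂ => glue S J J₂) ⁻¹' D)} with hE'
  have mE' : MeasurableSet E' := measurableSet_lt measurable_const
    (measurable_measure_prodMk_left (ν := μ) (measurable_glue S mD))
  have hE'ge : μ.real D ≤ μ.real E' := by
    refine ENNReal.toReal_mono (measure_ne_top _ _) ?_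
    calc μ D = (μ.prod μ) ((fun p : Couplings × Couplings => glue S p.1 p.2) ⁻¹' D) := by
          conv_lhs => rw [hμ, ← map_glue v S]
          rw [Measure.map_apply (measurable_glue S) mD]
      _ = ∫⁻ J₁, μ ((fun J₂ => glue S J₁ J₂) ⁻¹' D) ∂μ :=
          Measure.prod_apply (measurable_glue S mD)
      _ ≤ ∫⁻ J₁, E'.indicator 1 J₁ ∂μ := by
          refine lintegral_mono fun J₁ => ?_
          by_cases h : J₁ ∈ E'
          · rw [Set.indicator_of_mem h]; exact prob_le_one
          · rw [Set.indicator_of_notMem h]; exact not_lt.1 h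
      _ = μ E' := lintegral_indicator_one mE'
  have hex : ∀ J ∈ E', ∃ J', J' ∈ D ∧ ∀ e ∈ S, J' e = J e := by
    intro J hJ
    obtain ⟨J₂, hJ₂⟩ := nonempty_of_measure_ne_zero (ne_of_gt hJ)
    exact ⟨_, hJ₂, fun e he => glue_of_mem he⟩
  have hm'1 : (m' : ℤ) = m + 2 * M + 1 := by omega
  refine ⟨by omega, E', mE', ?_, ?_, ?_, ?_⟩
  · intro J J' hJJ hJ
    have : (fun J₂ => glue S J J₂) = fun J₂ => glue S J' J₂ := by
      funext J₂ e
      by_cases he : e ∈ S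
      · rw [glue_of_mem he, glue_of_mem he, hJJ e he]
      · rw [glue_of_notMem he, glue_of_notMem he]
    simp only [hE', Set.mem_ofPred_eq] at hJ ⊢
    rwa [← this]
  · have := mul_le_mul_of_nonneg_left hYd (by linarith : 0 ≤ 1 - δ)
    linarith
  · intro J hJ n hn1 hn2 hR
    obtain ⟨J', hJ', hJJ⟩ := hex J hJ
    obtain ⟨i, hi⟩ := Set.mem_iUnion.1 hJ'.1.1.1
    refine hi.1.1.2 n hn1 (by omega) (localTo_R (by omega) K J J' (fun e he => ?_) hR)
    exact (hJJ e (band_subset (by omega) (by omega) he)).symm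
  · intro J hJ hgen n hn hR k' hk1 hk2
    obtain ⟨J', ⟨⟨⟨hJU, hup⟩, hdown⟩, hgen'⟩, hJJ⟩ := hex J hJ
    obtain ⟨i, hi⟩ := Set.mem_iUnion.1 hJU
    simp only [hN₁, Set.mem_compl_iff, Set.mem_iInter, not_forall, not_not] at hup
    simp only [hN₂, Set.mem_compl_iff, Set.mem_iInter, not_forall, not_not] at hdown
    obtain ⟨j₂, hj₂⟩ := hup
    obtain ⟨j₁, hj₁⟩ := hdown
    have hb1 := j₁.2
    have hb2 := j₂.2
    refine mem_BA_of_glue (m := (m' : ℤ)) hgen hR (by omega) hgen' hi.1.1.1 (by omega) hJJ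
      hj₁ hj₂ (by omega) hk2 (by omega) (by omega) (by omega) (by omega) ?_
    rcases lt_or_eq_of_le hk2 with h | h
    · exact hi.1.2 k' hk1 h
    · rw [h]; exact hi.2

/-- Almost surely `R n k` occurs for some `n ≥ m`, and then the event of `Good` forces `BA n k`. -/
lemma Good.measure_iUnion_BA_ge {v : ℝ≥0} (hv : v ≠ 0) {c k m : ℕ} {d : ℝ} (hG : Good v c k m d)
    (hck : c + 1 < k) : d ≤ (couplingLaw v).real (⋃ n, ⋃ _ : k ≤ n, R n k ∩ BA n k) := by
  obtain ⟨hmk, E, mE, lE, hd, hnoR, hBA⟩ := hG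
  refine hd.trans (ENNReal.toReal_mono (measure_ne_top _ _) (measure_mono_ae ?_))
  filter_upwards [ae_generic hv, ae_exists_R hv k m] with J hgen ⟨n, hn, hR⟩ hJ
  exact Set.mem_biUnion (show k ≤ n by omega) ⟨hR, hBA J hJ hgen n hn hR k hck le_rfl⟩


/-! ### Iteration -/

lemma exp_neg_two_mul_le {x : ℝ} (h0 : 0 ≤ x) (h1 : x ≤ 1 / 2) : Real.exp (-(2 * x)) ≤ 1 - x := by
  have hpos : 0 < 1 - x := by linarith
  rw [← Real.exp_log hpos, Real.exp_le_exp]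
  have h := Real.one_sub_inv_le_log_of_pos hpos
  refine le_trans ?_ h
  rw [le_sub_iff_add_le, ← le_sub_iff_add_le', inv_le_iff_one_le_mul₀ hpos]
  nlinarith

/-- Here `l` is the negative logarithm of the current probability, `κ` the width, `q = 4 ^ (-κ)` and
`u` the probability of a strong line. With `u M` of order `4 (l + κ)`, the search fails with a
probability below `q` times the main term, while avoidance costs `40 q (l + κ)` in the exponent.
Altogether `l` grows by a factor close to `1`. -/
lemma iterate_bound {l κ u δ q : ℝ} {M : ℕ} (hl : 20 ≤ l) (hκ : 4 ≤ κ) (hu0 : 0 < u) (hu1 : u ≤ 1)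
    (hδ0 : 0 ≤ δ) (hδ1 : δ ≤ 1 / 3) (hq0 : Real.exp (-(2 * κ)) ≤ q) (hq1 : q ≤ 1 / 256)
    (hM1 : 4 * (l + κ) ≤ u * M) (hM2 : u * M ≤ 5 * (l + κ)) :
    Real.exp (-(l * (1 + (2 * δ + 44 * (q * (1 + κ)))))) ≤
      (1 - δ) * ((1 - 2 * (q * u)) ^ (2 * M) * ((1 - q) * Real.exp (-l))) - 2 * (1 - u) ^ M := by
  have hq : 0 < q := (Real.exp_pos _).trans_le hq0
  have hA1 : Real.exp (-(40 * (q * (l + κ)))) ≤ (1 - 2 * (q * u)) ^ (2 * M) := by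
    have hqu : q * u ≤ 1 / 256 := by nlinarith
    have h1 := exp_neg_two_mul_le (x := 2 * (q * u)) (by positivity) (by linarith)
    have h2 := pow_le_pow_left₀ (Real.exp_pos _).le h1 (2 * M)
    refine le_trans ?_ h2
    rw [← Real.exp_nat_mul, Real.exp_le_exp]
    push_cast
    nlinarith
  have hA2 : Real.exp (-(2 * q)) ≤ 1 - q := exp_neg_two_mul_le hq.le (by linarith)
  have hA3 : Real.exp (-(2 * δ)) ≤ 1 - δ := exp_neg_two_mul_le hδ0 (by linarith)
  set a := l + 2 * δ + 2 * q + 40 * (q * (l + κ)) with ha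
  have hA : Real.exp (-a) ≤
      (1 - δ) * ((1 - 2 * (q * u)) ^ (2 * M) * ((1 - q) * Real.exp (-l))) := by
    have : Real.exp (-a) = Real.exp (-(2 * δ)) * (Real.exp (-(40 * (q * (l + κ)))) *
        (Real.exp (-(2 * q)) * Real.exp (-l))) := by
      rw [← Real.exp_add, ← Real.exp_add, ← Real.exp_add, ha]; congr 1; ring
    rw [this]
    have h1 := Real.exp_pos (-l)
    have h2 : 0 ≤ 1 - q := by linarith
    have h3 : 0 ≤ 1 - δ := by linarith
    have h4 := (Real.exp_pos _).le.trans hA1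
    gcongr
  have hB : 2 * (1 - u) ^ M ≤ q * Real.exp (-a) := by
    have h1 : (1 - u) ^ M ≤ Real.exp (-(4 * (l + κ))) := by
      calc (1 - u) ^ M ≤ Real.exp (-u) ^ M :=
            pow_le_pow_left₀ (by linarith) (by linarith [Real.add_one_le_exp (-u)]) M
        _ = Real.exp (-(u * M)) := by rw [← Real.exp_nat_mul]; congr 1; ring
        _ ≤ _ := by rw [Real.exp_le_exp]; linarith
    have h2 : (2 : ℝ) ≤ Real.exp 1 := by linarith [Real.add_one_le_exp (1 : ℝ)]
    have hql : q * (l + κ) ≤ 1 / 256 * (l + κ) := by gcongr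
    calc 2 * (1 - u) ^ M ≤ Real.exp 1 * Real.exp (-(4 * (l + κ))) := by gcongr
      _ = Real.exp (1 - 4 * (l + κ)) := by rw [← Real.exp_add]; congr 1
      _ ≤ Real.exp (-(2 * κ) + -a) := by
          rw [Real.exp_le_exp, ha]
          linarith
      _ = Real.exp (-(2 * κ)) * Real.exp (-a) := Real.exp_add _ _
      _ ≤ q * Real.exp (-a) := by gcongr
  have hC : Real.exp (-(l * (1 + (2 * δ + 44 * (q * (1 + κ)))))) ≤ Real.exp (-a) * (1 - q) := by
    calc _ ≤ Real.exp (-a + -(2 * q)) := by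
          rw [Real.exp_le_exp, ha]
          have h1 : 0 ≤ q * κ * (l - 1) := by
            apply mul_nonneg (by positivity); linarith
          have h2 : 0 ≤ q * (l - 1) := by apply mul_nonneg hq.le; linarith
          have h3 : 0 ≤ δ * (l - 1) := by apply mul_nonneg hδ0; linarith
          nlinarith
      _ = Real.exp (-a) * Real.exp (-(2 * q)) := Real.exp_add _ _
      _ ≤ _ := by gcongr
  linarith

/-- Cauchy condensation turns the series into a multiple of that of `k ^ (-1 - ε)`. -/
lemma summable_bertrand {ε : ℝ} (hε : 0 < ε) :
    Summable fun n : ℕ => (n : ℝ)⁻¹ * Real.log n ^ (-1 - ε) := by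
  rw [← summable_condensed_iff_of_eventually_nonneg]
  · have h : ∀ k : ℕ, (2 : ℝ) ^ k * (((2 ^ k : ℕ) : ℝ)⁻¹ * Real.log ((2 ^ k : ℕ) : ℝ) ^ (-1 - ε)) =
        Real.log 2 ^ (-1 - ε) * (k : ℝ) ^ (-1 - ε) := by
      intro k
      rw [Nat.cast_pow, Nat.cast_two, ← mul_assoc, mul_inv_cancel₀ (by positivity), one_mul,
        Real.log_pow, mul_comm, Real.mul_rpow (Real.log_nonneg (by norm_num)) (Nat.cast_nonneg k)]
    simp_rw [h]
    exact (Real.summable_nat_rpow.2 (by linarith)).mul_left _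
  · filter_upwards [eventually_ge_atTop 1] with n hn
    have : 0 ≤ Real.log n := Real.log_natCast_nonneg n
    positivity
  · filter_upwards [eventually_ge_atTop 2] with n hn
    have h2 : (2 : ℝ) ≤ n := by exact_mod_cast hn
    have : 0 < Real.log n := Real.log_pos (by linarith)
    push_cast
    refine mul_le_mul (inv_anti₀ (by linarith) (by linarith)) ?_
      (Real.rpow_nonneg (Real.log_nonneg (by linarith)) _) (by positivity)
    · exact Real.rpow_le_rpow_of_nonpos this (Real.log_le_log (by linarith) (by linarith))
        (by linarith)

lemma exists_nat_mul_between {a u : ℝ} (ha : 0 ≤ a) (hu : 0 < u) :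
    ∃ M : ℕ, a ≤ u * M ∧ u * M ≤ a + u := by
  refine ⟨⌈a / u⌉₊, ?_, ?_⟩
  · have := Nat.le_ceil (a / u)
    rwa [div_le_iff₀ hu, mul_comm] at this
  · have := (Nat.ceil_lt_add_one (a := a / u) (by positivity)).le
    have h2 := mul_le_mul_of_nonneg_left this hu.le
    rwa [mul_add, mul_div_cancel₀ _ hu.ne', mul_one] at h2

lemma exp_neg_two_mul_le_pow (n : ℕ) : Real.exp (-(2 * (n : ℝ))) ≤ (1 / 4) ^ n := by
  have h1 : Real.exp (-(2 * (n : ℝ))) = Real.exp (-2) ^ n := by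
    rw [← Real.exp_nat_mul]; congr 1; ring
  rw [h1]
  refine pow_le_pow_left₀ (Real.exp_pos _).le ?_ n
  rw [Real.exp_neg, one_div]
  refine inv_anti₀ (by norm_num) ?_
  have h2 : (2 : ℝ) ≤ Real.exp 1 := by linarith [Real.add_one_le_exp (1 : ℝ)]
  have h3 : Real.exp 2 = Real.exp 1 * Real.exp 1 := by rw [← Real.exp_add]; norm_num
  rw [h3]
  nlinarith

/-- Iterating multiplies the negative logarithm of the probability by at most `exp (γ i)` each time.
As `γ` is summable, the probability stays bounded away from zero. -/
lemma exists_uniform_good {v : ℝ≥0} (hv : v ≠ 0) (hFC : FiniteConjecture v) :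
    ∃ c : ℕ, ∃ d : ℝ, 0 < d ∧ ∀ k, c + 2 ≤ k → ∃ m, Good v c k m d := by
  obtain ⟨c, hc, ε, hε, h⟩ := hFC
  obtain ⟨m₀, d₀, hd₀, hG₀⟩ := exists_good hv c
  set δ : ℕ → ℝ := fun j => (j : ℝ)⁻¹ * Real.log j ^ (-1 - ε) with hδ
  -- The step with index `i` leads to width `c + 3 + i`, so the conjecture contributes its error at
  -- `i + 3`.
  set γ : ℕ → ℝ := fun i => 2 * δ (i + 3) +
    44 * ((1 / 4) ^ (c + 3 + i) * (1 + ((c + 3 + i : ℕ) : ℝ))) with hγ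
  have hδ0 : ∀ j, 0 ≤ δ j := fun j => by
    have : 0 ≤ Real.log j := Real.log_natCast_nonneg j
    simp only [hδ]; positivity
  have hδ1 : ∀ j, 3 ≤ j → δ j ≤ 1 / 3 := by
    intro j hj
    have h3 : (3 : ℝ) ≤ j := by exact_mod_cast hj
    have hlog : 1 ≤ Real.log j := by
      rw [Real.le_log_iff_exp_le (by linarith)]
      linarith [Real.exp_one_lt_d9]
    have h1 : Real.log j ^ (-1 - ε) ≤ 1 := Real.rpow_le_one_of_one_le_of_nonpos hlog (by linarith)
    have h2 : (j : ℝ)⁻¹ ≤ 1 / 3 := by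
      rw [one_div]; exact inv_anti₀ (by norm_num) h3
    calc δ j ≤ (j : ℝ)⁻¹ * 1 := mul_le_mul_of_nonneg_left h1 (by positivity)
      _ ≤ 1 / 3 := by linarith
  have hγ0 : ∀ i, 0 ≤ γ i := fun i => by
    have := hδ0 (i + 3)
    simp only [hγ]; positivity
  have hsum : Summable γ := by
    refine Summable.add ?_ ?_
    · exact ((summable_nat_add_iff 3).2 (summable_bertrand hε)).mul_left 2
    · have h1 : Summable fun n : ℕ => (1 / 4 : ℝ) ^ n * (1 + (n : ℝ)) := by
        have ha := summable_geometric_of_lt_one (r := (1 / 4 : ℝ)) (by norm_num) (by norm_num)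
        have hb := summable_pow_mul_geometric_of_norm_lt_one 1 (r := (1 / 4 : ℝ))
          (by rw [Real.norm_eq_abs, abs_of_pos] <;> norm_num)
        refine (ha.add hb).congr fun n => ?_
        ring
      refine Summable.mul_left 44 ?_
      have := (summable_nat_add_iff (c + 3)).2 h1
      refine this.congr fun n => ?_
      rw [add_comm n (c + 3)]
  have hq256 : ∀ κ : ℕ, 4 ≤ κ → (1 / 4 : ℝ) ^ κ ≤ 1 / 256 := fun κ hκ => by
    have := pow_le_pow_of_le_one (a := (1 / 4 : ℝ)) (by norm_num) (by norm_num) hκ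
    refine this.trans (le_of_eq ?_)
    norm_num
  -- The bound `20` is what `iterate_bound` requires of `l`; decreasing the initial probability is
  -- harmless.
  set l₀ := max 20 (-Real.log d₀) with hl₀
  have key : ∀ j, ∃ m, Good v c (c + 2 + j) m
      (Real.exp (-(l₀ * Real.exp (∑ i ∈ Finset.range j, γ i)))) := by
    intro j
    induction j with
    | zero =>
      obtain ⟨h1, E, h2, h3, h4, h5⟩ := hG₀
      refine ⟨m₀, h1, E, h2, h3, le_trans ?_ h4, h5⟩
      rw [Finset.sum_range_zero, Real.exp_zero, mul_one]
      calc Real.exp (-l₀) ≤ Real.exp (Real.log d₀) := by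
            rw [Real.exp_le_exp]
            linarith [le_max_right 20 (-Real.log d₀)]
        _ = d₀ := Real.exp_log hd₀
    | succ j ih =>
      obtain ⟨m, hm⟩ := ih
      obtain ⟨l, hl⟩ : ∃ l, l = l₀ * Real.exp (∑ i ∈ Finset.range j, γ i) := ⟨_, rfl⟩
      rw [← hl] at hm
      have hl20 : 20 ≤ l := by
        have h1 : 1 ≤ Real.exp (∑ i ∈ Finset.range j, γ i) :=
          Real.one_le_exp (Finset.sum_nonneg fun i _ => hγ0 i)
        have h2 : 20 ≤ l₀ := le_max_left _ _
        rw [hl]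
        nlinarith
      obtain ⟨κ, hκ⟩ : ∃ κ, κ = c + 2 + j + 1 := ⟨_, rfl⟩
      have hκ' : κ = c + 3 + j := by omega
      obtain ⟨u, hu⟩ : ∃ u, u = lineProb v κ := ⟨_, rfl⟩
      have hu0 : 0 < u := hu ▸ lineProb_pos hv κ
      have hu1 : u ≤ 1 := hu ▸ lineProb_le_one v κ
      have hκ4 : (4 : ℝ) ≤ κ := by exact_mod_cast (by omega : 4 ≤ κ)
      obtain ⟨M, hM1, hM2'⟩ := exists_nat_mul_between (a := 4 * (l + κ)) (by linarith) hu0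
      have hM2 : u * M ≤ 5 * (l + κ) := by linarith
      have hM50 : 50 ≤ M := by
        have : (50 : ℝ) ≤ M := by
          have : u * M ≤ 1 * M := by gcongr
          linarith
        exact_mod_cast this
      have hstep := hm.step hv (M := M) (δ := δ (j + 3)) (by omega)
        ((hδ1 _ (by omega)).trans (by norm_num)) (fun n hn => ?_) hM50
      · rw [← hκ, ← hu] at hstep
        obtain ⟨h1, E, h2, h3, h4, h5⟩ := hstep
        rw [show c + 2 + (j + 1) = κ by omega]
        refine ⟨_, h1, E, h2, h3, le_trans ?_ h4, h5⟩
        refine le_trans ?_ (iterate_bound hl20 hκ4 hu0 hu1 (hδ0 _) (hδ1 _ (by omega)) ?_ ?_ hM1 hM2)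
        · have hl' : l₀ * Real.exp (∑ i ∈ Finset.range (j + 1), γ i) = l * Real.exp (γ j) := by
            rw [Finset.sum_range_succ, Real.exp_add, hl, mul_assoc]
          rw [Real.exp_le_exp, neg_le_neg_iff, hl']
          refine mul_le_mul_of_nonneg_left ?_ (by linarith)
          have h6 := Real.add_one_le_exp (γ j)
          have h7 : γ j = 2 * δ (j + 3) + 44 * ((1 / 4) ^ κ * (1 + (κ : ℝ))) := by
            rw [hκ']
          rw [h7] at h6 ⊢
          linarith
        · exact exp_neg_two_mul_le_pow κ
        · exact hq256 κ (by omega)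
      · rw [← hκ] at hn ⊢
        have := FiniteConjecture.measure_inter_BA h (n := n) (k := κ) (by omega) hn
        have hcast : ((κ : ℝ) - c) = ((j + 3 : ℕ) : ℝ) := by
          rw [hκ']; push_cast; ring
        rw [hcast] at this
        exact this
  refine ⟨c, Real.exp (-(l₀ * Real.exp (∑' i, γ i))), Real.exp_pos _, fun k hk => ?_⟩
  obtain ⟨m, h1, E, h2, h3, h4, h5⟩ := key (k - (c + 2))
  rw [Nat.add_sub_cancel' hk] at h1 h5
  refine ⟨m, h1, E, h2, h3, le_trans ?_ h4, h5⟩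
  have hl0 : 0 ≤ l₀ := le_trans (by norm_num) (le_max_left 20 (-Real.log d₀))
  have := hsum.sum_le_tsum (Finset.range (k - (c + 2))) fun i _ => hγ0 i
  gcongr

/-- The finite conjecture yields a lower bound for the probability of `BA(n, k)` for some `n`. -/
lemma exists_measure_BA_ge {v : ℝ≥0} (hv : v ≠ 0) (hFC : FiniteConjecture v) :
    ∃ d : ℝ, 0 < d ∧ ∃ k₀ : ℕ, 2 ≤ k₀ ∧ ∀ k, k₀ ≤ k →
      d ≤ (couplingLaw v).real (⋃ n, ⋃ _ : k ≤ n, R n k ∩ BA n k) := by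
  obtain ⟨c, d, hd, h⟩ := exists_uniform_good hv hFC
  refine ⟨d, hd, c + 2, by omega, fun k hk => ?_⟩
  obtain ⟨m, hm⟩ := h k hk
  exact hm.measure_iUnion_BA_ge hv (by omega)


/-! ### The pointwise ergodic theorem for functions with values in `[0, 1]` -/

section Ergodic

variable {Ω : Type*} {T S : Ω → Ω} {f : Ω → ℝ}

lemma birkhoffSum_nonneg (hf : ∀ x, 0 ≤ f x ∧ f x ≤ 1) (n : ℕ) (x : Ω) : 0 ≤ birkhoffSum T f n x :=
  Finset.sum_nonneg fun _ _ => (hf _).1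

lemma birkhoffSum_le (hf : ∀ x, 0 ≤ f x ∧ f x ≤ 1) (n : ℕ) (x : Ω) : birkhoffSum T f n x ≤ n := by
  refine (Finset.sum_le_sum fun i _ => (hf (T^[i] x)).2).trans ?_
  simp

lemma birkhoffAverage_eq (n : ℕ) (x : Ω) :
    birkhoffAverage ℝ T f n x = (n : ℝ)⁻¹ * birkhoffSum T f n x := rfl

lemma birkhoffAverage_mem (hf : ∀ x, 0 ≤ f x ∧ f x ≤ 1) (n : ℕ) (x : Ω) :
    0 ≤ birkhoffAverage ℝ T f n x ∧ birkhoffAverage ℝ T f n x ≤ 1 := by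
  have h0 := birkhoffSum_nonneg (T := T) hf n x
  have h1 := birkhoffSum_le (T := T) hf n x
  rw [birkhoffAverage_eq]
  exact ⟨by positivity, inv_mul_le_one_of_le₀ h1 (Nat.cast_nonneg n)⟩

lemma isBoundedUnder_le_of_mem {u : ℕ → ℝ} (hu : ∀ n, 0 ≤ u n ∧ u n ≤ 1) :
    IsBoundedUnder (· ≤ ·) atTop u := isBoundedUnder_of ⟨1, fun n => (hu n).2⟩

lemma isCoboundedUnder_le_of_mem {u : ℕ → ℝ} (hu : ∀ n, 0 ≤ u n ∧ u n ≤ 1) :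
    IsCoboundedUnder (· ≤ ·) atTop u :=
  (isBoundedUnder_of ⟨0, fun n => (hu n).1⟩ : IsBoundedUnder (· ≥ ·) atTop u).isCoboundedUnder_le

lemma limsup_mem_of_mem {u : ℕ → ℝ} (hu : ∀ n, 0 ≤ u n ∧ u n ≤ 1) :
    0 ≤ limsup u atTop ∧ limsup u atTop ≤ 1 :=
  ⟨le_limsup_of_frequently_le (Frequently.of_forall fun n => (hu n).1)
    (isBoundedUnder_le_of_mem hu),
  limsup_le_of_le (isCoboundedUnder_le_of_mem hu) (Eventually.of_forall fun n => (hu n).2)⟩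

lemma limsup_le_of_sub_tendsto {u w : ℕ → ℝ} (hu : ∀ n, 0 ≤ u n ∧ u n ≤ 1)
    (hw : ∀ n, 0 ≤ w n ∧ w n ≤ 1) (h : Tendsto (fun n => u n - w n) atTop (𝓝 0)) :
    limsup u atTop ≤ limsup w atTop := by
  by_contra! hc
  set δ := (limsup u atTop - limsup w atTop) / 3 with hδ
  have hδ0 : 0 < δ := by rw [hδ]; linarith
  have h1 := eventually_lt_of_limsup_lt (f := atTop) (u := w) (b := limsup w atTop + δ)
    (by linarith) (isBoundedUnder_le_of_mem hw)
  have h2 := frequently_lt_of_lt_limsup (f := atTop) (u := u) (b := limsup u atTop - δ)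
    (isCoboundedUnder_le_of_mem hu) (by linarith)
  have h3 := h.eventually (gt_mem_nhds hδ0)
  obtain ⟨n, hn1, hn2, hn3⟩ := (h2.and_eventually (h1.and h3)).exists
  linarith

/-- The upper limit of the ergodic averages. -/
def upperAvg (T : Ω → Ω) (f : Ω → ℝ) (x : Ω) : ℝ :=
  limsup (fun n => birkhoffAverage ℝ T f n x) atTop

lemma upperAvg_mem (hf : ∀ x, 0 ≤ f x ∧ f x ≤ 1) (x : Ω) :
    0 ≤ upperAvg T f x ∧ upperAvg T f x ≤ 1 :=
  limsup_mem_of_mem fun n => birkhoffAverage_mem hf n x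

lemma upperAvg_apply (hf : ∀ x, 0 ≤ f x ∧ f x ≤ 1) (x : Ω) :
    upperAvg T f (T x) = upperAvg T f x := by
  have hb : Bornology.IsBounded (Set.range fun n => f (T^[n] x)) := by
    refine (Metric.isBounded_Icc (0 : ℝ) 1).subset ?_
    rintro _ ⟨n, rfl⟩
    exact hf _
  have h := tendsto_birkhoffAverage_apply_sub_birkhoffAverage (𝕜 := ℝ) hb
  refine le_antisymm (limsup_le_of_sub_tendsto (fun n => birkhoffAverage_mem hf n _)
    (fun n => birkhoffAverage_mem hf n _) h) (limsup_le_of_sub_tendsto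
    (fun n => birkhoffAverage_mem hf n _) (fun n => birkhoffAverage_mem hf n _) ?_)
  have := h.neg
  simpa using this

/-- The orbit is cut greedily into blocks of length at most `M` with average at least `g - ε`. At
points of `E`, where no such block starts, the added indicator makes a single step sufficient. The
unfinished last block costs at most `M`. -/
lemma le_birkhoffSum_of_recurrent {g : Ω → ℝ} {M : ℕ} {ε : ℝ} {E : Set Ω}
    (hf : ∀ x, 0 ≤ f x ∧ f x ≤ 1)
    (hg : ∀ x, g (T x) = g x) (hg1 : ∀ x, g x - ε ≤ 1)
    (hE : ∀ x, x ∉ E → ∃ n, 1 ≤ n ∧ n ≤ M ∧ n * (g x - ε) ≤ birkhoffSum T f n x) (N : ℕ) (x : Ω) :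
    N * (g x - ε) - M ≤ birkhoffSum T (fun x => f x + E.indicator 1 x) N x := by
  classical
  have hf' : ∀ x, 0 ≤ f x + E.indicator (1 : Ω → ℝ) x := fun x =>
    add_nonneg (hf x).1 (Set.indicator_nonneg (fun _ _ => zero_le_one) x)
  have hgi : ∀ n x, g (T^[n] x) = g x := by
    intro n
    induction n with
    | zero => intro x; rfl
    | succ n ih => intro x; rw [Function.iterate_succ_apply, ih, hg]
  induction N using Nat.strong_induction_on generalizing x with
  | _ N ih =>
    rcases le_or_gt N M with hNM | hNM
    · have h1 : (0 : ℝ) ≤ birkhoffSum T (fun x => f x + E.indicator 1 x) N x :=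
        Finset.sum_nonneg fun _ _ => hf' _
      have h2 : (N : ℝ) * (g x - ε) ≤ N * 1 :=
        mul_le_mul_of_nonneg_left (hg1 x) (Nat.cast_nonneg N)
      have h3 : (N : ℝ) ≤ M := by exact_mod_cast hNM
      linarith
    · have key : ∀ n, 1 ≤ n → n ≤ N →
          n * (g x - ε) ≤ birkhoffSum T (fun x => f x + E.indicator 1 x) n x →
          N * (g x - ε) - M ≤ birkhoffSum T (fun x => f x + E.indicator 1 x) N x := by
        intro n h1 h2 h3
        have h4 := ih (N - n) (by omega) (T^[n] x)
        have h5 := birkhoffSum_add T (fun x => f x + E.indicator (1 : Ω → ℝ) x) n (N - n) x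
        rw [Nat.add_sub_cancel' h2] at h5
        rw [hgi, Nat.cast_sub h2] at h4
        rw [h5]
        linarith
      by_cases hx : x ∈ E
      · refine key 1 le_rfl (by omega) ?_
        rw [birkhoffSum_one, Set.indicator_of_mem hx, Nat.cast_one, one_mul]
        have := hg1 x
        have := (hf x).1
        simp only [Pi.one_apply]
        linarith
      · obtain ⟨n, h1, h2, h3⟩ := hE x hx
        refine key n h1 (by omega) (h3.trans (Finset.sum_le_sum fun i _ => ?_))
        have : (0 : ℝ) ≤ E.indicator 1 (T^[i] x) := Set.indicator_nonneg (fun _ _ => zero_le_one) _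
        linarith

lemma birkhoffAverage_mono {h h' : Ω → ℝ} (hh : ∀ x, h x ≤ h' x) (n : ℕ) (x : Ω) :
    birkhoffAverage ℝ S h n x ≤ birkhoffAverage ℝ S h' n x :=
  mul_le_mul_of_nonneg_left (Finset.sum_le_sum fun _ _ => hh _) (by positivity)

variable [MeasurableSpace Ω] {μ : Measure Ω}

lemma integral_comp_of_measurePreserving (hT : MeasurePreserving T μ μ) (hf : Measurable f) :
    ∫ x, f (T x) ∂μ = ∫ x, f x ∂μ := by
  conv_rhs => rw [← hT.map_eq]
  exact (integral_map hT.measurable.aemeasurable hf.aestronglyMeasurable).symm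

lemma integral_birkhoffSum (hT : MeasurePreserving T μ μ) (hf : Measurable f)
    (hi : Integrable f μ) (n : ℕ) : ∫ x, birkhoffSum T f n x ∂μ = n * ∫ x, f x ∂μ := by
  have h1 : ∀ i, MeasurePreserving T^[i] μ μ := fun i => hT.iterate i
  simp only [birkhoffSum]
  rw [integral_finsetSum _ fun i _ => ?_,
    Finset.sum_congr rfl fun i _ => integral_comp_of_measurePreserving (h1 i) hf]
  · simp
  · exact (h1 i).integrable_comp_of_integrable hi

variable [IsProbabilityMeasure μ]

lemma measurable_birkhoffSum (hT : Measurable T) (hf : Measurable f) (n : ℕ) :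
    Measurable (birkhoffSum T f n) :=
  Finset.measurable_sum _ fun i _ => hf.comp (hT.iterate i)

lemma measurable_birkhoffAverage (hT : Measurable T) (hf : Measurable f) (n : ℕ) :
    Measurable (birkhoffAverage ℝ T f n) :=
  (measurable_birkhoffSum hT hf n).const_mul _

lemma measurable_upperAvg (hT : Measurable T) (hf : Measurable f) : Measurable (upperAvg T f) :=
  Measurable.limsup fun n => measurable_birkhoffAverage hT hf n

lemma integrable_of_mem (hf : Measurable f) (h : ∀ x, 0 ≤ f x ∧ f x ≤ 1) : Integrable f μ :=
  Integrable.of_bound hf.aestronglyMeasurable 1 (Eventually.of_forall fun x => by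
    rw [Real.norm_eq_abs, abs_of_nonneg (h x).1]; exact (h x).2)

lemma integral_affine (hi : Integrable f μ) (a b c : ℝ) :
    ∫ x, (a * (f x - b) - c) ∂μ = a * (∫ x, f x ∂μ - b) - c := by
  have h1 : Integrable (fun x => f x - b) μ := hi.sub (integrable_const b)
  rw [integral_sub (h1.const_mul a) (integrable_const c), integral_const_mul,
    integral_sub hi (integrable_const b)]
  simp

/-- Integrate the block estimate and divide by its length; this gives the inequality up to `ε` and
the measure of `E M`. -/
lemma integral_upperAvg_le (hT : MeasurePreserving T μ μ) (hf : Measurable f)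
    (hf1 : ∀ x, 0 ≤ f x ∧ f x ≤ 1) : ∫ x, upperAvg T f x ∂μ ≤ ∫ x, f x ∂μ := by
  refine le_of_forall_pos_le_add fun ε hε => ?_
  set g := upperAvg T f with hg
  have mg : Measurable g := measurable_upperAvg hT.measurable hf
  have ig : Integrable g μ := integrable_of_mem mg (upperAvg_mem hf1)
  have iF : Integrable f μ := integrable_of_mem hf hf1
  -- The points from which no block of length at most `M` has a large average. By definition of the
  -- upper limit these sets decrease to the empty set.
  set E : ℕ → Set Ω := fun M =>
    ⋂ n : ℕ, ⋂ _ : 1 ≤ n, ⋂ _ : n ≤ M, {x | birkhoffSum T f n x < n * (g x - ε)} with hE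
  have mE : ∀ M, MeasurableSet (E M) := fun M => .iInter fun n => .iInter fun _ => .iInter fun _ =>
    measurableSet_lt (measurable_birkhoffSum hT.measurable hf n) ((mg.sub_const ε).const_mul _)
  have hEM : ∀ M x, x ∈ E M ↔ ∀ n : ℕ, 1 ≤ n → n ≤ M → birkhoffSum T f n x < n * (g x - ε) := by
    intro M x; simp [hE]
  have hanti : Antitone E := by
    intro M M' hM x hx
    rw [hEM] at hx ⊢
    exact fun n h1 h2 => hx n h1 (h2.trans hM)
  have hempty : ⋂ M, E M = ∅ := by
    rw [Set.eq_empty_iff_forall_notMem]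
    intro x hx
    rw [Set.mem_iInter] at hx
    have h1 := frequently_lt_of_lt_limsup (f := atTop)
      (u := fun n => birkhoffAverage ℝ T f n x) (b := g x - ε)
      (isCoboundedUnder_le_of_mem fun n => birkhoffAverage_mem hf1 n x)
      (sub_lt_self _ hε)
    obtain ⟨n, hn1, hn2⟩ := (h1.and_eventually (eventually_ge_atTop 1)).exists
    have h2 := (hEM n x).1 (hx n) n hn2 le_rfl
    have hn : (0 : ℝ) < n := by exact_mod_cast hn2
    rw [birkhoffAverage_eq, lt_inv_mul_iff₀ hn] at hn1
    linarith
  have hlim : Tendsto (fun M => μ.real (E M)) atTop (𝓝 0) := by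
    have := tendsto_measure_iInter_atTop (fun M => (mE M).nullMeasurableSet) hanti
      ⟨0, measure_ne_top μ _⟩
    rw [hempty, measure_empty] at this
    exact (ENNReal.tendsto_toReal ENNReal.zero_ne_top).comp this
  have key : ∀ M, ∫ x, g x ∂μ - ε ≤ ∫ x, f x ∂μ + μ.real (E M) := by
    intro M
    have mi : Measurable (fun x => f x + (E M).indicator 1 x) :=
      hf.add (measurable_one.indicator (mE M))
    have ii : Integrable ((E M).indicator (1 : Ω → ℝ)) μ :=
      (integrable_const (1 : ℝ)).indicator (mE M)
    have hN : ∀ N : ℕ, N * (∫ x, g x ∂μ - ε) - M ≤ N * (∫ x, f x ∂μ + μ.real (E M)) := by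
      intro N
      have h1 : ∫ x, ((N : ℝ) * (g x - ε) - M) ∂μ ≤
          ∫ x, birkhoffSum T (fun x => f x + (E M).indicator 1 x) N x ∂μ := by
        refine integral_mono ?_ ?_ fun x => ?_
        · exact ((ig.sub (integrable_const ε)).const_mul _).sub (integrable_const _)
        · exact integrable_finsetSum _ fun i _ =>
            (hT.iterate i).integrable_comp_of_integrable (iF.add ii)
        · refine le_birkhoffSum_of_recurrent hf1 (upperAvg_apply hf1) (fun x => ?_)
            (fun x hx => ?_) N x
          · have := (upperAvg_mem (T := T) hf1 x).2
            linarith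
          · rw [hEM] at hx
            push Not at hx
            exact hx
      rw [integral_birkhoffSum hT mi (iF.add ii), integral_add iF ii, integral_affine ig,
        integral_indicator_one (mE M)] at h1
      exact h1
    by_contra! hc
    obtain ⟨N, hN'⟩ := exists_nat_gt ((M : ℝ) / (∫ x, g x ∂μ - ε - (∫ x, f x ∂μ + μ.real (E M))))
    rw [div_lt_iff₀ (by linarith)] at hN'
    have := hN N
    nlinarith
  have := ge_of_tendsto' (hlim.const_add (∫ x, f x ∂μ)) key
  linarith

/-- The pointwise ergodic theorem. -/
lemma ae_tendsto_birkhoffAverage (hT : MeasurePreserving T μ μ) (hf : Measurable f)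
    (hf1 : ∀ x, 0 ≤ f x ∧ f x ≤ 1) :
    (∀ᵐ x ∂μ, Tendsto (fun n => birkhoffAverage ℝ T f n x) atTop (𝓝 (upperAvg T f x))) ∧
      ∫ x, upperAvg T f x ∂μ = ∫ x, f x ∂μ := by
  -- Applying the inequality to `1 - f` bounds the lower limit as well. The sum of the two upper
  -- averages is at least `1` and has integral at most `1`, which forces upper and lower limits to
  -- agree.
  set f' : Ω → ℝ := fun x => 1 - f x with hf'
  have mf' : Measurable f' := measurable_const.sub hf
  have hf'1 : ∀ x, 0 ≤ f' x ∧ f' x ≤ 1 := fun x => by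
    have := hf1 x; simp only [hf']; constructor <;> linarith
  have mg := measurable_upperAvg hT.measurable hf
  have mg' := measurable_upperAvg hT.measurable mf'
  have ig : Integrable (upperAvg T f) μ := integrable_of_mem mg (upperAvg_mem hf1)
  have ig' : Integrable (upperAvg T f') μ := integrable_of_mem mg' (upperAvg_mem hf'1)
  have h1 := integral_upperAvg_le hT hf hf1
  have h2 := integral_upperAvg_le hT mf' hf'1
  have h2' : ∫ x, f' x ∂μ = 1 - ∫ x, f x ∂μ := by
    rw [integral_sub (integrable_const _) (integrable_of_mem hf hf1)]; simp
  have hsum : ∀ n : ℕ, 1 ≤ n → ∀ x,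
      birkhoffAverage ℝ T f' n x = 1 - birkhoffAverage ℝ T f n x := by
    intro n hn x
    have hn' : (n : ℝ) ≠ 0 := by positivity
    rw [birkhoffAverage_eq, birkhoffAverage_eq, birkhoffSum, birkhoffSum]
    simp only [hf', Finset.sum_sub_distrib, Finset.sum_const, Finset.card_range, nsmul_eq_mul,
      mul_one, mul_sub, inv_mul_cancel₀ hn']
  have hup : ∀ {h : Ω → ℝ}, (∀ x, 0 ≤ h x ∧ h x ≤ 1) → ∀ x, ∀ ε, 0 < ε →
      ∀ᶠ n in atTop, birkhoffAverage ℝ T h n x < upperAvg T h x + ε := fun hh x ε hε =>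
    eventually_lt_of_limsup_lt (lt_add_of_pos_right _ hε)
      (isBoundedUnder_le_of_mem fun n => birkhoffAverage_mem hh n x)
  have hge : ∀ x, 0 ≤ upperAvg T f x + upperAvg T f' x - 1 := by
    intro x
    by_contra! hc
    set ε := -(upperAvg T f x + upperAvg T f' x - 1) / 3 with hε
    have hε0 : 0 < ε := by rw [hε]; linarith
    obtain ⟨n, h3, h4, h5⟩ := ((hup hf1 x ε hε0).and ((hup hf'1 x ε hε0).and
      (eventually_ge_atTop 1))).exists
    rw [hsum n h5] at h4
    linarith
  have hint : ∫ x, (upperAvg T f x + upperAvg T f' x - 1) ∂μ =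
      ∫ x, upperAvg T f x ∂μ + ∫ x, upperAvg T f' x ∂μ - 1 := by
    have h3 : Integrable (fun x => upperAvg T f x + upperAvg T f' x) μ := ig.add ig'
    rw [integral_sub h3 (integrable_const _), integral_add ig ig']
    simp
  have hint0 : 0 ≤ ∫ x, (upperAvg T f x + upperAvg T f' x - 1) ∂μ := integral_nonneg hge
  have hzero : ∫ x, (upperAvg T f x + upperAvg T f' x - 1) ∂μ = 0 := by linarith
  rw [integral_eq_zero_iff_of_nonneg hge ((ig.add ig').sub (integrable_const _))] at hzero
  refine ⟨?_, by linarith⟩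
  filter_upwards [hzero] with x hx
  simp only [Pi.zero_apply] at hx
  rw [Metric.tendsto_nhds]
  intro ε hε
  filter_upwards [hup hf1 x ε hε, hup hf'1 x ε hε, eventually_ge_atTop 1] with n h3 h4 h5
  rw [hsum n h5] at h4
  rw [Real.dist_eq, abs_lt]
  constructor <;> linarith

/-- The pointwise ergodic theorem for two transformations. -/
lemma ae_tendsto_birkhoffAverage_two (hT : MeasurePreserving T μ μ) (hS : MeasurePreserving S μ μ)
    (hf : Measurable f) (hf1 : ∀ x, 0 ≤ f x ∧ f x ≤ 1) :
    ∀ᵐ x ∂μ, ∃ l, Tendsto (fun n =>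
      birkhoffAverage ℝ S (fun y => birkhoffAverage ℝ T f n y) n x) atTop (𝓝 l) := by
  set g := upperAvg T f with hg
  have mg : Measurable g := measurable_upperAvg hT.measurable hf
  have hg1 : ∀ x, 0 ≤ g x ∧ g x ≤ 1 := upperAvg_mem hf1
  have hconv := (ae_tendsto_birkhoffAverage hT hf hf1).1
  -- The inner average depends on the same `n` as the outer one. `D ε N` is the set where
  -- convergence of the inner average is still bad after time `N`.
  set D : ℝ → ℕ → Set Ω := fun ε N =>
    ⋃ m : ℕ, ⋃ _ : N ≤ m, {x | ε < |birkhoffAverage ℝ T f m x - g x|} with hD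
  have mD : ∀ ε N, MeasurableSet (D ε N) := fun ε N => .iUnion fun m => .iUnion fun _ =>
    measurableSet_lt measurable_const
      ((measurable_birkhoffAverage hT.measurable hf m).sub mg).abs
  have hDm : ∀ ε N x, x ∈ D ε N ↔ ∃ m, N ≤ m ∧ ε < |birkhoffAverage ℝ T f m x - g x| := by
    intro ε N x; simp [hD]
  have hDlim : ∀ ε, 0 < ε → Tendsto (fun N => μ.real (D ε N)) atTop (𝓝 0) := by
    intro ε hε
    have hanti : Antitone (D ε) := by
      intro N N' hN x hx
      rw [hDm] at hx ⊢
      obtain ⟨m, h1, h2⟩ := hx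
      exact ⟨m, hN.trans h1, h2⟩
    have hnull : μ (⋂ N, D ε N) = 0 := by
      refine measure_mono_null (t := {x | ¬ Tendsto (fun n => birkhoffAverage ℝ T f n x) atTop
        (𝓝 (g x))}) ?_ hconv
      intro x hx ht
      rw [Metric.tendsto_atTop] at ht
      obtain ⟨N, hN⟩ := ht ε hε
      obtain ⟨m, h1, h2⟩ := (hDm ε N x).1 (Set.mem_iInter.1 hx N)
      have := hN m h1
      rw [Real.dist_eq] at this
      linarith
    have := tendsto_measure_iInter_atTop (fun N => (mD ε N).nullMeasurableSet) hanti
      ⟨0, measure_ne_top μ _⟩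
    rw [hnull] at this
    exact (ENNReal.tendsto_toReal ENNReal.zero_ne_top).comp this
  set χ : ℝ → ℕ → Ω → ℝ := fun ε N => (D ε N).indicator 1 with hχ
  have mχ : ∀ ε N, Measurable (χ ε N) := fun ε N => measurable_one.indicator (mD ε N)
  have hχ1 : ∀ ε N x, 0 ≤ χ ε N x ∧ χ ε N x ≤ 1 := by
    intro ε N x
    by_cases h : x ∈ D ε N <;> simp [hχ, h]
  -- The limiting frequency of visits to `D ε N` under `S` has integral `μ (D ε N)`, so by Markov's
  -- inequality it is small for some `N`, almost surely.
  have hsmall : ∀ ε, 0 < ε → ∀ᵐ x ∂μ, ∃ N, upperAvg S (χ ε N) x < ε := by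
    intro ε hε
    have hbound : ∀ N, ε * μ.real {x | ε ≤ upperAvg S (χ ε N) x} ≤ μ.real (D ε N) := by
      intro N
      have h1 := mul_meas_ge_le_integral_of_nonneg (μ := μ) (f := upperAvg S (χ ε N))
        (Eventually.of_forall fun x => (upperAvg_mem (hχ1 ε N) x).1)
        (integrable_of_mem (measurable_upperAvg hS.measurable (mχ ε N)) (upperAvg_mem (hχ1 ε N))) ε
      rw [(ae_tendsto_birkhoffAverage hS (mχ ε N) (hχ1 ε N)).2,
        integral_indicator_one (mD ε N)] at h1
      exact h1
    have hz : μ.real {x | ¬ ∃ N, upperAvg S (χ ε N) x < ε} = 0 := by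
      refine le_antisymm ?_ measureReal_nonneg
      have h0 : ε * μ.real {x | ¬ ∃ N, upperAvg S (χ ε N) x < ε} ≤ 0 := by
        refine ge_of_tendsto' (hDlim ε hε) fun N => le_trans ?_ (hbound N)
        refine mul_le_mul_of_nonneg_left (measureReal_mono ?_) hε.le
        intro x hx
        exact not_lt.1 fun hc => hx ⟨N, hc⟩
      nlinarith
    exact (measureReal_eq_zero_iff).1 hz
  have hall : ∀ᵐ x ∂μ, ∀ q : ℕ, ∃ N, upperAvg S (χ (1 / (q + 1)) N) x < 1 / ((q : ℝ) + 1) :=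
    ae_all_iff.2 fun q => hsmall _ (by positivity)
  have hconvχ : ∀ᵐ x ∂μ, ∀ q N : ℕ, Tendsto (fun n =>
      birkhoffAverage ℝ S (χ (1 / (q + 1)) N) n x) atTop (𝓝 (upperAvg S (χ (1 / (q + 1)) N) x)) :=
    ae_all_iff.2 fun q => ae_all_iff.2 fun N =>
      (ae_tendsto_birkhoffAverage hS (mχ _ N) (hχ1 _ N)).1
  filter_upwards [hall, hconvχ, (ae_tendsto_birkhoffAverage hS mg hg1).1] with x h1 h2 h3
  refine ⟨upperAvg S g x, ?_⟩
  rw [Metric.tendsto_nhds] at h3 ⊢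
  intro η hη
  obtain ⟨q, hq⟩ := exists_nat_one_div_lt (show 0 < η / 3 by linarith)
  obtain ⟨N, hN⟩ := h1 q
  set ε : ℝ := 1 / (q + 1) with hε
  have h4 := (h2 q N).eventually (gt_mem_nhds hN)
  filter_upwards [h4, h3 (η / 3) (by linarith), eventually_ge_atTop N, eventually_ge_atTop 1]
    with n h5 h6 h7 h8
  -- On `D` both averages lie in `[0, 1]`; elsewhere they differ by at most `ε`. Averaging along `S`
  -- transfers the limit from `g` to the inner averages, and no commutation of `S` and `T` is
  -- needed.
  have hpt : ∀ y, |birkhoffAverage ℝ T f n y - g y| ≤ ε + χ ε N y := by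
    intro y
    by_cases hy : y ∈ D ε N
    · have ha := birkhoffAverage_mem (T := T) hf1 n y
      have hb := hg1 y
      have hε0 : 0 < ε := by rw [hε]; positivity
      have : χ ε N y = 1 := by simp [hχ, hy]
      rw [this, abs_le]
      constructor <;> linarith
    · have : χ ε N y = 0 := by simp [hχ, hy]
      rw [this, add_zero]
      by_contra! hc
      exact hy ((hDm ε N y).2 ⟨n, h7, hc⟩)
  have hn : (0 : ℝ) < n := by exact_mod_cast h8
  have hlin : ∀ a b : Ω → ℝ, birkhoffAverage ℝ S (fun y => a y + b y) n x =
      birkhoffAverage ℝ S a n x + birkhoffAverage ℝ S b n x := by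
    intro a b
    simp only [birkhoffAverage_eq, birkhoffSum, Finset.sum_add_distrib, mul_add]
  have hconst : birkhoffAverage ℝ S (fun _ => ε) n x = ε := by
    simp only [birkhoffAverage_eq, birkhoffSum, Finset.sum_const, Finset.card_range, nsmul_eq_mul]
    field_simp
  have hb1 : birkhoffAverage ℝ S (fun y => birkhoffAverage ℝ T f n y) n x ≤
      birkhoffAverage ℝ S g n x + (ε + birkhoffAverage ℝ S (χ ε N) n x) := by
    have := birkhoffAverage_mono (S := S) (h := fun y => birkhoffAverage ℝ T f n y)
      (h' := fun y => g y + (ε + χ ε N y)) (fun y => by linarith [(abs_le.1 (hpt y)).2]) n x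
    rwa [hlin g fun y => ε + χ ε N y, hlin (fun _ => ε) (χ ε N), hconst] at this
  have hb2 : birkhoffAverage ℝ S g n x ≤
      birkhoffAverage ℝ S (fun y => birkhoffAverage ℝ T f n y) n x +
        (ε + birkhoffAverage ℝ S (χ ε N) n x) := by
    have := birkhoffAverage_mono (S := S) (h := g)
      (h' := fun y => birkhoffAverage ℝ T f n y + (ε + χ ε N y))
      (fun y => by linarith [(abs_le.1 (hpt y)).1]) n x
    rwa [hlin _ fun y => ε + χ ε N y, hlin (fun _ => ε) (χ ε N), hconst] at this
  rw [Real.dist_eq, abs_lt] at h6 ⊢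
  constructor <;> linarith

end Ergodic


/-! ### Couplings together with two spin assignments -/

lemma dualEdge_injective : Function.Injective dualEdge := by
  rintro ⟨⟨x, y⟩, _ | _⟩ ⟨⟨x', y'⟩, _ | _⟩ h <;>
    simp [dualEdge, Prod.ext_iff] at h ⊢ <;> omega

lemma crossed_subset {n k : ℕ} {A : Set Edge} {p q : Plaquette} (P : (dualGraph n k A).Walk p q) :
    crossed P ⊆ A := by
  intro e he
  have h := P.edges_subset_edgeSet he
  rw [dualGraph, SimpleGraph.edgeSet_fromEdgeSet] at h
  obtain ⟨⟨e', h1, h2⟩, -⟩ := h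
  rw [← dualEdge_injective h2]
  exact h1.1

/-- The side length of the square in the definition of `BA`. -/
def sideLen (K : ℕ) : ℝ := 100 * (K : ℝ) ^ (1 / 100 : ℝ)

lemma exists_floor_sideLen {K : ℕ} (hK : 1 ≤ K) :
    ∃ a : ℕ, ⌊sideLen K / 2⌋ = a ∧ 1 ≤ a ∧ 2 * a ≤ 99 + K ∧ (K : ℝ) ^ (1 / 100 : ℝ) ≤ 2 * a + 1 := by
  have hk1 : (1 : ℝ) ≤ (K : ℝ) ^ (1 / 100 : ℝ) :=
    Real.one_le_rpow (by exact_mod_cast hK) (by norm_num)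
  have hk2 : (K : ℝ) ^ (1 / 100 : ℝ) ≤ 1 + 1 / 100 * ((K : ℝ) - 1) := by
    have := rpow_one_add_le_one_add_mul_self (s := (K : ℝ) - 1) (p := 1 / 100)
      (by have : (0 : ℝ) ≤ K := Nat.cast_nonneg K
          linarith) (by norm_num) (by norm_num)
    simpa using this
  obtain ⟨a, ha⟩ : ∃ a : ℕ, ⌊sideLen K / 2⌋ = a := ⟨⌊sideLen K / 2⌋.toNat, (Int.toNat_of_nonneg
    (Int.floor_nonneg.2 (by unfold sideLen; positivity))).symm⟩
  have ha1 : sideLen K / 2 < a + 1 := by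
    have := Int.lt_floor_add_one (sideLen K / 2)
    rw [ha] at this
    exact_mod_cast this
  have ha2 : (a : ℝ) ≤ sideLen K / 2 := by
    have := Int.floor_le (sideLen K / 2)
    rw [ha] at this
    exact_mod_cast this
  rw [sideLen] at ha1 ha2
  refine ⟨a, ha, ?_, ?_, by linarith⟩
  · have : (0 : ℝ) < a := by linarith
    exact_mod_cast this
  · have : (2 * a : ℝ) ≤ 99 + K := by linarith
    exact_mod_cast this

lemma squareEdges_subset_boxE {L : ℝ} {a n k : ℕ} (ha : ⌊L / 2⌋ = a) (hn : a ≤ n) (hk : a ≤ k) :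
    squareEdges L ⊆ boxE n k := by
  rw [squareEdges_eq, ha]
  rintro ⟨⟨x, y⟩, _ | _⟩ he <;> rw [Finset.mem_coe, Finset.mem_filter] at he <;>
    rw [Finset.mem_coe] <;> [rw [mem_boxE_hE]; rw [mem_boxE_vE]] <;>
    simp only [Finset.mem_product, Finset.mem_Icc, Finset.mem_univ, and_true, tgt] at he <;>
    simp at he ⊢ <;> omega

/-- The square of `BA` lies in the smaller box, where the edges crossed by the path are edges on
which the two states differ; hence the path provides the density. -/
lemma BA.exists_pair {J : Couplings} {n K : ℕ} (hJ : Generic J) (hR : J ∈ R n K)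
    (hBA : J ∈ BA n K) (hKn : K ≤ n) (hK : 101 ≤ K) :
    ∃ r s, CutOpt J r K (K - 1) ∧ CutOpt J s K (K - 1) ∧
      1 / 100 ≤ densityIn {e | agree r e ≠ agree s e} (sideLen K) := by
  obtain ⟨r, s, hr, hs, p, -, q, -, -, -, P, -, -, hP⟩ := hBA
  have c : CPair J n K K r s := ⟨hJ, hR, by omega, by omega, le_rfl, hr, hs⟩
  refine ⟨r, s, hr.cutOpt.mono le_rfl (by omega), hs.cutOpt.mono le_rfl (by omega),
    hP.trans (densityIn_mono ?_)⟩
  obtain ⟨a, ha, -, ha2, -⟩ := exists_floor_sideLen (K := K) (by omega)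
  rintro e ⟨he1, he2⟩
  exact (c.mem_inner (squareEdges_subset_boxE ha (by omega) (by omega) he2)).1 (crossed_subset P he1)

/-- Couplings together with two spin assignments, `true` standing for the spin `-1`. -/
abbrev Config := Couplings × (Vertex → Bool) × (Vertex → Bool)

/-- The spin assignment given by a map to the Booleans. -/
def spinsB (b : Vertex → Bool) : Spins := fun u => if b u then -1 else 1

lemma spinsB_decide (W : Finset Vertex) : spinsB (fun u => decide (u ∈ W)) = spinsOf W := by
  funext u
  simp [spinsB, spinsOf, flipOn]

lemma CutOpt.congr {J : Couplings} {σ τ : Spins} {n k : ℕ} {b : ℤ} (h : CutOpt J σ k b)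
    (hb : b ≤ n) (hστ : ∀ u ∈ boxV n k, σ u = τ u) : CutOpt J τ k b := by
  intro W hW
  rw [← Finset.sum_congr rfl fun e he => bond_congr J hστ (cutE_subset_boxE
    (fun u hu => ⟨(hW u hu).1, (hW u hu).2.trans_le hb⟩) he)]
  exact h W hW

lemma measurableSet_cutOpt (σ : Spins) (k b : ℤ) : MeasurableSet {J | CutOpt J σ k b} := by
  have : {J | CutOpt J σ k b} = ⋂ W : Finset Vertex, ⋂ _ : ∀ u ∈ W, |u.1| < k ∧ |u.2| < b,
      {J | 0 ≤ ∑ e ∈ cutE W, bond J σ e} := by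
    ext J; simp [CutOpt]
  rw [this]
  exact .iInter fun W => .iInter fun _ => measurableSet_le measurable_const
    (Finset.measurable_sum _ fun e _ => measurable_bond σ e)

/-- The edge `e` is satisfied by exactly one of the two spin assignments. -/
def Differs (e : Edge) (ω : Config) : Prop := agree (spinsB ω.2.1) e ≠ agree (spinsB ω.2.2) e

/-- A measurable choice of two finite volume ground states, which differ on a set of positive
density when the event `BA` holds. -/
lemma exists_measurable_pair {K : ℕ} (hK : 101 ≤ K) :
    ∃ c : Couplings → Config, Measurable c ∧ ∀ J, (c J).1 = J ∧
      CutOpt J (spinsB (c J).2.1) K (K - 1) ∧ CutOpt J (spinsB (c J).2.2) K (K - 1) ∧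
      (Generic J → J ∈ (⋃ n, ⋃ _ : K ≤ n, R n K ∩ BA n K) →
        1 / 100 ≤ densityIn {e | Differs e (c J)} (sideLen K)) := by
  set U : Set Couplings := ⋃ n, ⋃ _ : K ≤ n, R n K ∩ BA n K with hU
  have mU : MeasurableSet U := .iUnion fun n => .iUnion fun _ =>
    (measurableSet_R n K).inter (measurableSet_BA n K)
  obtain ⟨a, ha, -, ha2, -⟩ := exists_floor_sideLen (K := K) (by omega)
  -- Countably many candidate pairs cover all couplings: outside the event `BA` one c-ground state
  -- is used twice. The first suitable pair in an enumeration is then a measurable choice.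
  let B : Finset Vertex × Finset Vertex → Set Couplings := fun i =>
    ({J | CutOpt J (spinsOf i.1) K (K - 1)} ∩ {J | CutOpt J (spinsOf i.2) K (K - 1)}) ∩
    {J | Generic J → J ∈ U →
      1 / 100 ≤ densityIn {e | agree (spinsOf i.1) e ≠ agree (spinsOf i.2) e} (sideLen K)}
  have mB : ∀ i, MeasurableSet (B i) := fun i =>
    ((measurableSet_cutOpt _ _ _).inter (measurableSet_cutOpt _ _ _)).inter
      (measurableSet_generic.imp (mU.imp (.const _)))
  have cover : ∀ J, ∃ i, J ∈ B i := by
    intro J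
    have key : ∃ r s, CutOpt J r K (K - 1) ∧ CutOpt J s K (K - 1) ∧ (Generic J → J ∈ U →
        1 / 100 ≤ densityIn {e | agree r e ≠ agree s e} (sideLen K)) := by
      by_cases h : Generic J ∧ J ∈ U
      · have h2 := h.2
        simp only [hU, Set.mem_iUnion] at h2
        obtain ⟨n, hn, h3, h4⟩ := h2
        obtain ⟨r, s, h5, h6, h7⟩ := BA.exists_pair h.1 h3 h4 hn hK
        exact ⟨r, s, h5, h6, fun _ _ => h7⟩
      · obtain ⟨σ, hσ⟩ := exists_isCGroundState J K K
        have := hσ.cutOpt.mono (le_refl (K : ℤ)) (show (K : ℤ) - 1 ≤ K by omega)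
        exact ⟨σ, σ, this, this, fun h1 h2 => absurd ⟨h1, h2⟩ h⟩
    obtain ⟨r, s, h1, h2, h3⟩ := key
    obtain ⟨V, hV⟩ := exists_spinsOf r (boxV K K)
    obtain ⟨W, hW⟩ := exists_spinsOf s (boxV K K)
    refine ⟨(V, W), ⟨h1.congr (by omega) fun u hu => (hV u hu).symm,
      h2.congr (by omega) fun u hu => (hW u hu).symm⟩, fun g u => (h3 g u).trans (densityIn_mono ?_)⟩
    rintro e ⟨he1, he2⟩
    have he := squareEdges_subset_boxE ha (show a ≤ K by omega) (show a ≤ K by omega) he2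
    rw [Finset.mem_coe, mem_boxE] at he
    simpa only [Set.mem_ofPred_eq, agree, hV _ he.1, hV _ he.2, hW _ he.1, hW _ he.2] using he1
  obtain ⟨f, hf⟩ := exists_surjective_nat (Finset Vertex × Finset Vertex)
  classical
  have cover' : ∀ J, ∃ m, J ∈ B (f m) := fun J => by
    obtain ⟨i, hi⟩ := cover J
    obtain ⟨m, rfl⟩ := hf i
    exact ⟨m, hi⟩
  have mN := measurable_find cover' fun m => mB (f m)
  refine ⟨fun J => (J, fun u => decide (u ∈ (f (Nat.find (cover' J))).1),
    fun u => decide (u ∈ (f (Nat.find (cover' J))).2)), ?_, fun J => ⟨rfl, ?_⟩⟩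
  · exact measurable_id.prodMk (Measurable.prodMk
      ((measurable_of_countable fun m u => decide (u ∈ (f m).1)).comp mN)
      ((measurable_of_countable fun m u => decide (u ∈ (f m).2)).comp mN))
  · have h := Nat.find_spec (cover' J)
    simp only [Differs, spinsB_decide]
    exact ⟨h.1.1, h.1.2, h.2⟩

/-- Translation of configurations. -/
def shiftC (t : Vertex) (ω : Config) : Config :=
  (shiftJ t ω.1, fun u => ω.2.1 (u + t), fun u => ω.2.2 (u + t))

lemma shiftC_shiftC (s t : Vertex) (ω : Config) : shiftC s (shiftC t ω) = shiftC (s + t) ω := by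
  refine Prod.ext (funext fun e => ?_) (Prod.ext (funext fun u => ?_) (funext fun u => ?_)) <;>
    simp [shiftC, shiftJ, add_assoc]

lemma shiftC_zero (ω : Config) : shiftC 0 ω = ω := by
  refine Prod.ext (funext fun e => ?_) (Prod.ext (funext fun u => ?_) (funext fun u => ?_)) <;>
    simp [shiftC, shiftJ]

lemma continuous_shiftC (t : Vertex) : Continuous (shiftC t) := by
  unfold shiftC shiftJ; fun_prop

lemma src_add (e : Edge) (t : Vertex) : src (e.1 + t, e.2) = src e + t := rfl

lemma tgt_add (e : Edge) (t : Vertex) : tgt (e.1 + t, e.2) = tgt e + t := by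
  rcases e with ⟨u, _ | _⟩ <;> simp [tgt, add_right_comm]

lemma agree_add (σ : Spins) (e : Edge) (t : Vertex) :
    agree (fun u => σ (u + t)) e = agree σ (e.1 + t, e.2) := by
  simp [agree, src_add, tgt_add]

lemma differs_shiftC (e : Edge) (t : Vertex) (ω : Config) :
    Differs e (shiftC t ω) ↔ Differs (e.1 + t, e.2) ω := by
  rw [Differs, Differs, ← agree_add, ← agree_add]; rfl

lemma CutOpt.shift {J : Couplings} {σ : Spins} {k b k' b' : ℤ} (h : CutOpt J σ k b) (t : Vertex)
    (hk : k' + |t.1| ≤ k) (hb : b' + |t.2| ≤ b) :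
    CutOpt (shiftJ t J) (fun u => σ (u + t)) k' b' := by
  intro W hW
  have h1 := h (W.map (Equiv.addRight t).toEmbedding) (by
    intro u hu
    obtain ⟨u, hu', rfl⟩ := Finset.mem_map.1 hu
    have h2 := hW u hu'
    have h3 := abs_add_le u.1 t.1
    have h4 := abs_add_le u.2 t.2
    simp only [Equiv.coe_toEmbedding, Equiv.coe_addRight, Prod.fst_add, Prod.snd_add]
    omega)
  refine h1.trans_eq (Eq.symm ?_)
  refine Finset.sum_nbij (fun e => (e.1 + t, e.2)) ?_ ?_ ?_ ?_
  · intro e he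
    rw [mem_cutE] at he ⊢
    simpa [src_add, tgt_add] using he
  · intro e _ e' _ h
    simpa [Prod.ext_iff] using h
  · intro e he
    refine ⟨(e.1 - t, e.2), ?_, by simp⟩
    have hs : src (e.1 - t, e.2) = src e - t := rfl
    have ht : tgt (e.1 - t, e.2) = tgt e - t := by
      have := tgt_add e (-t)
      simpa [sub_eq_add_neg] using this
    rw [Finset.mem_coe, mem_cutE] at he ⊢
    simpa [hs, ht, ← sub_eq_add_neg] using he
  · intro e _
    simp [bond_eq, agree_add, shiftJ]

lemma measurable_shiftC (t : Vertex) : Measurable (shiftC t) := (continuous_shiftC t).measurable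

/-- Being clopen makes the indicator continuous, so that its mean passes to weak limits. -/
lemma isClopen_differs (e : Edge) : IsClopen {ω | Differs e ω} := by
  have h : Continuous fun ω : Config =>
      (ω.2.1 (src e), ω.2.1 (tgt e), ω.2.2 (src e), ω.2.2 (tgt e)) := by fun_prop
  exact (isClopen_discrete {x : Bool × Bool × Bool × Bool |
    (if x.1 then (-1 : ℤˣ) else 1) * (if x.2.1 then -1 else 1) ≠
    (if x.2.2.1 then -1 else 1) * (if x.2.2.2 then -1 else 1)}).preimage h

open Classical in
/-- The indicator function of the event that the edge at the origin of the given direction is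
satisfied by exactly one of the two spin assignments. -/
def diffInd (b : Bool) (ω : Config) : ℝ := if Differs (0, b) ω then 1 else 0

lemma diffInd_mem (b : Bool) (ω : Config) : 0 ≤ diffInd b ω ∧ diffInd b ω ≤ 1 := by
  unfold diffInd; split_ifs <;> norm_num

lemma continuous_diffInd (b : Bool) : Continuous (diffInd b) := by
  classical
  have h : diffInd b = {ω | Differs (0, b) ω}.indicator 1 := by
    funext ω
    simp [diffInd, Set.indicator]
  rw [h]
  exact continuous_one.indicator (by simp [(isClopen_differs _).frontier_eq])

open Classical in
lemma diffInd_shiftC (b : Bool) (t : Vertex) (ω : Config) :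
    diffInd b (shiftC t ω) = if Differs (t, b) ω then 1 else 0 := by
  simp [diffInd, differs_shiftC]

lemma continuous_sum_bond (W : Finset Vertex) (g : Config → Vertex → Bool) (hg : Continuous g) :
    Continuous fun ω : Config => ∑ e ∈ cutE W, bond ω.1 (spinsB (g ω)) e := by
  refine continuous_finsetSum _ fun e _ => ?_
  have h : ∀ u : Vertex, Continuous fun ω : Config => ((spinsB (g ω) u : ℤ) : ℝ) := fun u =>
    (continuous_of_discreteTopology (f := fun x : Bool =>
      (((if x then (-1 : ℤˣ) else 1 : ℤˣ) : ℤ) : ℝ))).comp ((continuous_apply u).comp hg)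
  unfold bond
  exact (((continuous_apply e).comp continuous_fst).mul (h _)).mul (h _)


/-! ### Averages of measures over translations -/

section Average

variable {ι X : Type*} [MeasurableSpace X]

/-- The average of the measures `m i` for `i` in a finite set. -/
def avgMeasure (s : Finset ι) (m : ι → Measure X) : Measure X := (s.card : ENNReal)⁻¹ • ∑ i ∈ s, m i

variable {s : Finset ι} {m : ι → Measure X}

lemma avgMeasure_apply_eq (hs : s.Nonempty) {A : Set X} {c : ENNReal} (h : ∀ i ∈ s, m i A = c) :
    avgMeasure s m A = c := by
  rw [avgMeasure, Measure.smul_apply, Measure.finsetSum_apply, Finset.sum_congr rfl h,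
    Finset.sum_const, nsmul_eq_mul, smul_eq_mul, ← mul_assoc, ENNReal.inv_mul_cancel, one_mul]
  · simpa using hs.ne_empty
  · simp

lemma ae_avgMeasure {p : X → Prop} (h : ∀ i ∈ s, ∀ᵐ x ∂m i, p x) : ∀ᵐ x ∂avgMeasure s m, p x :=
  Measure.ae_smul_measure (ae_finsetSum_measure_iff.2 h) _

lemma integral_avgMeasure {f : X → ℝ} (h : ∀ i ∈ s, Integrable f (m i)) :
    ∫ x, f x ∂avgMeasure s m = (s.card : ℝ)⁻¹ * ∑ i ∈ s, ∫ x, f x ∂m i := by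
  rw [avgMeasure, integral_smul_measure, integral_finsetSum_measure h]
  simp

end Average

/-- The translations by the points of the square `[-a, a]²`. -/
def trans (a : ℕ) (p : ℕ × ℕ) : Vertex := ((p.1 : ℤ) - a, (p.2 : ℤ) - a)

/-- The index set of the points of `[-a, a]²`. -/
def idx (a : ℕ) : Finset (ℕ × ℕ) := Finset.range (2 * a + 1) ×ˢ Finset.range (2 * a + 1)

lemma card_idx (a : ℕ) : (idx a).card = (2 * a + 1) * (2 * a + 1) := by simp [idx]

lemma abs_trans_le {a : ℕ} {p : ℕ × ℕ} (hp : p ∈ idx a) : |(trans a p).1| ≤ a ∧ |(trans a p).2| ≤ a := by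
  simp only [idx, Finset.mem_product, Finset.mem_range] at hp
  simp only [trans, abs_le]
  omega

lemma abs_sum_range_sub_le {H : ℕ → ℝ} {C : ℝ} (hH : ∀ i, |H i| ≤ C) (N : ℕ) :
    |∑ i ∈ Finset.range N, (H (i + 1) - H i)| ≤ 2 * C := by
  rw [Finset.sum_range_sub]
  have h1 := abs_le.1 (hH N)
  have h2 := abs_le.1 (hH 0)
  rw [abs_le]
  constructor <;> linarith

/-- Along every line of the square the sum telescopes, leaving two boundary terms. -/
lemma abs_sum_trans_sub_le {G : Vertex → ℝ} {C : ℝ} (hG : ∀ u, |G u| ≤ C) (a : ℕ) {s : Vertex}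
    (hs : s = (1, 0) ∨ s = (0, 1)) :
    |∑ p ∈ idx a, (G (s + trans a p) - G (trans a p))| ≤ (2 * a + 1) * (2 * C) := by
  have hN : ∑ j ∈ Finset.range (2 * a + 1), 2 * C = (2 * a + 1) * (2 * C) := by simp
  rw [← hN, idx]
  rcases hs with rfl | rfl
  · rw [Finset.sum_product_right]
    refine (Finset.abs_sum_le_sum_abs _ _).trans (Finset.sum_le_sum fun j _ => ?_)
    refine le_trans (le_of_eq ?_) (abs_sum_range_sub_le (H := fun i => G (trans a (i, j)))
      (fun i => hG _) (2 * a + 1))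
    congr 1
    refine Finset.sum_congr rfl fun i _ => ?_
    congr 2
    simp [trans]; ring
  · rw [Finset.sum_product]
    refine (Finset.abs_sum_le_sum_abs _ _).trans (Finset.sum_le_sum fun i _ => ?_)
    refine le_trans (le_of_eq ?_) (abs_sum_range_sub_le (H := fun j => G (trans a (i, j)))
      (fun j => hG _) (2 * a + 1))
    congr 1
    refine Finset.sum_congr rfl fun j _ => ?_
    congr 2
    simp [trans]; ring

lemma inv_mul_le_of_le {x N C κ : ℝ} (hx : x ≤ N * (2 * C)) (hκ : 0 < κ) (hN : κ ≤ N) (hC : 0 ≤ C) :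
    (N * N)⁻¹ * x ≤ 2 * C / κ := by
  have hN0 : 0 < N := hκ.trans_le hN
  refine (mul_le_mul_of_nonneg_left hx (by positivity)).trans ?_
  refine le_trans (le_of_eq ?_) (div_le_div_of_nonneg_left (by positivity) hκ hN)
  field_simp

lemma ncard_differs_le {L : ℝ} {a : ℕ} (ha : ⌊L / 2⌋ = a) (ω : Config) :
    (({e | Differs e ω} ∩ squareEdges L).ncard : ℝ) ≤
      ∑ p ∈ idx a, (diffInd false (shiftC (trans a p) ω) + diffInd true (shiftC (trans a p) ω)) := by
  classical
  have hsub : {e | Differs e ω} ∩ squareEdges L ⊆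
      ↑(((idx a ×ˢ (Finset.univ : Finset Bool)).filter
        fun q => Differs (trans a q.1, q.2) ω).image fun q => ((trans a q.1, q.2) : Edge)) := by
    rintro ⟨⟨x, y⟩, b⟩ ⟨h1, h2⟩
    rw [squareEdges_eq, ha, Finset.mem_coe, Finset.mem_filter] at h2
    simp only [Finset.mem_product, Finset.mem_Icc, Finset.mem_univ, and_true] at h2
    have hxy : trans a ((x + a).toNat, (y + a).toNat) = (x, y) := by
      simp only [trans, Prod.mk.injEq]; omega
    rw [Finset.mem_coe, Finset.mem_image]
    refine ⟨(((x + a).toNat, (y + a).toNat), b), ?_, by rw [hxy]⟩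
    rw [Finset.mem_filter]
    refine ⟨?_, by rw [hxy]; exact h1⟩
    simp only [idx, Finset.mem_product, Finset.mem_range, Finset.mem_univ, and_true]
    omega
  have h1 := (Set.ncard_le_ncard hsub (Finset.finite_toSet _)).trans
    ((Set.ncard_coe_finset _).le.trans Finset.card_image_le)
  refine (Nat.cast_le.2 h1).trans (le_of_eq ?_)
  rw [Finset.card_filter, Finset.sum_product]
  push_cast
  refine Finset.sum_congr rfl fun p _ => ?_
  rw [Fintype.sum_bool, diffInd_shiftC, diffInd_shiftC, add_comm]

/-- The averaged law of a pair of finite volume ground states. -/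
lemma exists_approx {v : ℝ≥0} (hv : v ≠ 0) {K : ℕ} (hK : 101 ≤ K) {d : ℝ}
    (hd : d ≤ (couplingLaw v).real (⋃ n, ⋃ _ : K ≤ n, R n K ∩ BA n K)) :
    ∃ ν : ProbabilityMeasure Config, (ν : Measure Config).map Prod.fst = couplingLaw v ∧
      (∀ (W : Finset Vertex) (M : ℕ), (∀ u ∈ W, |u.1| ≤ M ∧ |u.2| ≤ M) → 2 * M + 102 ≤ K →
        ∀ᵐ ω ∂(ν : Measure Config), 0 ≤ ∑ e ∈ cutE W, bond ω.1 (spinsB ω.2.1) e ∧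
          0 ≤ ∑ e ∈ cutE W, bond ω.1 (spinsB ω.2.2) e) ∧
      (∀ (f : BoundedContinuousFunction Config ℝ) (s : Vertex), s = (1, 0) ∨ s = (0, 1) →
        |∫ ω, f (shiftC s ω) ∂(ν : Measure Config) - ∫ ω, f ω ∂(ν : Measure Config)| ≤
          2 * ‖f‖ / (K : ℝ) ^ (1 / 100 : ℝ)) ∧
      d / 100 ≤ ∫ ω, (diffInd false ω + diffInd true ω) ∂(ν : Measure Config) := by
  obtain ⟨c, mc, hc⟩ := exists_measurable_pair hK
  obtain ⟨a, ha, ha1, ha2, ha3⟩ := exists_floor_sideLen (K := K) (by omega)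
  have mt : ∀ t, Measurable fun J => shiftC t (c J) := fun t => (measurable_shiftC t).comp mc
  -- The translations run over the square of `BA`. Its side tends to infinity, which makes the
  -- average nearly invariant, yet its half side `a` is at most about `K / 2`, so a fixed window
  -- stays in the region where the chosen states are stable.
  let m : ℕ × ℕ → Measure Config := fun p => (couplingLaw v).map fun J => shiftC (trans a p) (c J)
  have hne : (idx a).Nonempty := ⟨(0, 0), by simp [idx]⟩
  have hm : ∀ p, IsProbabilityMeasure (m p) := fun p => Measure.isProbabilityMeasure_map (mt _).aemeasurable
  have hp : IsProbabilityMeasure (avgMeasure (idx a) m) :=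
    ⟨avgMeasure_apply_eq hne fun p _ => measure_univ⟩
  have hint : ∀ f : Config → ℝ, Measurable f → ∀ C, (∀ ω, |f ω| ≤ C) →
      ∫ ω, f ω ∂avgMeasure (idx a) m = (((2 * a + 1) * (2 * a + 1) : ℝ))⁻¹ *
        ∑ p ∈ idx a, ∫ J, f (shiftC (trans a p) (c J)) ∂couplingLaw v := by
    intro f mf C hC
    rw [integral_avgMeasure fun p _ => Integrable.of_bound mf.aestronglyMeasurable C
      (Eventually.of_forall hC), card_idx]
    push_cast
    congr 1
    exact Finset.sum_congr rfl fun p _ => integral_map (mt _).aemeasurable mf.aestronglyMeasurable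
  refine ⟨⟨avgMeasure (idx a) m, hp⟩, ?_, ?_, ?_, ?_⟩
  · rw [ProbabilityMeasure.coe_mk]
    ext A hA
    rw [Measure.map_apply measurable_fst hA]
    refine avgMeasure_apply_eq hne fun p _ => ?_
    rw [Measure.map_apply (mt _) (measurable_fst hA),
      ← (measurePreserving_shiftJ v (trans a p)).measure_preimage hA.nullMeasurableSet]
    congr 1
    ext J
    simp [shiftC, (hc J).1]
  · intro W M hW hM
    refine ae_avgMeasure fun p hp => ?_
    obtain ⟨h1, h2⟩ := abs_trans_le hp
    have mS : MeasurableSet {ω : Config | 0 ≤ ∑ e ∈ cutE W, bond ω.1 (spinsB ω.2.1) e ∧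
        0 ≤ ∑ e ∈ cutE W, bond ω.1 (spinsB ω.2.2) e} :=
      (measurableSet_le measurable_const (continuous_sum_bond W (fun ω => ω.2.1) (by fun_prop)).measurable).inter
      (measurableSet_le measurable_const (continuous_sum_bond W (fun ω => ω.2.2) (by fun_prop)).measurable)
    rw [ae_map_iff (mt _).aemeasurable mS]
    refine Eventually.of_forall fun J => ?_
    have hW' : ∀ u ∈ W, |u.1| < (M : ℤ) + 1 ∧ |u.2| < (M : ℤ) + 1 := fun u hu => by
      have := hW u hu; omega
    have key : ∀ σ, CutOpt J σ K (K - 1) →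
        0 ≤ ∑ e ∈ cutE W, bond (shiftJ (trans a p) J) (fun u => σ (u + trans a p)) e := fun σ h =>
      h.shift (trans a p) (k' := M + 1) (b' := M + 1) (by omega) (by omega) W hW'
    have hJ := hc J
    simp only [shiftC, hJ.1]
    exact ⟨key (spinsB (c J).2.1) hJ.2.1, key (spinsB (c J).2.2) hJ.2.2.1⟩
  · intro f s hs
    have hC : ∀ ω, |f ω| ≤ ‖f‖ := fun ω => f.norm_coe_le_norm ω
    have mf : Measurable f := f.continuous.measurable
    rw [ProbabilityMeasure.coe_mk, hint (fun ω => f (shiftC s ω)) (mf.comp (measurable_shiftC s)) ‖f‖ fun ω => hC _,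
      hint f mf ‖f‖ hC, ← mul_sub, ← Finset.sum_sub_distrib]
    have hG := abs_sum_trans_sub_le (G := fun u => ∫ J, f (shiftC u (c J)) ∂couplingLaw v)
      (C := ‖f‖) (fun u => by
        have := norm_integral_le_of_norm_le_const (μ := couplingLaw v) (f := fun J => f (shiftC u (c J)))
          (C := ‖f‖) (Eventually.of_forall fun J => hC _)
        simpa using this) a hs
    simp only [shiftC_shiftC] at hG ⊢
    rw [abs_mul, abs_of_nonneg (by positivity)]
    have hK0 : (0 : ℝ) < (K : ℝ) ^ (1 / 100 : ℝ) :=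
      Real.rpow_pos_of_pos (by exact_mod_cast (by omega : 0 < K)) _
    exact inv_mul_le_of_le hG hK0 ha3 (norm_nonneg f)
  · set U : Set Couplings := ⋃ n, ⋃ _ : K ≤ n, R n K ∩ BA n K with hU
    have mU : MeasurableSet U := .iUnion fun n => .iUnion fun _ =>
      (measurableSet_R n K).inter (measurableSet_BA n K)
    have mD : Measurable fun ω => diffInd false ω + diffInd true ω :=
      ((continuous_diffInd _).add (continuous_diffInd _)).measurable
    have hD : ∀ ω, |diffInd false ω + diffInd true ω| ≤ 2 := fun ω => by
      have h1 := diffInd_mem false ω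
      have h2 := diffInd_mem true ω
      rw [abs_le]; constructor <;> linarith
    rw [ProbabilityMeasure.coe_mk, hint _ mD 2 hD]
    have hi : ∀ p ∈ idx a, Integrable (fun J => diffInd false (shiftC (trans a p) (c J)) +
        diffInd true (shiftC (trans a p) (c J))) (couplingLaw v) := fun p _ =>
      Integrable.of_bound (mD.comp (mt _)).aestronglyMeasurable 2 (Eventually.of_forall fun J => hD _)
    rw [← integral_finsetSum _ hi, ← integral_const_mul]
    -- The square has `4 a (2 a + 1)` edges but the average runs over `(2 a + 1) ^ 2` points. As `a
    -- ≥ 1`, a density of `1 / 100` still gives an average of at least `1 / 100`.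
    have hlow : ∫ J, U.indicator (fun _ => (1 / 100 : ℝ)) J ∂couplingLaw v ≤
        ∫ J, (((2 * a + 1) * (2 * a + 1) : ℝ))⁻¹ * ∑ p ∈ idx a,
          (diffInd false (shiftC (trans a p) (c J)) + diffInd true (shiftC (trans a p) (c J)))
          ∂couplingLaw v := by
      refine integral_mono_ae ((integrable_const _).indicator mU)
        ((integrable_finsetSum _ hi).const_mul _) ?_
      filter_upwards [ae_generic hv] with J hJ
      have hpos : (0 : ℝ) < (2 * a + 1) * (2 * a + 1) := by positivity
      by_cases h : J ∈ U
      · rw [Set.indicator_of_mem h]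
        have h1 := (hc J).2.2.2 hJ h
        have hpos' : 0 < (squareEdges (sideLen K)).ncard := by
          rw [ncard_squareEdges ha]; positivity
        rw [densityIn, le_div_iff₀ (by exact_mod_cast hpos'), ncard_squareEdges ha] at h1
        have h2 := ncard_differs_le ha (c J)
        rw [le_inv_mul_iff₀ hpos]
        refine le_trans ?_ (h1.trans h2)
        push_cast
        have : (1 : ℝ) ≤ a := by exact_mod_cast ha1
        nlinarith
      · rw [Set.indicator_of_notMem h]
        refine mul_nonneg (by positivity) (Finset.sum_nonneg fun p _ => ?_)
        exact add_nonneg (diffInd_mem _ _).1 (diffInd_mem _ _).1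
    rw [integral_indicator_const _ mU, smul_eq_mul] at hlow
    linarith


/-! ### The translation invariant limit -/

/-- The first marginal is fixed and the spins form a compact space. -/
lemma isTightMeasureSet_of_fst {S : Set (ProbabilityMeasure Config)} {μ : Measure Couplings}
    [IsFiniteMeasure μ] (h : ∀ ν ∈ S, (ν : Measure Config).map Prod.fst = μ) :
    IsTightMeasureSet {x | ∃ ν ∈ S, (ν : Measure Config) = x} := by
  refine IsTightMeasureSet.prodMk ?_ IsTightMeasureSet.of_compactSpace
  refine (isTightMeasureSet_singleton (μ := μ)).subset ?_
  rintro _ ⟨_, ⟨ν, hν, rfl⟩, rfl⟩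
  exact h ν hν

lemma integral_shiftC_eq {L : Filter ℕ} [L.NeBot] {νs : ℕ → ProbabilityMeasure Config}
    {ν : ProbabilityMeasure Config} (hν : Tendsto νs L (𝓝 ν)) {t : Vertex}
    (h : ∀ f : BoundedContinuousFunction Config ℝ, Tendsto (fun i =>
      ∫ ω, f (shiftC t ω) ∂(νs i : Measure Config) - ∫ ω, f ω ∂(νs i : Measure Config)) L (𝓝 0)) :
    MeasurePreserving (shiftC t) (ν : Measure Config) (ν : Measure Config) := by
  refine ⟨measurable_shiftC t, ?_⟩
  have : IsProbabilityMeasure ((ν : Measure Config).map (shiftC t)) :=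
    Measure.isProbabilityMeasure_map (measurable_shiftC t).aemeasurable
  refine ext_of_forall_integral_eq_of_IsFiniteMeasure fun f => ?_
  rw [integral_map (measurable_shiftC t).aemeasurable f.continuous.measurable.aestronglyMeasurable]
  have h1 := ProbabilityMeasure.tendsto_iff_forall_integral_tendsto.1 hν
  have h2 := (h1 (f.compContinuous ⟨shiftC t, continuous_shiftC t⟩)).sub (h1 f)
  exact sub_eq_zero.1 (tendsto_nhds_unique h2 (h f))

lemma ae_mem_of_tendsto {L : Filter ℕ} [L.NeBot] {νs : ℕ → ProbabilityMeasure Config}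
    {ν : ProbabilityMeasure Config} (hν : Tendsto νs L (𝓝 ν)) {F : Set Config} (hF : IsClosed F)
    (h : ∀ᶠ i in L, ∀ᵐ ω ∂(νs i : Measure Config), ω ∈ F) : ∀ᵐ ω ∂(ν : Measure Config), ω ∈ F := by
  have h1 := ProbabilityMeasure.limsup_measure_closed_le_of_tendsto hν hF
  have h2 : limsup (fun i => (νs i : Measure Config) F) L = 1 := by
    rw [limsup_congr (h.mono fun i hi => (mem_ae_iff_prob_eq_one hF.measurableSet).1 hi), limsup_const]
  rw [h2] at h1
  exact (mem_ae_iff_prob_eq_one hF.measurableSet).2 (le_antisymm prob_le_one h1)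

/-- The configurations in which both spin assignments minimize the energy locally. -/
def OptPairs : Set Config :=
  {ω | ∀ W : Finset Vertex, 0 ≤ ∑ e ∈ cutE W, bond ω.1 (spinsB ω.2.1) e ∧
    0 ≤ ∑ e ∈ cutE W, bond ω.1 (spinsB ω.2.2) e}

/-- Stability under each finite flip is a closed condition, valid for all large boxes; the mean
difference is the integral of a continuous function; translations change integrals by an amount that
tends to zero. All three survive in the limit. -/
lemma exists_invariant {v : ℝ≥0} (hv : v ≠ 0) {d : ℝ} {k₀ : ℕ} (hd : ∀ k, k₀ ≤ k →
    d ≤ (couplingLaw v).real (⋃ n, ⋃ _ : k ≤ n, R n k ∩ BA n k)) :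
    ∃ ν : Measure Config, IsProbabilityMeasure ν ∧ ν.map Prod.fst = couplingLaw v ∧
      (∀ᵐ ω ∂ν, ω ∈ OptPairs) ∧ MeasurePreserving (shiftC (1, 0)) ν ν ∧
      MeasurePreserving (shiftC (0, 1)) ν ν ∧
      d / 100 ≤ ∫ ω, (diffInd false ω + diffInd true ω) ∂ν := by
  choose νs h1 h2 h3 h4 using fun i : ℕ =>
    exists_approx hv (K := i + k₀ + 101) (by omega) (hd (i + k₀ + 101) (by omega))
  have hcomp : IsCompact (closure (Set.range νs)) := by
    refine isCompact_closure_of_isTightMeasureSet (isTightMeasureSet_of_fst (μ := couplingLaw v) ?_)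
    rintro _ ⟨i, rfl⟩
    exact h1 i
  obtain ⟨ν, -, hν⟩ := hcomp.ultrafilter_le_nhds ((hyperfilter ℕ).map νs) (by
    rw [le_principal_iff]
    exact mem_map.2 (Eventually.of_forall fun i => subset_closure ⟨i, rfl⟩))
  have hν' : Tendsto νs (hyperfilter ℕ : Filter ℕ) (𝓝 ν) := hν
  have hle : (hyperfilter ℕ : Filter ℕ) ≤ atTop := Nat.hyperfilter_le_atTop
  have hlim := ProbabilityMeasure.tendsto_iff_forall_integral_tendsto.1 hν'
  have hinv : ∀ t : Vertex, t = (1, 0) ∨ t = (0, 1) →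
      MeasurePreserving (shiftC t) (ν : Measure Config) (ν : Measure Config) := by
    intro t ht
    refine integral_shiftC_eq hν' fun f => ?_
    have hb : Tendsto (fun i : ℕ => 2 * ‖f‖ / ((i + k₀ + 101 : ℕ) : ℝ) ^ (1 / 100 : ℝ)) atTop (𝓝 0) := by
      refine tendsto_const_nhds.div_atTop ((tendsto_rpow_atTop (by norm_num)).comp ?_)
      exact tendsto_natCast_atTop_atTop.comp
        (tendsto_atTop_mono (fun i => by omega : ∀ i : ℕ, i ≤ i + k₀ + 101) tendsto_id)
    exact squeeze_zero_norm (fun i => h3 i f t ht) (hb.mono_left hle)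
  refine ⟨ν, inferInstance, ?_, ?_, hinv _ (.inl rfl), hinv _ (.inr rfl), ?_⟩
  · have : IsProbabilityMeasure ((ν : Measure Config).map Prod.fst) :=
      Measure.isProbabilityMeasure_map measurable_fst.aemeasurable
    refine ext_of_forall_integral_eq_of_IsFiniteMeasure fun f => ?_
    rw [integral_map measurable_fst.aemeasurable f.continuous.measurable.aestronglyMeasurable]
    refine tendsto_nhds_unique (hlim (f.compContinuous ⟨Prod.fst, continuous_fst⟩)) ?_
    refine tendsto_const_nhds.congr fun i => ?_
    rw [← h1 i, integral_map measurable_fst.aemeasurable f.continuous.measurable.aestronglyMeasurable]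
    rfl
  · refine ae_all_iff.2 fun W => ?_
    refine ae_mem_of_tendsto hν' (F := {ω | 0 ≤ ∑ e ∈ cutE W, bond ω.1 (spinsB ω.2.1) e ∧
      0 ≤ ∑ e ∈ cutE W, bond ω.1 (spinsB ω.2.2) e}) ?_ (hle ?_)
    · exact (isClosed_le continuous_const (continuous_sum_bond W (fun ω => ω.2.1) (by fun_prop))).inter
        (isClosed_le continuous_const (continuous_sum_bond W (fun ω => ω.2.2) (by fun_prop)))
    · obtain ⟨M, hM⟩ : ∃ M : ℕ, ∀ u ∈ W, |u.1| ≤ (M : ℤ) ∧ |u.2| ≤ (M : ℤ) := by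
        refine ⟨∑ u ∈ W, (u.1.natAbs + u.2.natAbs), fun u hu => ?_⟩
        have := Finset.single_le_sum (f := fun u : Vertex => u.1.natAbs + u.2.natAbs)
          (fun _ _ => Nat.zero_le _) hu
        simp only [Int.abs_eq_natAbs]
        omega
      filter_upwards [eventually_ge_atTop (2 * M + 102)] with i hi
      exact h2 i W M hM (by omega)
  · have hc : Continuous fun ω => diffInd false ω + diffInd true ω :=
      (continuous_diffInd _).add (continuous_diffInd _)
    let D : BoundedContinuousFunction Config ℝ :=
      BoundedContinuousFunction.ofNormedAddCommGroup _ hc 2 fun ω => by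
        have h1 := diffInd_mem false ω
        have h2 := diffInd_mem true ω
        rw [Real.norm_eq_abs, abs_le]
        constructor <;> linarith
    exact ge_of_tendsto (hlim D) (Eventually.of_forall fun i => h4 i)


/-! ### Densities and averages over squares -/

/-- The average of `D` over the square `[-a, a)²`. -/
def sqAvg (D : Vertex → ℝ) (a : ℕ) : ℝ :=
  (4 * a * a : ℝ)⁻¹ * ∑ u ∈ Finset.Ico (-(a : ℤ)) a ×ˢ Finset.Ico (-(a : ℤ)) a, D u

lemma sum_Ico_neg (g : ℤ → ℝ) (a : ℕ) : ∑ x ∈ Finset.Ico (-(a : ℤ)) a, g x =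
    ∑ i ∈ Finset.range a, (g i + g (-1 - i)) := by
  induction a with
  | zero => simp
  | succ a ih =>
    have h : Finset.Ico (-((a + 1 : ℕ) : ℤ)) (a + 1 : ℕ) =
        insert (-1 - (a : ℤ)) (insert (a : ℤ) (Finset.Ico (-(a : ℤ)) a)) := by
      ext x; simp only [Finset.mem_insert, Finset.mem_Ico]; omega
    rw [h, Finset.sum_insert, Finset.sum_insert, ih, Finset.sum_range_succ]
    · ring
    · simp
    · simp only [Finset.mem_insert, Finset.mem_Ico]; omega

lemma sum_square (D : Vertex → ℝ) (a : ℕ) :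
    ∑ u ∈ Finset.Ico (-(a : ℤ)) a ×ˢ Finset.Ico (-(a : ℤ)) a, D u =
    (∑ i ∈ Finset.range a, ∑ j ∈ Finset.range a, D (0 + 1 * i, 0 + 1 * j) +
      ∑ i ∈ Finset.range a, ∑ j ∈ Finset.range a, D (0 + 1 * i, -1 + -1 * j)) +
    (∑ i ∈ Finset.range a, ∑ j ∈ Finset.range a, D (-1 + -1 * i, 0 + 1 * j) +
      ∑ i ∈ Finset.range a, ∑ j ∈ Finset.range a, D (-1 + -1 * i, -1 + -1 * j)) := by
  rw [Finset.sum_product, sum_Ico_neg fun x => ∑ y ∈ Finset.Ico (-(a : ℤ)) a, D (x, y)]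
  simp only [sum_Ico_neg, Finset.sum_add_distrib, zero_add, one_mul, neg_mul, ← sub_eq_add_neg]

lemma abs_sum_sub_le {A B : Finset Vertex} {D : Vertex → ℝ} {C : ℕ} (hD : ∀ u, 0 ≤ D u ∧ D u ≤ 1)
    (hAB : A ⊆ B) (hC : B.card = A.card + C) : |∑ u ∈ B, D u - ∑ u ∈ A, D u| ≤ C := by
  rw [← Finset.sum_sdiff hAB, add_sub_cancel_right, abs_of_nonneg (Finset.sum_nonneg fun u _ => (hD u).1)]
  refine (Finset.sum_le_sum fun u _ => (hD u).2).trans ?_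
  rw [Finset.sum_const, Finset.card_sdiff_of_subset hAB, hC]
  simp

open Classical in
lemma densityIn_eq_sum {A : Set Edge} {L : ℝ} {a : ℕ} (ha : ⌊L / 2⌋ = a) : densityIn A L =
    (∑ u ∈ Finset.Ico (-(a : ℤ)) a ×ˢ Finset.Icc (-(a : ℤ)) a, (if (u, false) ∈ A then 1 else 0) +
    ∑ u ∈ Finset.Icc (-(a : ℤ)) a ×ˢ Finset.Ico (-(a : ℤ)) a, (if (u, true) ∈ A then 1 else 0)) /
    (4 * a * (2 * a + 1)) := by
  rw [densityIn, ncard_squareEdges ha]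
  push_cast
  congr 1
  have h : A ∩ squareEdges L = ↑((((Finset.Ico (-(a : ℤ)) a ×ˢ Finset.Icc (-(a : ℤ)) a) ×ˢ
      ({false} : Finset Bool)) ∪ ((Finset.Icc (-(a : ℤ)) a ×ˢ Finset.Ico (-(a : ℤ)) a) ×ˢ
      ({true} : Finset Bool))).filter (· ∈ A)) := by
    rw [squareEdges_eq_union ha]
    ext e
    rw [Set.mem_inter_iff, Finset.mem_coe, Finset.mem_coe, Finset.mem_filter, and_comm]
  rw [h, Set.ncard_coe_finset, Finset.card_filter,
    Finset.sum_union (disjoint_product_false_true _ _),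
    Finset.sum_product _ (({false} : Finset Bool)), Finset.sum_product _ (({true} : Finset Bool))]
  push_cast
  simp only [Finset.sum_singleton]

/-- The squares of real side `L` and of integer half side `a = ⌊L / 2⌋₊` differ only in boundary
edges, which are negligible. The factor `1 / 2` accounts for two edges per vertex. -/
lemma tendsto_densityIn {A : Set Edge} {D : Bool → Vertex → ℝ} {l : ℝ}
    (hA : ∀ b u, ((u, b) ∈ A ∧ D b u = 1) ∨ ((u, b) ∉ A ∧ D b u = 0))
    (h : Tendsto (fun a => sqAvg (D false) a + sqAvg (D true) a) atTop (𝓝 l)) :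
    Tendsto (densityIn A) atTop (𝓝 (l * (1 / 2))) := by
  classical
  have hD : ∀ b u, 0 ≤ D b u ∧ D b u ≤ 1 := fun b u => by
    rcases hA b u with ⟨-, h⟩ | ⟨-, h⟩ <;> rw [h] <;> norm_num
  have hif : ∀ b u, (if (u, b) ∈ A then 1 else 0) = D b u := fun b u => by
    rcases hA b u with ⟨h1, h⟩ | ⟨h1, h⟩ <;> simp [h1, h]
  have h2 : Tendsto (fun a : ℕ => (a : ℝ) / (2 * a + 1)) atTop (𝓝 (1 / 2)) := by
    have h3 : Tendsto (fun a : ℕ => 1 / 2 - 1 / 2 * (1 / (2 * a + 1 : ℝ))) atTop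
        (𝓝 (1 / 2 - 1 / 2 * 0)) := by
      refine tendsto_const_nhds.sub (tendsto_const_nhds.mul ?_)
      refine tendsto_const_nhds.div_atTop (tendsto_atTop_add_const_right _ _ ?_)
      exact tendsto_natCast_atTop_atTop.const_mul_atTop (by norm_num)
    rw [mul_zero, sub_zero] at h3
    refine h3.congr fun a => ?_
    have : (2 * a + 1 : ℝ) ≠ 0 := by positivity
    field_simp
    ring
  have hz : Tendsto (fun a : ℕ => 1 / (2 * a + 1 : ℝ)) atTop (𝓝 0) := by
    refine tendsto_const_nhds.div_atTop (tendsto_atTop_add_const_right _ _ ?_)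
    exact tendsto_natCast_atTop_atTop.const_mul_atTop (by norm_num)
  have hmain := (h.mul h2).comp ((tendsto_nat_floor_atTop (α := ℝ)).comp
    (tendsto_id.atTop_div_const (by norm_num : (0 : ℝ) < 2)))
  have hz' := hz.comp ((tendsto_nat_floor_atTop (α := ℝ)).comp
    (tendsto_id.atTop_div_const (by norm_num : (0 : ℝ) < 2)))
  have hdiff : Tendsto (fun L : ℝ => densityIn A L - (((fun a => sqAvg (D false) a +
      sqAvg (D true) a) ⌊L / 2⌋₊) * ((⌊L / 2⌋₊ : ℝ) / (2 * ⌊L / 2⌋₊ + 1)))) atTop (𝓝 0) := by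
    refine squeeze_zero_norm' ?_ hz'
    filter_upwards [eventually_ge_atTop 2] with L hL
    obtain ⟨a, ha⟩ : ∃ a : ℕ, a = ⌊L / 2⌋₊ := ⟨_, rfl⟩
    have ha1 : 1 ≤ a := by rw [ha, Nat.le_floor_iff (by linarith)]; push_cast; linarith
    have haL : ⌊L / 2⌋ = a := by rw [ha, Int.natCast_floor_eq_floor (by linarith)]
    have ha0 : (0 : ℝ) < a := by exact_mod_cast ha1
    simp only [id, Function.comp]
    rw [← ha, densityIn_eq_sum haL]
    simp only [hif]
    have c1 : ((a : ℤ) - -a).toNat = 2 * a := by omega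
    have c2 : ((a : ℤ) + 1 - -a).toNat = 2 * a + 1 := by omega
    have b1 := abs_sum_sub_le (C := 2 * a) (hD false) (Finset.product_subset_product_right
      (s := Finset.Ico (-(a : ℤ)) a) (Finset.Ico_subset_Icc_self (a := -(a : ℤ)) (b := a)))
      (by simp only [Finset.card_product, Int.card_Ico, Int.card_Icc, c1, c2]; ring)
    have b2 := abs_sum_sub_le (C := 2 * a) (hD true) (Finset.product_subset_product_left
      (t := Finset.Ico (-(a : ℤ)) a) (Finset.Ico_subset_Icc_self (a := -(a : ℤ)) (b := a)))
      (by simp only [Finset.card_product, Int.card_Ico, Int.card_Icc, c1, c2]; ring)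
    simp only [sqAvg]
    generalize ∑ u ∈ Finset.Ico (-(a : ℤ)) a ×ˢ Finset.Icc (-(a : ℤ)) a, D false u = S1 at *
    generalize ∑ u ∈ Finset.Icc (-(a : ℤ)) a ×ˢ Finset.Ico (-(a : ℤ)) a, D true u = S2 at *
    generalize ∑ u ∈ Finset.Ico (-(a : ℤ)) a ×ˢ Finset.Ico (-(a : ℤ)) a, D false u = S3 at *
    generalize ∑ u ∈ Finset.Ico (-(a : ℤ)) a ×ˢ Finset.Ico (-(a : ℤ)) a, D true u = S4 at *
    have e : (S1 + S2) / (4 * a * (2 * a + 1)) -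
        ((4 * a * a : ℝ)⁻¹ * S3 + (4 * a * a : ℝ)⁻¹ * S4) * (a / (2 * a + 1)) =
        ((S1 - S3) + (S2 - S4)) / (4 * a * (2 * a + 1)) := by
      field_simp
      ring
    rw [e, Real.norm_eq_abs, abs_div, abs_of_pos (by positivity : (0 : ℝ) < 4 * a * (2 * a + 1)),
      div_le_div_iff₀ (by positivity) (by positivity)]
    have b3 := (abs_add_le (S1 - S3) (S2 - S4)).trans (add_le_add b1 b2)
    push_cast at b3
    nlinarith
  refine (add_zero (l * (1 / 2)) ▸ hmain.add hdiff).congr fun L => ?_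
  simp

/-! ### Averages over squares of a translation invariant field -/

section Invariant

variable {ν : Measure Config}

/-- The translations that preserve the measure form a subgroup, and the two unit vectors generate.
-/
lemma measurePreserving_shiftC (h1 : MeasurePreserving (shiftC (1, 0)) ν ν)
    (h2 : MeasurePreserving (shiftC (0, 1)) ν ν) (t : Vertex) : MeasurePreserving (shiftC t) ν ν := by
  let H : AddSubgroup Vertex :=
    { carrier := {t | MeasurePreserving (shiftC t) ν ν}
      zero_mem' := by
        have : shiftC 0 = id := funext shiftC_zero
        simpa [this] using MeasurePreserving.id ν
      add_mem' := by
        intro s t hs ht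
        have : shiftC (s + t) = shiftC s ∘ shiftC t := funext fun ω => (shiftC_shiftC s t ω).symm
        simp only [Set.mem_ofPred_eq, this]
        exact MeasurePreserving.comp hs ht
      neg_mem' := by
        intro t ht
        have h : shiftC (-t) ∘ shiftC t = id := by
          funext ω
          simp [shiftC_shiftC, shiftC_zero]
        refine ⟨measurable_shiftC _, ?_⟩
        conv_lhs => rw [← (show MeasurePreserving (shiftC t) ν ν from ht).map_eq]
        rw [Measure.map_map (measurable_shiftC _) (measurable_shiftC _), h, Measure.map_id] }
  have ht : t = t.1 • ((1, 0) : Vertex) + t.2 • ((0, 1) : Vertex) := by ext <;> simp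
  have : t ∈ H := ht ▸ H.add_mem (H.zsmul_mem h1 _) (H.zsmul_mem h2 _)
  exact this

lemma iterate_shiftC (t : Vertex) (i : ℕ) (ω : Config) : (shiftC t)^[i] ω = shiftC (i • t) ω := by
  induction i with
  | zero => simp [shiftC_zero]
  | succ i ih => rw [Function.iterate_succ_apply', ih, shiftC_shiftC, succ_nsmul']

variable [IsProbabilityMeasure ν]

/-- The signs `ε`, `δ` select a quadrant. Four quadrants make up the centred square, whereas ergodic
averages only see forward orbits. -/
lemma ae_tendsto_quadrant (h : ∀ t, MeasurePreserving (shiftC t) ν ν) {g : Config → ℝ}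
    (mg : Measurable g) (hg : ∀ ω, 0 ≤ g ω ∧ g ω ≤ 1) (o₁ o₂ ε δ : ℤ) :
    ∀ᵐ ω ∂ν, ∃ l, Tendsto (fun n : ℕ => (n * n : ℝ)⁻¹ * ∑ i ∈ Finset.range n, ∑ j ∈ Finset.range n,
      g (shiftC (o₁ + ε * i, o₂ + δ * j) ω)) atTop (𝓝 l) := by
  filter_upwards [ae_tendsto_birkhoffAverage_two (h (ε, 0)) (h (0, δ))
    (mg.comp (measurable_shiftC (o₁, o₂))) fun ω => hg _] with ω ⟨l, hl⟩
  refine ⟨l, hl.congr fun n => ?_⟩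
  simp only [birkhoffAverage_eq, birkhoffSum, iterate_shiftC, Function.comp, shiftC_shiftC]
  rw [← Finset.mul_sum, ← mul_assoc, ← mul_inv, Finset.sum_comm]
  congr 1
  refine Finset.sum_congr rfl fun i _ => Finset.sum_congr rfl fun j _ => ?_
  congr 2
  simp [mul_comm]

lemma ae_tendsto_sqAvg (h : ∀ t, MeasurePreserving (shiftC t) ν ν) {g : Config → ℝ}
    (mg : Measurable g) (hg : ∀ ω, 0 ≤ g ω ∧ g ω ≤ 1) :
    ∀ᵐ ω ∂ν, ∃ l, Tendsto (sqAvg fun u => g (shiftC u ω)) atTop (𝓝 l) := by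
  filter_upwards [ae_tendsto_quadrant h mg hg 0 0 1 1, ae_tendsto_quadrant h mg hg 0 (-1) 1 (-1),
    ae_tendsto_quadrant h mg hg (-1) 0 (-1) 1, ae_tendsto_quadrant h mg hg (-1) (-1) (-1) (-1)]
    with ω ⟨l₁, h₁⟩ ⟨l₂, h₂⟩ ⟨l₃, h₃⟩ ⟨l₄, h₄⟩
  refine ⟨_, (((h₁.add h₂).add (h₃.add h₄)).const_mul (1 / 4)).congr fun n => ?_⟩
  rw [sqAvg, sum_square]
  simp only [mul_inv]
  ring

lemma integral_sqAvg (h : ∀ t, MeasurePreserving (shiftC t) ν ν) {g : Config → ℝ}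
    (mg : Measurable g) (hg : ∀ ω, 0 ≤ g ω ∧ g ω ≤ 1) {a : ℕ} (ha : 1 ≤ a) :
    ∫ ω, sqAvg (fun u => g (shiftC u ω)) a ∂ν = ∫ ω, g ω ∂ν := by
  simp only [sqAvg]
  have hi : ∀ u, Integrable (fun ω => g (shiftC u ω)) ν := fun u =>
    integrable_of_mem (mg.comp (measurable_shiftC u)) fun ω => hg _
  rw [integral_const_mul, integral_finsetSum _ fun u _ => hi u,
    Finset.sum_congr rfl fun u _ => integral_comp_of_measurePreserving (h u) mg]
  have c1 : ((a : ℤ) - -a).toNat = 2 * a := by omega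
  simp only [Finset.sum_const, Finset.card_product, Int.card_Ico, c1, nsmul_eq_mul]
  have : (0 : ℝ) < a := by exact_mod_cast ha
  push_cast
  field_simp
  ring

lemma sqAvg_mem {D : Vertex → ℝ} (hD : ∀ u, 0 ≤ D u ∧ D u ≤ 1) (a : ℕ) :
    0 ≤ sqAvg D a ∧ sqAvg D a ≤ 1 := by
  have h0 : 0 ≤ ∑ u ∈ Finset.Ico (-(a : ℤ)) a ×ˢ Finset.Ico (-(a : ℤ)) a, D u :=
    Finset.sum_nonneg fun u _ => (hD u).1
  refine ⟨mul_nonneg (by positivity) h0, inv_mul_le_one_of_le₀ ?_ (by positivity)⟩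
  refine (Finset.sum_le_sum fun u _ => (hD u).2).trans (le_of_eq ?_)
  have c1 : ((a : ℤ) - -a).toNat = 2 * a := by omega
  simp only [Finset.sum_const, Finset.card_product, Int.card_Ico, c1, nsmul_eq_mul]
  push_cast
  ring

lemma measurable_sqAvg {g : Config → ℝ} (mg : Measurable g) (a : ℕ) :
    Measurable fun ω => sqAvg (fun u => g (shiftC u ω)) a :=
  (Finset.measurable_sum _ fun u _ => mg.comp (measurable_shiftC u)).const_mul _

end Invariant

/-! ### Incongruent ground states -/

lemma isGroundState_of_mem_optPairs {ω : Config} (h : ω ∈ OptPairs) :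
    IsGroundState ω.1 (spinsB ω.2.1) ∧ IsGroundState ω.1 (spinsB ω.2.2) :=
  ⟨isGroundState_of_cut fun W => (h W).1, isGroundState_of_cut fun W => (h W).2⟩

lemma xor_satisfied_iff {ω : Config} (hω : ∀ e, ω.1 e ≠ 0) (e : Edge) :
    Xor (Satisfied ω.1 (spinsB ω.2.1) e) (Satisfied ω.1 (spinsB ω.2.2) e) ↔ Differs e ω := by
  rw [satisfied_iff (hω e), satisfied_iff (hω e), Differs]
  generalize agree (spinsB ω.2.1) e = a
  generalize agree (spinsB ω.2.2) e = b
  generalize sg ω.1 e = c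
  simp only [Xor]
  revert a b c
  decide

lemma incongruent_of_tendsto {ω : Config} (hω : ∀ e, ω.1 e ≠ 0) {l : ℝ} (hl : 0 < l)
    (h : Tendsto (fun a => sqAvg (fun u => diffInd false (shiftC u ω)) a +
      sqAvg (fun u => diffInd true (shiftC u ω)) a) atTop (𝓝 l)) :
    Incongruent ω.1 (spinsB ω.2.1) (spinsB ω.2.2) := by
  classical
  refine ⟨l * (1 / 2), by positivity, ?_⟩
  refine tendsto_densityIn (D := fun b u => diffInd b (shiftC u ω)) (fun b u => ?_) h
  rw [Set.mem_ofPred_eq, xor_satisfied_iff hω, diffInd_shiftC]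
  by_cases h : Differs (u, b) ω <;> simp [h]

/-- If the conclusion failed, almost every sample of the invariant measure would have a difference
of density zero. Dominated convergence would make the mean density vanish, although invariance keeps
it equal to a positive constant. -/
theorem mainConjecture_of_finiteConjecture {v : ℝ≥0} (hv : v ≠ 0) (hFC : FiniteConjecture v) :
    MainConjecture v := by
  obtain ⟨d, hd, k₀, -, hk₀⟩ := exists_measure_BA_ge hv hFC
  obtain ⟨ν, hν, hfst, hopt, hs1, hs2, hint⟩ := exists_invariant hv hk₀
  have hs := measurePreserving_shiftC hs1 hs2
  rw [MainConjecture, pos_iff_ne_zero]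
  intro h0
  have hnot := measure_eq_zero_iff_ae_notMem.1 h0
  rw [← hfst] at hnot
  have hne := ae_ne_zero hv
  rw [← hfst] at hne
  have m : ∀ b, Measurable (diffInd b) := fun b => (continuous_diffInd b).measurable
  let s : ℕ → Config → ℝ := fun a ω => sqAvg (fun u => diffInd false (shiftC u ω)) a +
    sqAvg (fun u => diffInd true (shiftC u ω)) a
  have hmem : ∀ b a ω, 0 ≤ sqAvg (fun u => diffInd b (shiftC u ω)) a ∧
      sqAvg (fun u => diffInd b (shiftC u ω)) a ≤ 1 := fun b a ω => sqAvg_mem (fun u => diffInd_mem b _) a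
  have hs0 : ∀ a ω, 0 ≤ s a ω := fun a ω => add_nonneg (hmem _ _ _).1 (hmem _ _ _).1
  -- The limit of the averages exists almost surely. A positive one would make the two ground states
  -- incongruent, which is excluded almost surely.
  have hzero : ∀ᵐ ω ∂ν, Tendsto (fun a => s a ω) atTop (𝓝 0) := by
    filter_upwards [ae_of_ae_map measurable_fst.aemeasurable hnot,
      ae_of_ae_map measurable_fst.aemeasurable hne, hopt,
      ae_tendsto_sqAvg hs (m false) (diffInd_mem false),
      ae_tendsto_sqAvg hs (m true) (diffInd_mem true)] with ω h1 h2 h3 ⟨l₁, h4⟩ ⟨l₂, h5⟩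
    have hlim := h4.add h5
    have hl0 : 0 ≤ l₁ + l₂ := ge_of_tendsto hlim (Eventually.of_forall fun a => hs0 a ω)
    rcases hl0.eq_or_lt with h | h
    · rw [h]; exact hlim
    · obtain ⟨g1, g2⟩ := isGroundState_of_mem_optPairs h3
      exact absurd ⟨_, _, g1, g2, incongruent_of_tendsto h2 h hlim⟩ h1
  have ms : ∀ a, Measurable (s a) := fun a =>
    (measurable_sqAvg (m false) a).add (measurable_sqAvg (m true) a)
  have hdom : Tendsto (fun a => ∫ ω, s a ω ∂ν) atTop (𝓝 (∫ _, (0 : ℝ) ∂ν)) := by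
    refine tendsto_integral_of_dominated_convergence (fun _ => 2)
      (fun a => (ms a).aestronglyMeasurable) (integrable_const _) (fun a => ?_) hzero
    refine Eventually.of_forall fun ω => ?_
    rw [Real.norm_eq_abs, abs_of_nonneg (hs0 a ω)]
    have h1 := (hmem false a ω).2
    have h2 := (hmem true a ω).2
    simp only [s]
    linarith
  rw [integral_zero] at hdom
  have hconst : ∀ᶠ a in atTop, ∫ ω, s a ω ∂ν = ∫ ω, (diffInd false ω + diffInd true ω) ∂ν := by
    filter_upwards [eventually_ge_atTop 1] with a ha
    simp only [s]
    rw [integral_add (integrable_of_mem (measurable_sqAvg (m false) a) (hmem false a))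
      (integrable_of_mem (measurable_sqAvg (m true) a) (hmem true a)),
      integral_sqAvg hs (m false) (diffInd_mem false) ha,
      integral_sqAvg hs (m true) (diffInd_mem true) ha,
      integral_add (integrable_of_mem (m false) (diffInd_mem false))
      (integrable_of_mem (m true) (diffInd_mem true))]
  have := tendsto_nhds_unique (hdom.congr' hconst) tendsto_const_nhds
  linarith

end SpinGlass

end

theorem theorem2 (v : NNReal) (hv : v ≠ 0) :
    SpinGlass.FiniteConjecture v → SpinGlass.MainConjecture v :=
  SpinGlass.mainConjecture_of_finiteConjecture hv
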